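/- **Notation.** Let $F$ be an $n$-simplex with ordered vertices $v_0,\dots,v_n$ and barycentric coordinates $\lambda_0,\dots,\lambda_n$. Faces inherit the ordering of the vertices. For $\alpha\in\mathbb N_0^{n+1}$ put $\lambda^\alpha=\prod_i\lambda_i^{\alpha_i}$ and $|\alpha|=\sum_i\alpha_i$. Let $\Sigma(k,n)$ and $\Sigma_0(k,n)$ be the sets of strictly ascending sequences of length $k$, respectively $k+1$, in $\{0,\dots,n\}$. For $\sigma\in\Sigma(k,n)$ put $d\lambda_\sigma=d\lambda_{\sigma(1)}\wedge\dots\wedge d\lambda_{\sigma(k)}$; for $\rho\in\Sigma_0(k,n)$ let $\phi_\rho=\sum_{i=0}^k(-1)^i\lambda_{\rho(i)}\,d\lambda_{\rho(0)}\wedge\dots\widehat{d\lambda_{\rho(i)}}\dots\wedge d\lambda_{\rho(k)}$. Let $\lambda_\sigma=\prod_i\lambda_{\sigma(i)}$ (likewise $\lambda_\rho$), let $\sigma^c\in\Sigma_0(n-k,n)$ be the complementary sequence, and let $\epsilon(\sigma,\sigma^c)$ be the sign of the permutation ordering $(\sigma,\sigma^c)$. For $\mathbb K\in\{\mathbb R,\mathbb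 C\}$ let $\mathbb K\mathcal P_r\Lambda^k(F)$ be the $\mathbb K$-span of the forms $\lambda^\alpha d\lambda_\sigma$ with $|\alpha|=r$, $\sigma\in\Sigma(k,n)$, and let $\mathbb K\mathcal P^-_r\Lambda^k(F)$ be the $\mathbb K$-span of the forms $\lambda^\alpha\phi_\rho$ with $|\alpha|=r-1$, $\rho\in\Sigma_0(k,n)$ (so it is $0$ for $r=0$). **Maps.** There are the following $\mathbb C$-linear maps; the first two are defined on $\mathbb C\mathcal P_r\Lambda^k(F)$ and on the span of the forms $\lambda^\alpha\lambda_{\sigma^c}d\lambda_\sigma$ with $|\alpha|=s-1$, respectively, and are injective: $$\mathcal I_r(\lambda^\alpha d\lambda_\sigma)=\epsilon(\sigma,\sigma^c)\lambda^\alpha\lambda_\sigma\phi_{\sigma^c}\ (|\alpha|=r),\qquad \mathcal J_s(\lambda^\alpha\lambda_{\sigma^c}d\lambda_\sigma)=\epsilon(\sigma,\sigma^c)\lambda^\alpha\phi_{\sigma^c}\ (|\alpha|=s-1).$$ For a face $G$ of $F$, let $\tilde\alpha$ denote the extension of a multiindex $\alpha$ of $G$ by zero and $\tilde\sigma,\tilde\rho$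 the sequences $\sigma,\rho$ in the numbering of the vertices of $F$. Then for $r\ge1$ $$\operatorname{ext}^{r}_{G,F}(\lambda_G^\alpha d\lambda^G_\sigma)=\lambda_F^{\tilde\alpha}\,\Psi_{\tilde\sigma(1)}\wedge\dots\wedge\Psi_{\tilde\sigma(k)},\quad \Psi_i=d\lambda^F_i-\tfrac{\tilde\alpha_i}{|\alpha|}\sum_{j\in G}d\lambda^F_j\quad(|\alpha|=r),$$ $$\operatorname{ext}^{r,-}_{G,F}(\lambda_G^\alpha\phi^G_\rho)=\lambda_F^{\tilde\alpha}\phi^F_{\tilde\rho}\quad(|\alpha|=r-1).$$ **Recursion.** For every simplex $F$ of dimension $n$ and every $k$ let $\mathcal A\mathcal P_0\Lambda^k(F)$ be a given set of forms such that, for $n\le1$ and $0\le k\le n$, it is a basis of the real space $\mathbb R\mathcal P_0\Lambda^k(F)$, and such that for $n=2$, $k=1$ $$\mathcal A\mathcal P_0\Lambda^1(F)=\{d\lambda_0+\xi d\lambda_1+\xi^2d\lambda_2,\ d\lambda_0+\xi^2d\lambda_1+\xi d\lambda_2\},\qquad \xi=e^{2\pi i/3}$$ (no other choice enters below). Define recursively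 for $0\le k\le n$, with the convention that $\mathcal A\mathcal P_s$ and $\mathcal A\mathcal P_s^-$ are empty for $s<0$, $$\mathcal A\mathring{\mathcal P}^-_r\Lambda^k(F)=\mathcal I_{r-n+k-1}\big(\mathcal A\mathcal P_{r-n+k-1}\Lambda^{n-k}(F)\big),\qquad \mathcal A\mathring{\mathcal P}_r\Lambda^k(F)=\mathcal J_{r-n+k}^{-1}\big(\mathcal A\mathcal P^-_{r-n+k}\Lambda^{n-k}(F)\big),$$ $$\mathcal A\mathcal P_r\Lambda^k(F)=\bigcup_{G\subseteq F}\operatorname{ext}^{r}_{G,F}\mathcal A\mathring{\mathcal P}_r\Lambda^k(G)\ (r\ge1),\qquad \mathcal A\mathcal P^-_r\Lambda^k(F)=\bigcup_{G\subseteq F}\operatorname{ext}^{r,-}_{G,F}\mathcal A\mathring{\mathcal P}^-_r\Lambda^k(G)\ (r\ge0),$$ where $G$ runs over the faces of $F$ (including $F$) of dimension at least $k$. A finite set $Q$ of complex-valued forms on $F$ is *$\mathbb K$-invariant* if for every affine automorphism $S$ of $F$ there are a permutation $\tau$ of $Q$ and non-zero numbers $\chi_\omega\in\mathbb K$ ($\omega\in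 Q$) with $S^*\omega=\chi_\omega\,\tau(\omega)$ for all $\omega\in Q$. **Theorem.** Let $T$ be a triangle and $r\in\mathbb N_0$. Then $\mathcal A\mathcal P_r\Lambda^1(T)$ and $\mathcal A\mathcal P^-_r\Lambda^1(T)$ are bases over $\mathbb C$ of $\mathbb C\mathcal P_r\Lambda^1(T)$ and $\mathbb C\mathcal P^-_r\Lambda^1(T)$, respectively, and: 1. $\mathcal A\mathcal P_r\Lambda^1(T)$ and $\mathcal A\mathcal P^-_r\Lambda^1(T)$ are $\mathbb C$-invariant; 2. $\mathcal A\mathcal P_r\Lambda^1(T)$ is $\mathbb R$-invariant if and only if $r\notin3\mathbb N_0$; 3. $\mathcal A\mathcal P^-_r\Lambda^1(T)$ is $\mathbb R$-invariant if and only if $r\notin3\mathbb N_0+2$. -/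

import Mathlib

/-! Polynomial differential forms on simplices and the recursively constructed bases. -/

noncomputable section

namespace FEEC

/-! ### Simplices, barycentric coordinates, differential forms -/

/-- The affine hull of the simplex `T`. -/
abbrev Hull {E : Type*} [AddCommGroup E] [Module ℝ E] {n : ℕ} (T : Affine.Simplex ℝ E n) :
    AffineSubspace ℝ E :=
  affineSpan ℝ (Set.range T.points)

/-- The tangent space of the simplex `T`. -/
abbrev Tangent {E : Type*} [AddCommGroup E] [Module ℝ E] {n : ℕ} (T : Affine.Simplex ℝ E n) :
    Submodule ℝ E :=
  (Hull T).direction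

/-- The simplex `T` as a set of points: the convex hull of its vertices, inside its affine hull. -/
def body {E : Type*} [AddCommGroup E] [Module ℝ E] {n : ℕ} (T : Affine.Simplex ℝ E n) :
    Set (Hull T) :=
  {x | (x : E) ∈ convexHull ℝ (Set.range T.points)}

/-- The vertices of `T`, as an affine basis of the affine hull of `T`. -/
def vertexBasis {E : Type*} [AddCommGroup E] [Module ℝ E] {n : ℕ} (T : Affine.Simplex ℝ E n) :
    AffineBasis (Fin (n + 1)) ℝ (Hull T) where
  toFun i := ⟨T.points i, mem_affineSpan ℝ (Set.mem_range_self i)⟩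
  ind' := AffineIndependent.of_comp (Hull T).subtype T.independent
  tot' := by
    have h := affineSpan_coe_preimage_eq_top (k := ℝ) (Set.range T.points)
    convert h using 2
    ext x
    constructor
    · rintro ⟨i, rfl⟩
      exact ⟨i, rfl⟩
    · rintro ⟨i, hi⟩
      exact ⟨i, Subtype.ext hi⟩

/-- The barycentric coordinate `λ_i` of `T`: the affine function with `λ_i (v_j) = δ_ij`. -/
def bary {E : Type*} [AddCommGroup E] [Module ℝ E] {n : ℕ} (T : Affine.Simplex ℝ E n)
    (i : Fin (n + 1)) : Hull T →ᵃ[ℝ] ℝ :=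
  (vertexBasis T).coord i

/-- The constant covector `dλ_i` on `T`, the differential (linear part) of `λ_i`. -/
def dbary {E : Type*} [AddCommGroup E] [Module ℝ E] {n : ℕ} (T : Affine.Simplex ℝ E n)
    (i : Fin (n + 1)) : Tangent T →ₗ[ℝ] ℝ :=
  (bary T i).linear

/-- Complex-valued differential `k`-forms on `T`: at every point of `T` an alternating `k`-linear
form on the tangent space. No regularity is imposed on this ambient space; all the forms below lie
in spaces of polynomial forms. -/
abbrev Form {E : Type*} [AddCommGroup E] [Module ℝ E] {n : ℕ} (T : Affine.Simplex ℝ E n) (k : ℕ) :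
    Type _ :=
  body T → (Tangent T) [⋀^Fin k]→ₗ[ℝ] ℂ

/-- The exterior product `f₁ ∧ ⋯ ∧ f_k` of real covectors: its value on `w₁, …, w_k` is the
determinant of the matrix `f_i (w_j)`. -/
def wedge {W : Type*} [AddCommGroup W] [Module ℝ W] {k : ℕ} (f : Fin k → W →ₗ[ℝ] ℝ) :
    W [⋀^Fin k]→ₗ[ℝ] ℝ :=
  (Matrix.detRowAlternating (n := Fin k) (R := ℝ)).compLinearMap (LinearMap.pi f)

/-- A form with real values, as a form with complex values. -/
def complexify {W : Type*} [AddCommGroup W] [Module ℝ W] {k : ℕ} (a : W [⋀^Fin k]→ₗ[ℝ] ℝ) :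
    W [⋀^Fin k]→ₗ[ℝ] ℂ :=
  (Complex.ofRealCLM : ℝ →ₗ[ℝ] ℂ).compAlternatingMap a

/-! ### Barycentric differential forms -/

/-- The barycentric monomial `λ^α`, as a function on `T`. -/
def mono {E : Type*} [AddCommGroup E] [Module ℝ E] {n : ℕ} (T : Affine.Simplex ℝ E n)
    (α : Fin (n + 1) → ℕ) (x : body T) : ℝ :=
  ∏ i, bary T i x ^ α i

/-- The product `∏_i λ_{ρ i}` over the members of a strictly ascending index. -/
def prodBary {E : Type*} [AddCommGroup E] [Module ℝ E] {n : ℕ} (T : Affine.Simplex ℝ E n) {m : ℕ}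
    (ρ : Fin m ↪o Fin (n + 1)) (x : body T) : ℝ :=
  ∏ i, bary T (ρ i) x

/-- The barycentric alternator `dλ_σ = dλ_{σ 1} ∧ ⋯ ∧ dλ_{σ k}`. -/
def alternator {E : Type*} [AddCommGroup E] [Module ℝ E] {n : ℕ} (T : Affine.Simplex ℝ E n)
    {k : ℕ} (σ : Fin k → Fin (n + 1)) : Form T k :=
  fun _ => complexify (wedge fun i => dbary T (σ i))

/-- The Whitney form
`φ_ρ = ∑_i (-1)^i λ_{ρ i} dλ_{ρ 0} ∧ ⋯ ∧ dλ_{ρ (i-1)} ∧ dλ_{ρ (i+1)} ∧ ⋯ ∧ dλ_{ρ k}`. -/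
def whitney {E : Type*} [AddCommGroup E] [Module ℝ E] {n : ℕ} (T : Affine.Simplex ℝ E n)
    {k : ℕ} (ρ : Fin (k + 1) → Fin (n + 1)) : Form T k :=
  fun x => ∑ i : Fin (k + 1),
    ((-1 : ℝ) ^ (i : ℕ) * bary T (ρ i) x) • alternator T (fun j => ρ (i.succAbove j)) x

/-- The product of a real function and a form. -/
def fmul {E : Type*} [AddCommGroup E] [Module ℝ E] {n : ℕ} {T : Affine.Simplex ℝ E n} {k : ℕ}
    (f : body T → ℝ) (ω : Form T k) : Form T k :=
  fun x => f x • ω x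

/-- The canonical spanning set `{λ^α dλ_σ : |α| = r}` of the forms of polynomial degree `r`. -/
def spanningP {E : Type*} [AddCommGroup E] [Module ℝ E] {n : ℕ} (r : ℕ)
    (T : Affine.Simplex ℝ E n) (k : ℕ) : Set (Form T k) :=
  {ω | ∃ (α : Fin (n + 1) → ℕ) (σ : Fin k ↪o Fin (n + 1)),
    ∑ i, α i = r ∧ ω = fmul (mono T α) (alternator T σ)}

/-- The canonical spanning set `{λ^α φ_ρ : |α| = r - 1}` of the higher order Whitney forms
(empty for `r = 0`). -/
def spanningPminus {E : Type*} [AddCommGroup E] [Module ℝ E] {n : ℕ} (r : ℕ)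
    (T : Affine.Simplex ℝ E n) (k : ℕ) : Set (Form T k) :=
  {ω | ∃ (α : Fin (n + 1) → ℕ) (ρ : Fin (k + 1) ↪o Fin (n + 1)),
    ∑ i, α i + 1 = r ∧ ω = fmul (mono T α) (whitney T ρ)}

/-- The space `𝕂P_r Λ^k(T)`, for `𝕂 = ℝ` or `𝕂 = ℂ`. -/
def spaceP (𝕂 : Type*) [Semiring 𝕂] [Module 𝕂 ℂ] [SMulCommClass ℝ 𝕂 ℂ] {E : Type*}
    [AddCommGroup E] [Module ℝ E] {n : ℕ} (r : ℕ) (T : Affine.Simplex ℝ E n) (k : ℕ) :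
    Submodule 𝕂 (Form T k) :=
  Submodule.span 𝕂 (spanningP r T k)

/-- The space `𝕂P⁻_r Λ^k(T)`, for `𝕂 = ℝ` or `𝕂 = ℂ`. -/
def spacePminus (𝕂 : Type*) [Semiring 𝕂] [Module 𝕂 ℂ] [SMulCommClass ℝ 𝕂 ℂ] {E : Type*}
    [AddCommGroup E] [Module ℝ E] {n : ℕ} (r : ℕ) (T : Affine.Simplex ℝ E n) (k : ℕ) :
    Submodule 𝕂 (Form T k) :=
  Submodule.span 𝕂 (spanningPminus r T k)

/-- The set `Q` is a basis, over `𝕂`, of the subspace `W`. -/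
def IsBasisOf (𝕂 : Type*) [Semiring 𝕂] {V : Type*} [AddCommMonoid V] [Module 𝕂 V]
    (Q : Set V) (W : Submodule 𝕂 V) : Prop :=
  LinearIndepOn 𝕂 id Q ∧ Submodule.span 𝕂 Q = W

/-! ### Simplicial symmetries and invariant sets -/

/-- The symmetry group `Sym(T)`: the affine automorphisms (of the affine hull) mapping `T` onto
itself. -/
def Symmetry {E : Type*} [AddCommGroup E] [Module ℝ E] {n : ℕ} (T : Affine.Simplex ℝ E n) :
    Type _ :=
  {S : Hull T ≃ᵃ[ℝ] Hull T // S '' body T = body T}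

/-- The pullback `S^* ω` of a form along a symmetry. -/
def pullback {E : Type*} [AddCommGroup E] [Module ℝ E] {n : ℕ} {T : Affine.Simplex ℝ E n} {k : ℕ}
    (S : Symmetry T) (ω : Form T k) : Form T k :=
  fun x => (ω ⟨S.1 x, S.2.subset (Set.mem_image_of_mem _ x.2)⟩).compLinearMap
    (S.1.linear : Tangent T →ₗ[ℝ] Tangent T)

/-- A finite set `Q` of forms on `T` is `𝕂`-invariant if every symmetry of `T` permutes its members
up to non-zero factors in `𝕂`. -/
def IsInvariant (𝕂 : Type*) [Semiring 𝕂] [Module 𝕂 ℂ] [SMulCommClass ℝ 𝕂 ℂ] {E : Type*}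
    [AddCommGroup E] [Module ℝ E] {n : ℕ} {T : Affine.Simplex ℝ E n} {k : ℕ}
    (Q : Set (Form T k)) : Prop :=
  Q.Finite ∧ ∀ S : Symmetry T, ∃ (τ : Equiv.Perm Q) (χ : Q → 𝕂),
    ∀ ω : Q, χ ω ≠ 0 ∧ pullback S (ω : Form T k) = χ ω • (τ ω : Form T k)

/-! ### Canonical isomorphisms and extension operators

Each of these linear maps is prescribed on a spanning set of its domain. It is represented by its
graph, the linear span of the prescribed pairs (argument, value). -/

/-- The sign of the permutation that puts a sequence of distinct numbers in ascending order, that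
is, `-1` to the number of inversions. -/
def seqSign {N M : ℕ} (f : Fin N → Fin M) : ℤ :=
  ∏ i, ∏ j ∈ Finset.Ioi i, if f i < f j then 1 else -1

/-- The graph of `I_{k,r} : P_r Λ^k(T) → P̊⁻_{r+k+1} Λ^l(T)`, where `k + l = n`, given by
`λ^α dλ_σ ↦ ε(σ, σᶜ) λ^α λ_σ φ_{σᶜ}`. -/
def graphI {E : Type*} [AddCommGroup E] [Module ℝ E] {n : ℕ} (r : ℕ) (T : Affine.Simplex ℝ E n)
    (k l : ℕ) : Submodule ℂ (Form T k × Form T l) :=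
  Submodule.span ℂ {p | ∃ (α : Fin (n + 1) → ℕ) (σ : Fin k ↪o Fin (n + 1))
    (ρ : Fin (l + 1) ↪o Fin (n + 1)),
    ∑ i, α i = r ∧ IsCompl (Set.range σ) (Set.range ρ) ∧
    p = (fmul (mono T α) (alternator T σ),
      seqSign (Fin.append σ ρ) • fmul (mono T α) (fmul (prodBary T σ) (whitney T ρ)))}

/-- The graph of `J : P̊_{s+l} Λ^k(T) → P⁻_s Λ^l(T)`, where `k + l = n`, given by
`λ^α λ_{σᶜ} dλ_σ ↦ ε(σ, σᶜ) λ^α φ_{σᶜ}` for `|α| = s - 1`. -/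
def graphJ {E : Type*} [AddCommGroup E] [Module ℝ E] {n : ℕ} (s : ℕ) (T : Affine.Simplex ℝ E n)
    (k l : ℕ) : Submodule ℂ (Form T k × Form T l) :=
  Submodule.span ℂ {p | ∃ (α : Fin (n + 1) → ℕ) (σ : Fin k ↪o Fin (n + 1))
    (ρ : Fin (l + 1) ↪o Fin (n + 1)),
    ∑ i, α i + 1 = s ∧ IsCompl (Set.range σ) (Set.range ρ) ∧
    p = (fmul (mono T α) (fmul (prodBary T ρ) (alternator T σ)),
      seqSign (Fin.append σ ρ) • fmul (mono T α) (whitney T ρ))}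

/-- The form `Ψ_σ^{α,F,T} = Ψ_{σ 1} ∧ ⋯ ∧ Ψ_{σ k}` on `T`, for the subsimplex `F` with vertex set
`fs`, where `Ψ_i = dλ_i - (α_i / |α|) ∑_{j ∈ fs} dλ_j`. -/
def psi {E : Type*} [AddCommGroup E] [Module ℝ E] {n : ℕ} (T : Affine.Simplex ℝ E n)
    (fs : Finset (Fin (n + 1))) (α : Fin (n + 1) → ℕ) {k : ℕ} (σ : Fin k → Fin (n + 1)) :
    Form T k :=
  fun _ => complexify (wedge fun i =>
    dbary T (σ i) - ((α (σ i) : ℝ) / ∑ j, (α j : ℝ)) • ∑ j ∈ fs, dbary T j)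

/-- The graph of the extension operator `ext^{r,k}_{F,T}` for the spaces `P_r Λ^k`, given by
`λ_F^α dλ^F_σ ↦ λ_T^α̃ Ψ_σ̃^{α̃,F,T}`; here `F = T.face h` is the subsimplex with vertex set `fs`,
`α̃` is the extension of `α` by zero, and `σ̃` is `σ` in the numbering of `T`. -/
def graphExt {E : Type*} [AddCommGroup E] [Module ℝ E] {n m : ℕ} (r : ℕ)
    (T : Affine.Simplex ℝ E n) {fs : Finset (Fin (n + 1))} (h : fs.card = m + 1) (k : ℕ) :
    Submodule ℂ (Form (T.face h) k × Form T k) :=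
  Submodule.span ℂ {p | ∃ (α : Fin (m + 1) → ℕ) (σ : Fin k ↪o Fin (m + 1)), ∑ i, α i = r ∧
    p = (fmul (mono (T.face h) α) (alternator (T.face h) σ),
      fmul (mono T (Function.extend (fs.orderEmbOfFin h) α 0))
        (psi T fs (Function.extend (fs.orderEmbOfFin h) α 0) (fs.orderEmbOfFin h ∘ σ)))}

/-- The graph of the extension operator `ext^{r,k,-}_{F,T}` for the spaces `P⁻_r Λ^k`, given by
`λ_F^α φ^F_ρ ↦ λ_T^α̃ φ^T_ρ̃` for `|α| = r - 1`. -/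
def graphExtMinus {E : Type*} [AddCommGroup E] [Module ℝ E] {n m : ℕ} (r : ℕ)
    (T : Affine.Simplex ℝ E n) {fs : Finset (Fin (n + 1))} (h : fs.card = m + 1) (k : ℕ) :
    Submodule ℂ (Form (T.face h) k × Form T k) :=
  Submodule.span ℂ {p | ∃ (α : Fin (m + 1) → ℕ) (ρ : Fin (k + 1) ↪o Fin (m + 1)),
    ∑ i, α i + 1 = r ∧
    p = (fmul (mono (T.face h) α) (whitney (T.face h) ρ),
      fmul (mono T (Function.extend (fs.orderEmbOfFin h) α 0))
        (whitney T (fs.orderEmbOfFin h ∘ ρ)))}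

/-- The image of the set `Q` under the map with graph `G`. -/
def imageOf {V W : Type*} [AddCommGroup V] [Module ℂ V] [AddCommGroup W] [Module ℂ W]
    (G : Submodule ℂ (V × W)) (Q : Set V) : Set W :=
  {w | ∃ v ∈ Q, (v, w) ∈ G}

/-- The image of the set `Q` under the inverse of the map with graph `G`. -/
def inverseImageOf {V W : Type*} [AddCommGroup V] [Module ℂ V] [AddCommGroup W] [Module ℂ W]
    (G : Submodule ℂ (V × W)) (Q : Set W) : Set V :=
  {v | ∃ w ∈ Q, (v, w) ∈ G}

/-! ### The recursive construction -/

mutual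

/-- The basis `AP_r Λ^k(T)`. For `r = 0` it is the given basis `B T k` of the constant forms; for
`r > 0` it is the union of the sets `ext_{F,T} AP̊_r Λ^k(F)` over all subsimplices `F` of `T`. -/
def basisP {E : Type*} [AddCommGroup E] [Module ℝ E]
    (B : ∀ {n : ℕ} (T : Affine.Simplex ℝ E n) (k : ℕ), Set (Form T k))
    (r : ℕ) {n : ℕ} (T : Affine.Simplex ℝ E n) (k : ℕ) : Set (Form T k) :=
  if r = 0 then B T k
  else ⋃ (m : ℕ) (fs : Finset (Fin (n + 1))) (h : fs.card = m + 1),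
    imageOf (graphExt r T h k) (basisPring B r (T.face h) k)
termination_by 4 * r + 3

/-- The basis `AP⁻_r Λ^k(T)`: the union of the sets `ext⁻_{F,T} AP̊⁻_r Λ^k(F)` over all
subsimplices `F` of `T`. -/
def basisPminus {E : Type*} [AddCommGroup E] [Module ℝ E]
    (B : ∀ {n : ℕ} (T : Affine.Simplex ℝ E n) (k : ℕ), Set (Form T k))
    (r : ℕ) {n : ℕ} (T : Affine.Simplex ℝ E n) (k : ℕ) : Set (Form T k) :=
  ⋃ (m : ℕ) (fs : Finset (Fin (n + 1))) (h : fs.card = m + 1),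
    imageOf (graphExtMinus r T h k) (basisPminusRing B r (T.face h) k)
termination_by 4 * r + 1

/-- The basis `AP̊_r Λ^k(T) = J⁻¹ (AP⁻_s Λ^l(T))`, where `k + l = n` and `s = r - l`
(empty if `r < l`). -/
def basisPring {E : Type*} [AddCommGroup E] [Module ℝ E]
    (B : ∀ {n : ℕ} (T : Affine.Simplex ℝ E n) (k : ℕ), Set (Form T k))
    (r : ℕ) {n : ℕ} (T : Affine.Simplex ℝ E n) (k : ℕ) : Set (Form T k) :=
  ⋃ (l : ℕ) (s : ℕ) (_ : k + l = n) (_ : s + l = r),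
    inverseImageOf (graphJ s T k l) (basisPminus B s T l)
termination_by 4 * r + 2

/-- The basis `AP̊⁻_r Λ^k(T) = I (AP_s Λ^l(T))`, where `k + l = n` and `s = r - l - 1`
(empty if `r < l + 1`). -/
def basisPminusRing {E : Type*} [AddCommGroup E] [Module ℝ E]
    (B : ∀ {n : ℕ} (T : Affine.Simplex ℝ E n) (k : ℕ), Set (Form T k))
    (r : ℕ) {n : ℕ} (T : Affine.Simplex ℝ E n) (k : ℕ) : Set (Form T k) :=
  ⋃ (l : ℕ) (s : ℕ) (_ : k + l = n) (_ : s + l + 1 = r),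
    imageOf (graphI s T l k) (basisP B s T l)
termination_by 4 * r

end

/-! ### The basis of the constant `1`-forms on a triangle -/

/-- The primitive cube root of unity `ξ = exp(2πi/3)`. -/
def xi : ℂ := Complex.exp (2 * Complex.I * Real.pi / 3)

/-- The constant `1`-form `dλ_i`. -/
def dform {E : Type*} [AddCommGroup E] [Module ℝ E] {n : ℕ} (T : Affine.Simplex ℝ E n)
    (i : Fin (n + 1)) : Form T 1 :=
  alternator T ![i]

/-- The two forms `dλ₀ + ξ dλ₁ + ξ² dλ₂` and `dλ₀ + ξ² dλ₁ + ξ dλ₂` on a triangle. -/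
def triangleBasis {E : Type*} [AddCommGroup E] [Module ℝ E] (T : Affine.Simplex ℝ E 2) :
    Set (Form T 1) :=
  {dform T 0 + xi • dform T 1 + xi ^ 2 • dform T 2,
   dform T 0 + xi ^ 2 • dform T 1 + xi • dform T 2}

end FEEC

namespace FEEC

variable {E : Type*} [AddCommGroup E] [Module ℝ E] {n : ℕ}

/-! ### Barycentric coordinates -/

-- On a point every barycentric monomial is 1, and on an edge `φ_01 = dλ₁ = -dλ₀`. Hence in
-- dimension at most one all maps of the recursion carry monomial forms to real multiples of
-- monomial forms, and the recursive sets are, up to non-zero real factors, the monomials `λ^α` or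
-- `λ^α dλ₁`, whatever real bases are given in degree 0. The relation `Lines Q S N` records this
-- agreement together with a bound on the number of members (`lines_point`, `lines_edge`). Extended
-- to the triangle, the edges contribute the forms `edgeP` and `edgeM`, which symmetries permute.
--
-- In the interior of the triangle both canonical isomorphisms come from a single pointwise linear
-- map `starMap`: it sends `dλ_i` to `λ_i φ_{i+1,i+2}` and `φ_{i+1,i+2}` to `-λ_{i+1} λ_{i+2} dλ_i`,
-- indices modulo 3. So it is the map I, and its negative is the inverse of J. It commutes with
-- rotations of the triangle and anticommutes with reflections. The recursion becomes: `basisP (r +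
-- 1)` is edge forms together with `-starMap` of `basisPminus r`, and `basisPminus (r + 2)` is edge
-- forms together with `starMap` of `basisP r`.
--
-- Bases: both recursions preserve the property of spanning (`spaceP_succ_le`,
-- `spacePminus_succ_le`), and they bound the cardinalities by `(r + 1)(r + 2)` and `r (r + 2)`.
-- Independence of the monomial forms bounds the dimension of `P_r Λ¹` from below by the first
-- number, which makes the spanning sets independent.
--
-- Invariance: the composite of the two recursions raises `r` by 3. Therefore the complex forms of
-- `triangleBasis` enter `basisP r` only for `r` divisible by 3, and `basisPminus r` only for `r`
-- congruent to 2; in the other degrees everything is built from real edge forms. The two given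
-- forms are permuted by symmetries up to cube roots of unity, and this passes through `starMap`.
-- Conversely, in the exceptional degrees the images of `dλ₀ + ξ dλ₁ + ξ² dλ₂` are eigenforms of a
-- rotation with the non-real eigenvalue `ξ²`, which excludes real factors. The predicate `MapsLines
-- K`, with `K` an intermediate field of `ℂ` over `ℝ`, treats the real and complex cases together.

theorem bary_vertexBasis (T : Affine.Simplex ℝ E n) (i j : Fin (n + 1)) :
    bary T i (vertexBasis T j) = if i = j then 1 else 0 :=
  (vertexBasis T).coord_apply i j

theorem sum_bary (T : Affine.Simplex ℝ E n) (x : Hull T) : ∑ i, bary T i x = 1 :=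
  (vertexBasis T).sum_coord_apply_eq_one x

theorem dbary_vsub (T : Affine.Simplex ℝ E n) (i : Fin (n + 1)) (x y : Hull T) :
    dbary T i (x -ᵥ y) = bary T i x - bary T i y :=
  (bary T i).linearMap_vsub x y

theorem sum_dbary (T : Affine.Simplex ℝ E n) : ∑ i, dbary T i = 0 := by
  ext w
  have h : w = (w +ᵥ vertexBasis T 0) -ᵥ vertexBasis T 0 := (vadd_vsub _ _).symm
  rw [h, LinearMap.sum_apply]
  simp only [dbary_vsub, Finset.sum_sub_distrib, sum_bary, sub_self, LinearMap.zero_apply]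

theorem sum_dbary_apply (T : Affine.Simplex ℝ E n) (w : Tangent T) : ∑ i, dbary T i w = 0 := by
  rw [← LinearMap.sum_apply, sum_dbary, LinearMap.zero_apply]

theorem coe_affineCombination_vertexBasis (T : Affine.Simplex ℝ E n) (s : Finset (Fin (n + 1)))
    (w : Fin (n + 1) → ℝ) (hw : ∑ i ∈ s, w i = 1) :
    ((s.affineCombination ℝ (vertexBasis T) w : Hull T) : E) =
      s.affineCombination ℝ T.points w :=
  s.map_affineCombination (vertexBasis T) w hw (Hull T).subtype

theorem bary_nonneg (T : Affine.Simplex ℝ E n) (i : Fin (n + 1)) {x : Hull T} (hx : x ∈ body T) :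
    0 ≤ bary T i x := by
  have hx' : (x : E) ∈ convexHull ℝ (Set.range T.points) := hx
  rw [convexHull_range_eq_exists_affineCombination] at hx'
  obtain ⟨s, w, h0, h1, h2⟩ := hx'
  rw [← coe_affineCombination_vertexBasis T s w h1] at h2
  rw [← Subtype.ext h2]
  by_cases hi : i ∈ s
  · exact (h0 i hi).trans_eq ((vertexBasis T).coord_apply_combination_of_mem hi h1).symm
  · exact ((vertexBasis T).coord_apply_combination_of_notMem hi h1).symm.le

theorem exists_mem_body (T : Affine.Simplex ℝ E n) (y : Fin (n + 1) → ℝ) (h0 : ∀ i, 0 ≤ y i)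
    (h1 : ∑ i, y i = 1) : ∃ x : body T, ∀ i, bary T i x = y i := by
  refine ⟨⟨Finset.univ.affineCombination ℝ (vertexBasis T) y, ?_⟩, fun i =>
    (vertexBasis T).coord_apply_combination_of_mem (Finset.mem_univ i) h1⟩
  change (_ : E) ∈ convexHull ℝ (Set.range T.points)
  rw [convexHull_range_eq_exists_affineCombination]
  exact ⟨Finset.univ, y, fun i _ => h0 i, h1, (coe_affineCombination_vertexBasis T _ y h1).symm⟩

theorem vertexBasis_mem_body (T : Affine.Simplex ℝ E n) (i : Fin (n + 1)) :
    vertexBasis T i ∈ body T :=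
  subset_convexHull ℝ _ (Set.mem_range_self i)

/-! ### Linear independence of the barycentric monomials -/

theorem mono_coeff_eq_zero (T : Affine.Simplex ℝ E n) (r : ℕ) (s : Finset (Fin (n + 1) → ℕ))
    (hs : ∀ α ∈ s, ∑ i, α i = r) (c : (Fin (n + 1) → ℕ) → ℂ)
    (h : ∀ x : body T, ∑ α ∈ s, c α * (mono T α x : ℂ) = 0) : ∀ α ∈ s, c α = 0 := by
  let p : MvPolynomial (Fin (n + 1)) ℂ :=
    ∑ α ∈ s, MvPolynomial.monomial (Finsupp.equivFunOnFinite.symm α) (c α)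
  have hp : p = 0 := by
    -- A point `y` of the open positive orthant, divided by its coordinate sum, gives the
    -- barycentric coordinates of a point of the simplex. Since `p` is homogeneous of degree `r`, it
    -- vanishes at `y` itself, and a polynomial vanishing on a product of infinite sets is zero.
    refine MvPolynomial.funext_set (fun _ => (fun t : ℝ => (t : ℂ)) '' Set.Ioi 0)
      (fun _ => (Set.Ioi_infinite (0 : ℝ)).image (Complex.ofReal_injective.injOn)) ?_
    intro z hz
    choose y hy hyz using fun i => hz i (Set.mem_univ i)
    obtain rfl : (fun i => (y i : ℂ)) = z := funext hyz
    have hS : 0 < ∑ i, y i := Finset.sum_pos (fun i _ => hy i) Finset.univ_nonempty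
    obtain ⟨x, hx⟩ := exists_mem_body T (fun i => y i / ∑ j, y j)
      (fun i => div_nonneg (le_of_lt (hy i)) hS.le)
      (by rw [← Finset.sum_div, div_self hS.ne'])
    have h2 := h x
    have h3 : ∀ α ∈ s, c α * (∏ i, (y i : ℂ) ^ α i) =
        ((∑ i, y i : ℝ) : ℂ) ^ r * (c α * (mono T α x : ℂ)) := by
      intro α hα
      have : mono T α x * (∑ i, y i) ^ r = ∏ i, y i ^ α i := by
        simp only [mono, hx, div_pow, Finset.prod_div_distrib]
        rw [Finset.prod_pow_eq_pow_sum, hs α hα, div_mul_cancel₀ _ (pow_ne_zero _ hS.ne')]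
      have h4 : ((mono T α x : ℝ) : ℂ) * ((∑ i, y i : ℝ) : ℂ) ^ r = ∏ i, (y i : ℂ) ^ α i := by
        exact_mod_cast congrArg Complex.ofReal this
      rw [← h4]; ring
    have h5 : MvPolynomial.eval (fun i => (y i : ℂ)) p = ∑ α ∈ s, c α * ∏ i, (y i : ℂ) ^ α i := by
      simp [p, MvPolynomial.eval_monomial, Finsupp.prod_fintype]
    rw [h5, Finset.sum_congr rfl h3, ← Finset.mul_sum, h2, mul_zero, map_zero]
  intro α hα
  have h6 : MvPolynomial.coeff (Finsupp.equivFunOnFinite.symm α) p = c α := by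
    simp only [p, MvPolynomial.coeff_sum, MvPolynomial.coeff_monomial,
      Finsupp.equivFunOnFinite.symm.injective.eq_iff]
    simp [hα]
  rw [← h6, hp, MvPolynomial.coeff_zero]

/-- Monomials of one degree times linearly independent constant forms are linearly independent. -/
theorem linearIndependent_mono_smul (T : Affine.Simplex ℝ E n) (r k : ℕ) {ι : Type*}
    {η : ι → (Tangent T) [⋀^Fin k]→ₗ[ℝ] ℂ} (hη : LinearIndependent ℂ η) :
    LinearIndependent ℂ (fun p : {α : Fin (n + 1) → ℕ // ∑ i, α i = r} × ι =>
      (fmul (mono T p.1) (fun _ => η p.2) : Form T k)) := by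
  classical
  rw [linearIndependent_iff']
  intro s c hc ⟨α, i⟩ hp
  -- Extending the coefficients by zero turns the sum over `s` into a double sum over the product of
  -- its projections. At a fixed point the independence of `η` then separates the inner sums.
  let c' : (Fin (n + 1) → ℕ) → ι → ℂ := fun β j =>
    if h : ∑ i, β i = r then (if (⟨β, h⟩, j) ∈ s then c (⟨β, h⟩, j) else 0) else 0
  let s₁ : Finset (Fin (n + 1) → ℕ) := s.image fun p => p.1.1
  let s₂ : Finset ι := s.image fun p => p.2
  have key : ∀ x : body T, ∀ j ∈ s₂, ∑ β ∈ s₁, c' β j * (mono T β x : ℂ) = 0 := by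
    intro x
    refine linearIndependent_iff'.1 hη s₂ _ ?_
    have h1 := congrFun hc x
    have h2 : ∑ j ∈ s₂, (∑ β ∈ s₁, c' β j * (mono T β x : ℂ)) • η j =
        ∑ p ∈ s₁ ×ˢ s₂, (c' p.1 p.2 * (mono T p.1 x : ℂ)) • η p.2 := by
      rw [Finset.sum_product_right]
      exact Finset.sum_congr rfl fun j _ => Finset.sum_smul
    rw [h2, ← (show _ = (0 : (Tangent T) [⋀^Fin k]→ₗ[ℝ] ℂ) from h1), Finset.sum_apply]
    symm
    refine Finset.sum_of_injOn (fun p => (p.1.1, p.2)) ?_ ?_ ?_ ?_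
    · rintro ⟨⟨a, ha⟩, b⟩ _ ⟨⟨a', ha'⟩, b'⟩ _ h
      simpa using h
    · intro p hp
      simp only [Finset.coe_product, Set.mem_prod, Finset.mem_coe]
      exact ⟨Finset.mem_image_of_mem (fun p => p.1.1) hp, Finset.mem_image_of_mem (fun p => p.2) hp⟩
    · rintro ⟨β, j⟩ _ hn
      have : c' β j = 0 := by
        simp only [c']
        split_ifs with h h'
        · exact absurd ⟨_, h', rfl⟩ hn
        · rfl
        · rfl
      simp [this]
    · rintro ⟨⟨a, ha⟩, b⟩ hab
      ext v
      simp [c', ha, hab, fmul, mul_assoc]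
  have h3 := mono_coeff_eq_zero T r (s₁.filter fun β => ∑ i, β i = r)
    (fun β hβ => (Finset.mem_filter.1 hβ).2) (fun β => c' β i) (fun x => ?_) α.1
    (Finset.mem_filter.2 ⟨Finset.mem_image_of_mem (fun p => p.1.1) hp, α.2⟩)
  · simpa [c', α.2, hp] using h3
  · rw [Finset.sum_filter_of_ne, key x i (Finset.mem_image_of_mem (fun p => p.2) hp)]
    intro β _ hne
    by_contra hβ
    simp [c', hβ] at hne

end FEEC

namespace FEEC

/-! ### Sets that agree up to real factors -/

section Lines

variable {V W : Type*} [AddCommGroup V] [Module ℂ V] [AddCommGroup W] [Module ℂ W]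

/-- The sets `Q` and `S` have the same members up to non-zero real factors, and `Q` has at most
`N` members. -/
structure Lines (Q S : Set V) (N : ℕ∞) : Prop where
  encard_le : Q.encard ≤ N
  exists_eq : ∀ q ∈ Q, ∃ c : ℝ, c ≠ 0 ∧ ∃ s ∈ S, q = (c : ℂ) • s
  exists_mem : ∀ s ∈ S, ∃ c : ℝ, c ≠ 0 ∧ (c : ℂ) • s ∈ Q

theorem Lines.mono_card {Q S : Set V} {N M : ℕ∞} (h : Lines Q S N) (hNM : N ≤ M) : Lines Q S M :=
  ⟨h.1.trans hNM, h.2, h.3⟩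

theorem Lines.empty (N : ℕ∞) : Lines (∅ : Set V) ∅ N :=
  ⟨by simp, by simp, by simp⟩

theorem Lines.union {Q S Q' S' : Set V} {N N' : ℕ∞} (h : Lines Q S N) (h' : Lines Q' S' N') :
    Lines (Q ∪ Q') (S ∪ S') (N + N') := by
  refine ⟨(Set.encard_union_le _ _).trans (add_le_add h.1 h'.1), ?_, ?_⟩
  · rintro q (hq | hq)
    · obtain ⟨c, hc, s, hs, e⟩ := h.2 q hq
      exact ⟨c, hc, s, Or.inl hs, e⟩
    · obtain ⟨c, hc, s, hs, e⟩ := h'.2 q hq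
      exact ⟨c, hc, s, Or.inr hs, e⟩
  · rintro q (hq | hq)
    · obtain ⟨c, hc, s⟩ := h.3 q hq
      exact ⟨c, hc, Or.inl s⟩
    · obtain ⟨c, hc, s⟩ := h'.3 q hq
      exact ⟨c, hc, Or.inr s⟩

theorem Lines.congr {Q S S' : Set V} {N : ℕ∞} (h : Lines Q S N)
    (h₁ : ∀ s ∈ S, ∃ c : ℝ, c ≠ 0 ∧ ∃ s' ∈ S', s = (c : ℂ) • s')
    (h₂ : ∀ s' ∈ S', ∃ c : ℝ, c ≠ 0 ∧ ∃ s ∈ S, s' = (c : ℂ) • s) : Lines Q S' N := by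
  refine ⟨h.1, fun q hq => ?_, fun s' hs' => ?_⟩
  · obtain ⟨c, hc, s, hs, rfl⟩ := h.2 q hq
    obtain ⟨c', hc', s', hs', rfl⟩ := h₁ s hs
    exact ⟨c * c', mul_ne_zero hc hc', s', hs', by rw [smul_smul]; push_cast; rfl⟩
  · obtain ⟨c, hc, s, hs, rfl⟩ := h₂ s' hs'
    obtain ⟨d, hd, hm⟩ := h.3 s hs
    refine ⟨d / c, div_ne_zero hd hc, ?_⟩
    rw [smul_smul]
    push_cast
    rwa [div_mul_cancel₀ _ (by exact_mod_cast hc)]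

theorem Lines.span_eq {Q S : Set V} {N : ℕ∞} (h : Lines Q S N) :
    Submodule.span ℂ Q = Submodule.span ℂ S := by
  apply le_antisymm
  · rw [Submodule.span_le]
    intro q hq
    obtain ⟨c, -, s, hs, rfl⟩ := h.2 q hq
    exact Submodule.smul_mem _ _ (Submodule.subset_span hs)
  · rw [Submodule.span_le]
    intro s hs
    obtain ⟨c, hc, hm⟩ := h.3 s hs
    have := Submodule.smul_mem (Submodule.span ℂ Q) (c : ℂ)⁻¹ (Submodule.subset_span hm)
    rwa [inv_smul_smul₀ (by exact_mod_cast hc)] at this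

theorem Lines.image {Q S : Set V} {N : ℕ∞} (h : Lines Q S N) (L : V →ₗ[ℂ] W) :
    Lines (L '' Q) (L '' S) N := by
  refine ⟨(Set.encard_image_le _ _).trans h.1, ?_, ?_⟩
  · rintro _ ⟨q, hq, rfl⟩
    obtain ⟨c, hc, s, hs, rfl⟩ := h.2 q hq
    exact ⟨c, hc, L s, ⟨s, hs, rfl⟩, by simp⟩
  · rintro _ ⟨s, hs, rfl⟩
    obtain ⟨c, hc, hm⟩ := h.3 s hs
    exact ⟨c, hc, _, hm, by simp⟩

/-- A relation given as the span of prescribed pairs need be neither single-valued nor total. `hG`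
puts it inside the graph of `L`, and `hD` with `hQ` puts `Q` inside its domain. -/
theorem imageOf_eq_image {G : Submodule ℂ (V × W)} {Q : Set V} {D : Set V} (L : V →ₗ[ℂ] W)
    (hG : ∀ p ∈ G, p.2 = L p.1) (hD : ∀ v ∈ D, ∃ w, (v, w) ∈ G)
    (hQ : Q ⊆ Submodule.span ℂ D) : imageOf G Q = L '' Q := by
  have hdom : ∀ v ∈ Q, (v, L v) ∈ G := by
    intro v hv
    have h1 : Submodule.span ℂ D ≤ G.comap (LinearMap.id.prod L) := by
      rw [Submodule.span_le]
      intro d hd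
      obtain ⟨w, hw⟩ := hD d hd
      have h2 := hG _ hw
      simp only at h2
      rw [h2] at hw
      exact hw
    exact h1 (hQ hv)
  ext w
  constructor
  · rintro ⟨v, hv, hvw⟩
    exact ⟨v, hv, (hG _ hvw).symm⟩
  · rintro ⟨v, hv, rfl⟩
    exact ⟨v, hv, hdom v hv⟩

theorem inverseImageOf_eq_image {G : Submodule ℂ (V × W)} {Q : Set W} {D : Set W} (L : W →ₗ[ℂ] V)
    (hG : ∀ p ∈ G, p.1 = L p.2) (hD : ∀ w ∈ D, ∃ v, (v, w) ∈ G)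
    (hQ : Q ⊆ Submodule.span ℂ D) : inverseImageOf G Q = L '' Q := by
  have := imageOf_eq_image (G := G.map (LinearEquiv.prodComm ℂ V W).toLinearMap) (Q := Q) (D := D) L
    (by rintro _ ⟨p, hp, rfl⟩; exact hG p hp)
    (fun w hw => (hD w hw).imp fun v hv => ⟨_, hv, rfl⟩) hQ
  rw [← this]
  ext v
  constructor
  · rintro ⟨w, hw, h⟩
    exact ⟨w, hw, _, h, rfl⟩
  · rintro ⟨w, hw, ⟨a, b⟩, h, e⟩
    obtain ⟨rfl, rfl⟩ : b = w ∧ a = v := by simpa using e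
    exact ⟨b, hw, h⟩

theorem exists_linearMap_of_linearIndependent {ι : Type*} (I : Set ι) (v : ι → V) (w : ι → W)
    (hv : LinearIndependent ℂ fun i : I => v i) : ∃ L : V →ₗ[ℂ] W, ∀ i ∈ I, L (v i) = w i := by
  obtain ⟨L, hL⟩ := LinearMap.exists_extend
    ((Module.Basis.span hv).constr ℂ fun i : I => w i)
  refine ⟨L, fun i hi => ?_⟩
  have h1 := LinearMap.congr_fun hL (Module.Basis.span hv ⟨i, hi⟩)
  rw [Module.Basis.constr_basis] at h1
  simpa [Module.Basis.span_apply] using h1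

/-- The image of a set of multiples of linearly independent `v i` under a relation spanned by
multiples of the pairs `(v i, w i)`. -/
theorem Lines.imageOf {ι : Type*} {I : Set ι} {v : ι → V} {w : ι → W} {P : Set (V × W)}
    {Q : Set V} {N : ℕ∞} (h : Lines Q (v '' I) N) (hv : LinearIndependent ℂ fun i : I => v i)
    (hP : ∀ p ∈ P, ∃ i ∈ I, ∃ c : ℂ, p = (c • v i, c • w i))
    (hm : ∀ i ∈ I, (v i, w i) ∈ Submodule.span ℂ P) :
    Lines (imageOf (Submodule.span ℂ P) Q) (w '' I) N := by
  obtain ⟨L, hL⟩ := exists_linearMap_of_linearIndependent I v w hv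
  rw [imageOf_eq_image (D := v '' I) L]
  · have := h.image L
    rwa [Set.image_image, Set.image_congr hL] at this
  · intro p hp
    have h1 : Submodule.span ℂ P ≤ LinearMap.graph L := by
      rw [Submodule.span_le]
      intro p hp
      obtain ⟨i, hi, c, rfl⟩ := hP p hp
      simp [LinearMap.mem_graph_iff, hL i hi]
    exact h1 hp
  · rintro _ ⟨i, hi, rfl⟩
    exact ⟨_, hm i hi⟩
  · rw [← h.span_eq]
    exact Submodule.subset_span

/-- Here the independence of the values `w i` makes the inverse relation a map. -/
theorem Lines.inverseImageOf {ι : Type*} {I : Set ι} {v : ι → V} {w : ι → W} {P : Set (V × W)}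
    {Q : Set W} {N : ℕ∞} (h : Lines Q (w '' I) N) (hw : LinearIndependent ℂ fun i : I => w i)
    (hP : ∀ p ∈ P, ∃ i ∈ I, ∃ c : ℂ, p = (c • v i, c • w i))
    (hm : ∀ i ∈ I, (v i, w i) ∈ Submodule.span ℂ P) :
    Lines (inverseImageOf (Submodule.span ℂ P) Q) (v '' I) N := by
  obtain ⟨L, hL⟩ := exists_linearMap_of_linearIndependent I w v hw
  rw [inverseImageOf_eq_image (D := w '' I) L]
  · have := h.image L
    rwa [Set.image_image, Set.image_congr hL] at this
  · intro p hp
    have h1 : Submodule.span ℂ P ≤ (LinearMap.graph L).comap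
        (LinearEquiv.prodComm ℂ V W).toLinearMap := by
      rw [Submodule.span_le]
      intro p hp
      obtain ⟨i, hi, c, rfl⟩ := hP p hp
      simp [LinearMap.mem_graph_iff, hL i hi]
    exact h1 hp
  · rintro _ ⟨i, hi, rfl⟩
    exact ⟨_, hm i hi⟩
  · rw [← h.span_eq]
    exact Submodule.subset_span

/-- Two distinct real multiples of `v` are dependent, so a real basis of a real line is one non-zero
multiple of `v`. This is how the unspecified bases of constant forms on points and edges are
controlled. -/
theorem Lines.of_isBasisOf {Q : Set V} [Module ℝ V] [IsScalarTower ℝ ℂ V] {v : V} (hv : v ≠ 0)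
    (h : IsBasisOf ℝ Q (Submodule.span ℝ {v})) : Lines Q {v} 1 := by
  obtain ⟨hli, hsp⟩ := h
  have hsmul : ∀ (c : ℝ) (u : V), (c : ℂ) • u = c • u := fun c u =>
    algebraMap_smul ℂ c u
  have hmul : ∀ q ∈ Q, ∃ c : ℝ, c ≠ 0 ∧ q = c • v := by
    intro q hq
    have h1 : q ∈ Submodule.span ℝ {v} := hsp ▸ Submodule.subset_span hq
    obtain ⟨c, rfl⟩ := Submodule.mem_span_singleton.1 h1
    refine ⟨c, ?_, rfl⟩
    rintro rfl
    exact hli.ne_zero hq (zero_smul _ _)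
  refine ⟨?_, fun q hq => ?_, ?_⟩
  · rw [Set.encard_le_one_iff]
    intro p q hp hq
    by_contra hne
    obtain ⟨a, ha, rfl⟩ := hmul p hp
    obtain ⟨b, hb, rfl⟩ := hmul q hq
    have h1 := (LinearIndepOn.pair_iff id hne).1
      (hli.mono (Set.insert_subset hp (Set.singleton_subset_iff.2 hq))) b (-a)
      (by simp only [id]; module)
    exact hb h1.1
  · obtain ⟨c, hc, e⟩ := hmul q hq
    exact ⟨c, hc, v, rfl, by rw [hsmul, e]⟩
  · rintro _ rfl
    have hne : Q.Nonempty := by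
      by_contra hQ
      rw [Set.not_nonempty_iff_eq_empty.1 hQ, Submodule.span_empty] at hsp
      exact hv ((Submodule.mem_bot ℝ).1 (hsp ▸ Submodule.mem_span_singleton_self _))
    obtain ⟨q, hq⟩ := hne
    obtain ⟨c, hc, e⟩ := hmul q hq
    exact ⟨c, hc, by rwa [hsmul, ← e]⟩

end Lines

end FEEC

namespace FEEC

variable {E : Type*} [AddCommGroup E] [Module ℝ E] {n : ℕ}

/-! ### Evaluation of barycentric forms of low degree -/

theorem Form.ext {T : Affine.Simplex ℝ E n} {k : ℕ} {ω η : Form T k}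
    (h : ∀ (x : body T) (v : Fin k → Tangent T), ω x v = η x v) : ω = η :=
  funext fun x => AlternatingMap.ext (h x)

theorem fmul_apply {T : Affine.Simplex ℝ E n} {k : ℕ} (f : body T → ℝ) (ω : Form T k)
    (x : body T) (v : Fin k → Tangent T) : fmul f ω x v = (f x : ℂ) * ω x v := by
  simp [fmul]

theorem complexify_wedge_zero {W : Type*} [AddCommGroup W] [Module ℝ W] (f : Fin 0 → W →ₗ[ℝ] ℝ)
    (v : Fin 0 → W) : complexify (wedge f) v = 1 := by
  change ((Matrix.det (Matrix.of fun i j : Fin 0 => f j (v i)) : ℝ) : ℂ) = 1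
  simp

theorem complexify_wedge_one {W : Type*} [AddCommGroup W] [Module ℝ W] (f : Fin 1 → W →ₗ[ℝ] ℝ)
    (v : Fin 1 → W) : complexify (wedge f) v = (f 0 (v 0) : ℂ) := by
  change ((Matrix.det (Matrix.of fun i j : Fin 1 => f j (v i)) : ℝ) : ℂ) = _
  rw [Matrix.det_fin_one]
  rfl

theorem alternator_zero_apply (T : Affine.Simplex ℝ E n) (σ : Fin 0 → Fin (n + 1)) (x : body T)
    (v : Fin 0 → Tangent T) : alternator T σ x v = 1 :=
  complexify_wedge_zero _ v

theorem alternator_one_apply (T : Affine.Simplex ℝ E n) (σ : Fin 1 → Fin (n + 1)) (x : body T)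
    (v : Fin 1 → Tangent T) : alternator T σ x v = (dbary T (σ 0) (v 0) : ℂ) :=
  complexify_wedge_one _ v

theorem dform_apply (T : Affine.Simplex ℝ E n) (i : Fin (n + 1)) (x : body T)
    (v : Fin 1 → Tangent T) : dform T i x v = (dbary T i (v 0) : ℂ) :=
  alternator_one_apply T ![i] x v

theorem psi_zero_apply (T : Affine.Simplex ℝ E n) (fs : Finset (Fin (n + 1)))
    (α : Fin (n + 1) → ℕ) (σ : Fin 0 → Fin (n + 1)) (x : body T) (v : Fin 0 → Tangent T) :
    psi T fs α σ x v = 1 :=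
  complexify_wedge_zero _ v

theorem psi_one_apply (T : Affine.Simplex ℝ E n) (fs : Finset (Fin (n + 1)))
    (α : Fin (n + 1) → ℕ) (σ : Fin 1 → Fin (n + 1)) (x : body T) (v : Fin 1 → Tangent T) :
    psi T fs α σ x v = (dbary T (σ 0) (v 0) : ℂ) -
      (α (σ 0) / ∑ j, (α j : ℂ)) * ∑ j ∈ fs, (dbary T j (v 0) : ℂ) := by
  refine (complexify_wedge_one _ v).trans ?_
  simp

/-- The correction term in `Ψ_i` is a multiple of the sum of all `dλ_j`, which vanishes. Hence
extension from the whole simplex to itself is the identity. -/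
theorem psi_univ (T : Affine.Simplex ℝ E n) (α : Fin (n + 1) → ℕ) {k : ℕ}
    (σ : Fin k → Fin (n + 1)) : psi T Finset.univ α σ = alternator T σ := by
  funext x
  change complexify (wedge fun i => dbary T (σ i) -
    ((α (σ i) : ℝ) / ∑ j, (α j : ℝ)) • ∑ j, dbary T j) = _
  simp only [sum_dbary, smul_zero, sub_zero]
  rfl

theorem whitney_zero_apply (T : Affine.Simplex ℝ E n) (ρ : Fin (0 + 1) → Fin (n + 1)) (x : body T)
    (v : Fin 0 → Tangent T) : whitney T ρ x v = (bary T (ρ 0) x : ℂ) := by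
  simp [whitney, alternator_zero_apply]

theorem whitney_one_apply (T : Affine.Simplex ℝ E n) (ρ : Fin (1 + 1) → Fin (n + 1)) (x : body T)
    (v : Fin 1 → Tangent T) : whitney T ρ x v =
      bary T (ρ 0) x * (dbary T (ρ 1) (v 0) : ℂ) - bary T (ρ 1) x * dbary T (ρ 0) (v 0) := by
  simp [whitney, Fin.sum_univ_two, alternator_one_apply]
  ring

/-! ### Index combinatorics -/

theorem isCompl_range_iff {k l N : ℕ} (σ : Fin k → Fin N) (ρ : Fin l → Fin N) :
    IsCompl (Set.range σ) (Set.range ρ) ↔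
      (∀ i j, σ i ≠ ρ j) ∧ ∀ x, (∃ i, σ i = x) ∨ ∃ j, ρ j = x := by
  have h : Codisjoint (Set.range σ) (Set.range ρ) ↔ Set.range σ ∪ Set.range ρ = Set.univ :=
    codisjoint_iff
  rw [isCompl_iff, Set.disjoint_left, h, Set.eq_univ_iff_forall]
  simp [eq_comm]

/-- The empty index. -/
def emb0 (N : ℕ) : Fin 0 ↪o Fin N := OrderEmbedding.ofStrictMono ![] (fun i => i.elim0)

/-- The index of length one with the given member. -/
def emb1 {N : ℕ} (i : Fin N) : Fin 1 ↪o Fin N :=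
  OrderEmbedding.ofStrictMono ![i] (fun a b h => absurd h (by omega))

/-- The index of length two with the given members. -/
def emb2 {N : ℕ} {i j : Fin N} (h : i < j) : Fin 2 ↪o Fin N :=
  OrderEmbedding.ofStrictMono ![i, j] (by
    rw [Fin.strictMono_iff_lt_succ]
    intro a
    fin_cases a
    exact h)

theorem seqSign_zero_one (σ : Fin 0 → Fin 1) (ρ : Fin (0 + 1) → Fin 1) :
    seqSign (Fin.append σ ρ) = 1 := by
  rw [show Fin.append σ ρ = fun _ => 0 from Subsingleton.elim _ _]
  decide

theorem seqSign_one_one (σ : Fin 1 → Fin 2) (ρ : Fin (0 + 1) → Fin 2) :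
    seqSign (Fin.append σ ρ) = if σ 0 < ρ 0 then 1 else -1 := by
  have h : Fin.append σ ρ = ![σ 0, ρ 0] := by
    ext i
    fin_cases i <;> rfl
  rw [h]
  generalize σ 0 = a
  generalize ρ 0 = b
  revert a b
  decide

theorem seqSign_zero_two (σ : Fin 0 → Fin 2) (ρ : Fin (1 + 1) → Fin 2) :
    seqSign (Fin.append σ ρ) = if ρ 0 < ρ 1 then 1 else -1 := by
  have h : Fin.append σ ρ = ![ρ 0, ρ 1] := by
    ext i
    fin_cases i <;> rfl
  change seqSign (N := 2) _ = _
  rw [h]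
  generalize ρ 0 = a
  generalize ρ 1 = b
  revert a b
  decide

theorem seqSign_one_two (σ : Fin 1 → Fin 3) (ρ : Fin (1 + 1) → Fin 3) :
    seqSign (Fin.append σ ρ) = (if σ 0 < ρ 0 then 1 else -1) * (if σ 0 < ρ 1 then 1 else -1) *
      (if ρ 0 < ρ 1 then 1 else -1) := by
  have h : Fin.append σ ρ = ![σ 0, ρ 0, ρ 1] := by
    ext i
    fin_cases i <;> rfl
  change seqSign (N := 3) _ = _
  rw [h]
  generalize σ 0 = c
  generalize ρ 0 = a
  generalize ρ 1 = b
  revert a b c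
  decide

theorem orderEmbOfFin_singleton {N : ℕ} {fs : Finset (Fin N)} (h : fs.card = 0 + 1) {i : Fin N}
    (hfs : fs = {i}) : (fs.orderEmbOfFin h : Fin 1 → Fin N) = ![i] := by
  symm
  apply Finset.orderEmbOfFin_unique
  · intro x
    fin_cases x
    simp [hfs]
  · exact (emb1 i).strictMono

theorem orderEmbOfFin_pair {N : ℕ} {fs : Finset (Fin N)} (h : fs.card = 1 + 1) {i j : Fin N}
    (hij : i < j) (hfs : fs = {i, j}) : (fs.orderEmbOfFin h : Fin 2 → Fin N) = ![i, j] := by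
  symm
  apply Finset.orderEmbOfFin_unique
  · intro x
    fin_cases x <;> simp [hfs]
  · exact (emb2 hij).strictMono

theorem orderEmbOfFin_full {N : ℕ} {fs : Finset (Fin N)} (h : fs.card = N) :
    (fs.orderEmbOfFin h : Fin N → Fin N) = id := by
  symm
  apply Finset.orderEmbOfFin_unique
  · intro x
    rw [(Finset.card_eq_iff_eq_univ fs).1 (h.trans (Fintype.card_fin N).symm)]
    exact Finset.mem_univ _
  · exact strictMono_id

/-! ### The subsimplex that is the whole simplex -/

theorem face_full (T : Affine.Simplex ℝ E n) {fs : Finset (Fin (n + 1))} (h : fs.card = n + 1) :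
    T.face h = T := by
  ext i
  rw [Affine.Simplex.face_points, orderEmbOfFin_full]
  rfl

theorem extend_id_zero {ι : Type*} (α : ι → ℕ) : Function.extend id α 0 = α := by
  ext i
  exact Function.injective_id.extend_apply α 0 i

/-- `T.face h` equals `T` only propositionally and the type of forms depends on it. For this reason
`X` is a family over all simplices, and the equality is eliminated through the variable `T'` in
`key`. -/
theorem imageOf_graphExt_full {r k : ℕ} (T : Affine.Simplex ℝ E n) {fs : Finset (Fin (n + 1))}
    (h : fs.card = n + 1) (X : ∀ T' : Affine.Simplex ℝ E n, Set (Form T' k))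
    (hX : X T ⊆ spaceP ℂ r T k) : imageOf (graphExt r T h k) (X (T.face h)) = X T := by
  have key : ∀ T', T' = T → imageOf (Submodule.span ℂ {p : Form T' k × Form T k |
      ∃ (α : Fin (n + 1) → ℕ) (σ : Fin k ↪o Fin (n + 1)), ∑ i, α i = r ∧
      p = (fmul (mono T' α) (alternator T' σ), fmul (mono T α) (alternator T σ))}) (X T')
      = X T := by
    rintro _ rfl
    rw [imageOf_eq_image LinearMap.id ?_ ?_ hX]
    · simp
    · intro p hp
      refine Submodule.span_induction ?_ rfl ?_ ?_ hp
      · rintro _ ⟨α, σ, _, rfl⟩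
        rfl
      · rintro p q - - hp hq
        simp_all
      · rintro c p - hp
        simp_all
    · rintro _ ⟨α, σ, hα, rfl⟩
      exact ⟨_, Submodule.subset_span ⟨α, σ, hα, rfl⟩⟩
  have hfs : fs = Finset.univ :=
    (Finset.card_eq_iff_eq_univ fs).1 (h.trans (Fintype.card_fin _).symm)
  rw [← key _ (face_full T h)]
  unfold graphExt
  simp only [orderEmbOfFin_full, extend_id_zero, Function.id_comp, hfs, psi_univ]

theorem imageOf_graphExtMinus_full {r k : ℕ} (T : Affine.Simplex ℝ E n) {fs : Finset (Fin (n + 1))}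
    (h : fs.card = n + 1) (X : ∀ T' : Affine.Simplex ℝ E n, Set (Form T' k))
    (hX : X T ⊆ spacePminus ℂ r T k) : imageOf (graphExtMinus r T h k) (X (T.face h)) = X T := by
  have key : ∀ T', T' = T → imageOf (Submodule.span ℂ {p : Form T' k × Form T k |
      ∃ (α : Fin (n + 1) → ℕ) (σ : Fin (k + 1) ↪o Fin (n + 1)), ∑ i, α i + 1 = r ∧
      p = (fmul (mono T' α) (whitney T' σ), fmul (mono T α) (whitney T σ))}) (X T')
      = X T := by
    rintro _ rfl
    rw [imageOf_eq_image LinearMap.id ?_ ?_ hX]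
    · simp
    · intro p hp
      refine Submodule.span_induction ?_ rfl ?_ ?_ hp
      · rintro _ ⟨α, σ, _, rfl⟩
        rfl
      · rintro p q - - hp hq
        simp_all
      · rintro c p - hp
        simp_all
    · rintro _ ⟨α, σ, hα, rfl⟩
      exact ⟨_, Submodule.subset_span ⟨α, σ, hα, rfl⟩⟩
  rw [← key _ (face_full T h)]
  unfold graphExtMinus
  simp only [orderEmbOfFin_full, extend_id_zero, Function.id_comp]

/-! ### Monomial forms on points and edges -/

theorem mono_add (T : Affine.Simplex ℝ E n) (α β : Fin (n + 1) → ℕ) (x : body T) :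
    mono T (α + β) x = mono T α x * mono T β x := by
  simp [mono, pow_add, Finset.prod_mul_distrib]

theorem mono_single (T : Affine.Simplex ℝ E n) (i : Fin (n + 1)) (a : ℕ) (x : body T) :
    mono T (Pi.single i a) x = bary T i x ^ a := by
  rw [mono, Finset.prod_eq_single i]
  · simp
  · intro j _ hj
    simp [hj]
  · simp

theorem mono_one (T : Affine.Simplex ℝ E n) (x : body T) :
    mono T 1 x = ∏ i, bary T i x := by
  simp [mono]

/-- The `0`-form `λ^α`. -/
def m0 (T : Affine.Simplex ℝ E n) (α : Fin (n + 1) → ℕ) : Form T 0 :=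
  fmul (mono T α) (alternator T ![])

/-- The `1`-form `λ^α dλ₁` on an edge. -/
def m1 (T : Affine.Simplex ℝ E 1) (α : Fin 2 → ℕ) : Form T 1 :=
  fmul (mono T α) (dform T 1)

theorem m0_apply (T : Affine.Simplex ℝ E n) (α : Fin (n + 1) → ℕ) (x : body T)
    (v : Fin 0 → Tangent T) : m0 T α x v = (mono T α x : ℂ) := by
  simp [m0, fmul_apply, alternator_zero_apply]

theorem m1_apply (T : Affine.Simplex ℝ E 1) (α : Fin 2 → ℕ) (x : body T)
    (v : Fin 1 → Tangent T) : m1 T α x v = (mono T α x : ℂ) * (dbary T 1 (v 0) : ℂ) := by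
  simp [m1, fmul_apply, dform_apply]

theorem linearIndependent_fmul_mono (T : Affine.Simplex ℝ E n) {k : ℕ}
    {η : (Tangent T) [⋀^Fin k]→ₗ[ℝ] ℂ} (hη : η ≠ 0) {r : ℕ} {I : Set (Fin (n + 1) → ℕ)}
    (hI : ∀ α ∈ I, ∑ i, α i = r) :
    LinearIndependent ℂ fun α : I => (fmul (mono T α) (fun _ => η) : Form T k) := by
  have h := linearIndependent_mono_smul T r k
    (LinearIndependent.of_subsingleton (R := ℂ) (v := fun _ : Unit => η) () hη)
  exact h.comp (fun α : I => (⟨α.1, hI α.1 α.2⟩, ())) fun a b hab => by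
    simpa [Subtype.ext_iff] using hab

theorem linearIndependent_m0 (T : Affine.Simplex ℝ E n) {r : ℕ} {I : Set (Fin (n + 1) → ℕ)}
    (hI : ∀ α ∈ I, ∑ i, α i = r) : LinearIndependent ℂ fun α : I => m0 T α := by
  refine linearIndependent_fmul_mono T (k := 0)
    (η := complexify (wedge fun i => dbary T (![] i))) (fun h => ?_) hI
  have := DFunLike.congr_fun h ![]
  rw [complexify_wedge_zero] at this
  exact one_ne_zero this

theorem linearIndependent_m1 (T : Affine.Simplex ℝ E 1) {r : ℕ} {I : Set (Fin 2 → ℕ)}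
    (hI : ∀ α ∈ I, ∑ i, α i = r) : LinearIndependent ℂ fun α : I => m1 T α := by
  refine linearIndependent_fmul_mono T (k := 1)
    (η := complexify (wedge fun i => dbary T (![1] i))) (fun h => ?_) hI
  have := DFunLike.congr_fun h fun _ => vertexBasis T 1 -ᵥ vertexBasis T 0
  rw [complexify_wedge_one] at this
  simp [dbary_vsub, bary_vertexBasis] at this

/-! ### Points -/

theorem bary_point (F : Affine.Simplex ℝ E 0) (i : Fin 1) (x : Hull F) : bary F i x = 1 :=
  haveI : Subsingleton (Fin (0 + 1)) := Fin.subsingleton_one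
  congrFun ((vertexBasis F).coe_coord_of_subsingleton_eq_one i) x

theorem mono_point (F : Affine.Simplex ℝ E 0) (α : Fin 1 → ℕ) (x : body F) : mono F α x = 1 := by
  simp [mono, bary_point]

/-- The constant `0`-form `1`. -/
def unitForm (T : Affine.Simplex ℝ E n) : Form T 0 := m0 T 0

theorem unitForm_apply (T : Affine.Simplex ℝ E n) (x : body T) (v : Fin 0 → Tangent T) :
    unitForm T x v = 1 := by
  simp [unitForm, m0_apply, mono]

theorem unitForm_ne_zero (T : Affine.Simplex ℝ E n) : unitForm T ≠ 0 := by
  intro h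
  have h1 := unitForm_apply T ⟨_, vertexBasis_mem_body T 0⟩ ![]
  rw [h] at h1
  exact zero_ne_one h1

theorem image_const_univ {V : Type*} (v : V) : (fun _ : Unit => v) '' Set.univ = {v} := by
  simp

theorem linearIndependent_unitForm (T : Affine.Simplex ℝ E n) :
    LinearIndependent ℂ fun _ : (Set.univ : Set Unit) => unitForm T :=
  LinearIndependent.of_subsingleton ⟨(), trivial⟩ (unitForm_ne_zero T)

/-- The only barycentric coordinate of a point is the constant 1, so every prescribed pair is `(1,
1)`. -/
theorem Lines.graphI_point {F : Affine.Simplex ℝ E 0} {Q : Set (Form F 0)} {N : ℕ∞} (s : ℕ)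
    (h : Lines Q {unitForm F} N) : Lines (FEEC.imageOf (graphI s F 0 0) Q) {unitForm F} N := by
  rw [← image_const_univ] at h ⊢
  refine h.imageOf (linearIndependent_unitForm F) ?_ ?_
  · rintro _ ⟨α, σ, ρ, hα, hc, rfl⟩
    refine ⟨(), trivial, 1, Prod.ext (Form.ext fun x v => ?_) (Form.ext fun x v => ?_)⟩
    · simp [fmul_apply, unitForm_apply, mono_point, alternator_zero_apply]
    · rw [seqSign_zero_one]
      simp [fmul_apply, unitForm_apply, mono_point, prodBary, whitney_zero_apply, bary_point]
  · rintro _ _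
    refine Submodule.subset_span ⟨fun _ => s, emb0 1, emb1 0, by simp, ?_, ?_⟩
    · rw [isCompl_range_iff]
      exact ⟨fun i => i.elim0, fun x => Or.inr ⟨0, Fin.subsingleton_one.elim _ _⟩⟩
    · refine Prod.ext (Form.ext fun x v => ?_) (Form.ext fun x v => ?_)
      · simp [fmul_apply, unitForm_apply, mono_point, alternator_zero_apply]
      · rw [seqSign_zero_one]
        simp [fmul_apply, unitForm_apply, mono_point, prodBary, whitney_zero_apply, bary_point]

/-- The index is `s + 1` because for index 0 there is no admissible exponent and the relation
contains only the zero pair. -/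
theorem Lines.graphJ_point {F : Affine.Simplex ℝ E 0} {Q : Set (Form F 0)} {N : ℕ∞} (s : ℕ)
    (h : Lines Q {unitForm F} N) :
    Lines (FEEC.inverseImageOf (graphJ (s + 1) F 0 0) Q) {unitForm F} N := by
  rw [← image_const_univ] at h ⊢
  refine h.inverseImageOf (linearIndependent_unitForm F) ?_ ?_
  · rintro _ ⟨α, σ, ρ, hα, hc, rfl⟩
    refine ⟨(), trivial, 1, Prod.ext (Form.ext fun x v => ?_) (Form.ext fun x v => ?_)⟩
    · simp [fmul_apply, unitForm_apply, mono_point, alternator_zero_apply, prodBary, bary_point]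
    · rw [seqSign_zero_one]
      simp [fmul_apply, unitForm_apply, mono_point, whitney_zero_apply, bary_point]
  · rintro _ _
    refine Submodule.subset_span ⟨fun _ => s, emb0 1, emb1 0, by simp, ?_, ?_⟩
    · rw [isCompl_range_iff]
      exact ⟨fun i => i.elim0, fun x => Or.inr ⟨0, Fin.subsingleton_one.elim _ _⟩⟩
    · refine Prod.ext (Form.ext fun x v => ?_) (Form.ext fun x v => ?_)
      · simp [fmul_apply, unitForm_apply, mono_point, alternator_zero_apply, prodBary, bary_point]
      · rw [seqSign_zero_one]
        simp [fmul_apply, unitForm_apply, mono_point, whitney_zero_apply, bary_point]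

theorem spanningP_point (F : Affine.Simplex ℝ E 0) (r : ℕ) :
    spanningP r F 0 = {unitForm F} := by
  ext ω
  constructor
  · rintro ⟨α, σ, -, rfl⟩
    exact Form.ext fun x v => by
      simp [fmul_apply, unitForm_apply, mono_point, alternator_zero_apply]
  · rintro rfl
    exact ⟨fun _ => r, emb0 1, by simp, Form.ext fun x v => by
      simp [fmul_apply, unitForm_apply, mono_point, alternator_zero_apply]⟩

theorem spanningPminus_point (F : Affine.Simplex ℝ E 0) (r : ℕ) :
    spanningPminus (r + 1) F 0 = {unitForm F} := by
  ext ω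
  constructor
  · rintro ⟨α, σ, -, rfl⟩
    exact Form.ext fun x v => by
      simp [fmul_apply, unitForm_apply, mono_point, whitney_zero_apply, bary_point]
  · rintro rfl
    exact ⟨fun _ => r, emb1 0, by simp, Form.ext fun x v => by
      simp [fmul_apply, unitForm_apply, mono_point, whitney_zero_apply, bary_point]⟩

theorem Lines.subset_span {V : Type*} [AddCommGroup V] [Module ℂ V] {Q S : Set V} {N : ℕ∞}
    (h : Lines Q S N) : Q ⊆ Submodule.span ℂ S := by
  rw [← h.span_eq]
  exact Submodule.subset_span

theorem iUnion_faces_point {V : Type*}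
    (X : ∀ (m : ℕ) (fs : Finset (Fin (0 + 1))) (_ : fs.card = m + 1), Set V) :
    (⋃ (m : ℕ) (fs : Finset (Fin (0 + 1))) (h : fs.card = m + 1), X m fs h) =
      X 0 Finset.univ (Finset.card_fin (0 + 1)) := by
  apply Set.Subset.antisymm
  · refine Set.iUnion_subset fun m => Set.iUnion_subset fun fs => Set.iUnion_subset fun h => ?_
    have h1 := Finset.card_le_univ fs
    rw [Fintype.card_fin] at h1
    obtain rfl : m = 0 := by omega
    obtain rfl : fs = Finset.univ := (Finset.card_eq_iff_eq_univ fs).1 h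
    exact subset_rfl
  · exact fun x hx => Set.mem_iUnion.2 ⟨0, Set.mem_iUnion₂.2 ⟨_, _, hx⟩⟩

-- Unfolding the recursion; bases on a point

section Recursion

variable (B : ∀ {n : ℕ} (T : Affine.Simplex ℝ E n) (k : ℕ), Set (Form T k))

/-- The unions in the definition run over a single admissible pair `(l, s)`; writing the degree as
`s + l` avoids truncated subtraction. -/
theorem basisPring_eq {k l n : ℕ} (hkl : k + l = n) (s : ℕ) (T : Affine.Simplex ℝ E n) :
    basisPring B (s + l) T k = inverseImageOf (graphJ s T k l) (basisPminus B s T l) := by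
  rw [basisPring]
  apply Set.Subset.antisymm
  · refine Set.iUnion_subset fun l' => Set.iUnion_subset fun s' => Set.iUnion_subset fun h =>
      Set.iUnion_subset fun h' => ?_
    obtain rfl : l' = l := by omega
    obtain rfl : s' = s := by omega
    exact subset_rfl
  · exact fun x hx => Set.mem_iUnion₂.2 ⟨l, s, Set.mem_iUnion₂.2 ⟨hkl, rfl, hx⟩⟩

theorem basisPminusRing_eq {k l n : ℕ} (hkl : k + l = n) (s : ℕ) (T : Affine.Simplex ℝ E n) :
    basisPminusRing B (s + l + 1) T k = imageOf (graphI s T l k) (basisP B s T l) := by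
  rw [basisPminusRing]
  apply Set.Subset.antisymm
  · refine Set.iUnion_subset fun l' => Set.iUnion_subset fun s' => Set.iUnion_subset fun h =>
      Set.iUnion_subset fun h' => ?_
    obtain rfl : l' = l := by omega
    obtain rfl : s' = s := by omega
    exact subset_rfl
  · exact fun x hx => Set.mem_iUnion₂.2 ⟨l, s, Set.mem_iUnion₂.2 ⟨hkl, rfl, hx⟩⟩

theorem basisPminusRing_eq_empty {k l n : ℕ} (hkl : k + l = n) {r : ℕ} (hr : r < l + 1)
    (T : Affine.Simplex ℝ E n) : basisPminusRing B r T k = ∅ := by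
  rw [basisPminusRing]
  simp only [Set.iUnion_eq_empty]
  intro _ _ _ _
  omega

theorem basisPring_eq_empty_of_lt {k n : ℕ} (hn : n < k) (r : ℕ)
    (T : Affine.Simplex ℝ E n) : basisPring B r T k = ∅ := by
  rw [basisPring]
  simp only [Set.iUnion_eq_empty]
  intro _ _ _ _
  omega

theorem basisPminusRing_eq_empty_of_lt {k n : ℕ} (hn : n < k) (r : ℕ)
    (T : Affine.Simplex ℝ E n) : basisPminusRing B r T k = ∅ := by
  rw [basisPminusRing]
  simp only [Set.iUnion_eq_empty]
  intro _ _ _ _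
  omega

theorem imageOf_empty {V W : Type*} [AddCommGroup V] [Module ℂ V] [AddCommGroup W] [Module ℂ W]
    (G : Submodule ℂ (V × W)) : imageOf G ∅ = ∅ := by
  simp [imageOf]

theorem basisPminus_zero {n : ℕ} (T : Affine.Simplex ℝ E n) (k : ℕ) :
    basisPminus B 0 T k = ∅ := by
  rw [basisPminus]
  simp only [Set.iUnion_eq_empty]
  intro m fs h
  rw [basisPminusRing]
  simp [imageOf_empty]

theorem basisP_zero {n : ℕ} (T : Affine.Simplex ℝ E n) (k : ℕ) :
    basisP B 0 T k = B T k := by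
  rw [basisP]
  simp

theorem basisP_succ (r : ℕ) {n : ℕ} (T : Affine.Simplex ℝ E n) (k : ℕ) :
    basisP B (r + 1) T k = ⋃ (m : ℕ) (fs : Finset (Fin (n + 1))) (h : fs.card = m + 1),
      imageOf (graphExt (r + 1) T h k) (basisPring B (r + 1) (T.face h) k) := by
  rw [basisP]
  simp

variable (hB : ∀ {n : ℕ} (F : Affine.Simplex ℝ E n) (k : ℕ), n ≤ 1 → k ≤ n →
      IsBasisOf ℝ (B F k) (spaceP ℝ 0 F k))

include hB in
-- On a point the recursion is one cycle, from `basisP r` through `basisPminusRing (r + 1)`,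
-- `basisPminus (r + 1)` and `basisPring (r + 1)` to `basisP (r + 1)`, each step sending 1 to 1.
theorem lines_point (r : ℕ) (F : Affine.Simplex ℝ E 0) :
    Lines (basisP B r F 0) {unitForm F} 1 ∧ Lines (basisPminusRing B (r + 1) F 0) {unitForm F} 1 ∧
      Lines (basisPring B (r + 1) F 0) {unitForm F} 1 := by
  have step : ∀ r, Lines (basisP B r F 0) {unitForm F} 1 →
      Lines (basisPminusRing B (r + 1) F 0) {unitForm F} 1 ∧
      Lines (basisPring B (r + 1) F 0) {unitForm F} 1 := by
    intro r h
    have h1 : Lines (basisPminusRing B (r + 1) F 0) {unitForm F} 1 := by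
      have := basisPminusRing_eq B (k := 0) (l := 0) (n := 0) rfl r F
      rw [add_zero] at this
      rw [this]
      exact h.graphI_point r
    refine ⟨h1, ?_⟩
    have h2 : Lines (basisPminus B (r + 1) F 0) {unitForm F} 1 := by
      rw [basisPminus, iUnion_faces_point,
        imageOf_graphExtMinus_full F _ (fun T' => basisPminusRing B (r + 1) T' 0)]
      · exact h1
      · rw [spacePminus, spanningPminus_point]
        exact h1.subset_span
    have := basisPring_eq B (k := 0) (l := 0) (n := 0) rfl (r + 1) F
    rw [add_zero] at this
    rw [this]
    exact h2.graphJ_point r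
  suffices h : Lines (basisP B r F 0) {unitForm F} 1 from ⟨h, step r h⟩
  induction r with
  | zero =>
    rw [basisP_zero]
    refine Lines.of_isBasisOf (unitForm_ne_zero F) ?_
    have := hB F 0 (by norm_num) le_rfl
    rwa [spaceP, spanningP_point] at this
  | succ r ih =>
    have h1 := (step r ih).2
    rw [basisP_succ, iUnion_faces_point,
      imageOf_graphExt_full F _ (fun T' => basisPring B (r + 1) T' 0)]
    · exact h1
    · rw [spaceP, spanningP_point]
      exact h1.subset_span

end Recursion

/-! ### Edges -/

theorem extend_vec1 {N : ℕ} (i : Fin N) (α : Fin 1 → ℕ) :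
    Function.extend ![i] α 0 = Pi.single i (α 0) := by
  have hinj : Function.Injective ![i] := Function.injective_of_subsingleton _
  ext j
  by_cases hj : j = i
  · subst hj
    simpa using hinj.extend_apply α 0 0
  · rw [Function.extend_apply', Pi.single_eq_of_ne hj]
    · rfl
    · rintro ⟨a, rfl⟩
      fin_cases a
      exact hj rfl

theorem Lines.graphExt_vertex {T : Affine.Simplex ℝ E n} {fs : Finset (Fin (n + 1))}
    (h : fs.card = 0 + 1) {i : Fin (n + 1)} (hi : fs = {i}) {Q : Set (Form (T.face h) 0)} {N : ℕ∞}
    (r : ℕ) (hQ : Lines Q {unitForm (T.face h)} N) :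
    Lines (FEEC.imageOf (graphExt r T h 0) Q) {m0 T (Pi.single i r)} N := by
  have e := orderEmbOfFin_singleton h hi
  rw [← image_const_univ] at hQ ⊢
  refine hQ.imageOf (linearIndependent_unitForm _) ?_ ?_
  · rintro _ ⟨α, σ, hα, rfl⟩
    refine ⟨(), trivial, 1, Prod.ext (Form.ext fun x v => ?_) (Form.ext fun x v => ?_)⟩
    · simp [fmul_apply, unitForm_apply, mono_point, alternator_zero_apply]
    · obtain rfl : α 0 = r := by simpa using hα
      rw [fmul_apply, psi_zero_apply, e, extend_vec1]
      simp [m0_apply]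
  · rintro _ _
    refine Submodule.subset_span ⟨fun _ => r, emb0 1, by simp, ?_⟩
    refine Prod.ext (Form.ext fun x v => ?_) (Form.ext fun x v => ?_)
    · simp [fmul_apply, unitForm_apply, mono_point, alternator_zero_apply]
    · rw [fmul_apply, psi_zero_apply, e, extend_vec1]
      simp [m0_apply]

/-- The Whitney 0-form of a vertex is `λ_i`, which raises the exponent from `r` to `r + 1`. -/
theorem Lines.graphExtMinus_vertex {T : Affine.Simplex ℝ E n} {fs : Finset (Fin (n + 1))}
    (h : fs.card = 0 + 1) {i : Fin (n + 1)} (hi : fs = {i}) {Q : Set (Form (T.face h) 0)} {N : ℕ∞}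
    (r : ℕ) (hQ : Lines Q {unitForm (T.face h)} N) :
    Lines (FEEC.imageOf (graphExtMinus (r + 1) T h 0) Q) {m0 T (Pi.single i (r + 1))} N := by
  have e := orderEmbOfFin_singleton h hi
  have e0 : fs.orderEmbOfFin h 0 = i := congrFun e 0
  rw [← image_const_univ] at hQ ⊢
  refine hQ.imageOf (linearIndependent_unitForm _) ?_ ?_
  · rintro _ ⟨α, ρ, hα, rfl⟩
    have hρ : ρ 0 = 0 := Fin.subsingleton_one.elim _ _
    refine ⟨(), trivial, 1, Prod.ext (Form.ext fun x v => ?_) (Form.ext fun x v => ?_)⟩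
    · simp [fmul_apply, unitForm_apply, mono_point, whitney_zero_apply, bary_point]
    · obtain rfl : α 0 = r := by simpa using hα
      rw [fmul_apply, whitney_zero_apply, Function.comp_apply, hρ, e0, e, extend_vec1]
      simp [m0_apply, mono_single, pow_succ]
  · rintro _ _
    refine Submodule.subset_span ⟨fun _ => r, emb1 0, by simp, ?_⟩
    refine Prod.ext (Form.ext fun x v => ?_) (Form.ext fun x v => ?_)
    · simp [fmul_apply, unitForm_apply, mono_point, whitney_zero_apply, bary_point]
    · have h0 : (emb1 0 : Fin 1 ↪o Fin 1) 0 = 0 := rfl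
      rw [fmul_apply, whitney_zero_apply, Function.comp_apply, h0, e0, e, extend_vec1]
      simp [m0_apply, mono_single, pow_succ]

theorem dbary_edge (F : Affine.Simplex ℝ E 1) (w : Tangent F) : dbary F 0 w = -dbary F 1 w := by
  have h := sum_dbary_apply F w
  rw [Fin.sum_univ_two] at h
  linarith

theorem bary_edge (F : Affine.Simplex ℝ E 1) (x : Hull F) : bary F 0 x = 1 - bary F 1 x := by
  have h := sum_bary F x
  rw [Fin.sum_univ_two] at h
  linarith

theorem embedding_two (ρ : Fin (1 + 1) ↪o Fin 2) : ρ 0 = 0 ∧ ρ 1 = 1 := by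
  have h : ρ 0 < ρ 1 := ρ.strictMono (by decide)
  revert h
  generalize ρ 0 = a
  generalize ρ 1 = b
  revert a b
  decide

theorem prodBary_zero (T : Affine.Simplex ℝ E n) (σ : Fin 0 ↪o Fin (n + 1)) (x : body T) :
    prodBary T σ x = 1 := by
  simp [prodBary]

theorem prodBary_one (T : Affine.Simplex ℝ E n) (σ : Fin 1 ↪o Fin (n + 1)) (x : body T) :
    prodBary T σ x = bary T (σ 0) x := by
  simp [prodBary]

theorem prodBary_two (T : Affine.Simplex ℝ E n) (σ : Fin (1 + 1) ↪o Fin (n + 1)) (x : body T) :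
    prodBary T σ x = bary T (σ 0) x * bary T (σ 1) x := by
  rw [prodBary]
  exact Fin.prod_univ_two _

/-- On an edge `λ₀ dλ₁ - λ₁ dλ₀ = (λ₀ + λ₁) dλ₁ = dλ₁`. -/
theorem fmul_whitney_edge (F : Affine.Simplex ℝ E 1) (α : Fin 2 → ℕ) (ρ : Fin (1 + 1) ↪o Fin 2) :
    fmul (mono F α) (whitney F ρ) = m1 F α := by
  obtain ⟨h0, h1⟩ := embedding_two ρ
  refine Form.ext fun x v => ?_
  rw [fmul_apply, whitney_one_apply, h0, h1, m1_apply, dbary_edge, bary_edge]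
  push_cast
  ring

theorem fmul_alternator_zero (T : Affine.Simplex ℝ E n) (α : Fin (n + 1) → ℕ)
    (σ : Fin 0 → Fin (n + 1)) : fmul (mono T α) (alternator T σ) = m0 T α := by
  rw [m0, Subsingleton.elim σ ![]]

theorem fmul_whitney_zero (T : Affine.Simplex ℝ E n) (α : Fin (n + 1) → ℕ)
    (ρ : Fin (0 + 1) → Fin (n + 1)) :
    fmul (mono T α) (whitney T ρ) = m0 T (α + Pi.single (ρ 0) 1) :=
  Form.ext fun x v => by
    rw [fmul_apply, whitney_zero_apply, m0_apply, mono_add, mono_single, pow_one]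
    push_cast
    rfl

theorem fmul_alternator_edge (F : Affine.Simplex ℝ E 1) (α : Fin 2 → ℕ) (σ : Fin 1 → Fin 2) :
    fmul (mono F α) (alternator F σ) = (if σ 0 = 0 then (-1 : ℂ) else 1) • m1 F α := by
  refine Form.ext fun x v => ?_
  rw [fmul_apply, alternator_one_apply]
  simp only [Pi.smul_apply, AlternatingMap.smul_apply, m1_apply, smul_eq_mul]
  generalize σ 0 = a
  fin_cases a
  · simp [dbary_edge]
  · simp

theorem isCompl_embedding_edge {σ : Fin 1 → Fin 2} {ρ : Fin (0 + 1) → Fin 2}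
    (h : IsCompl (Set.range σ) (Set.range ρ)) : (σ 0 = 0 ∧ ρ 0 = 1) ∨ (σ 0 = 1 ∧ ρ 0 = 0) := by
  have h1 := ((isCompl_range_iff σ ρ).1 h).1 0 0
  revert h1
  generalize σ 0 = a
  generalize ρ 0 = b
  revert a b
  decide

theorem isCompl_emb_edge (i j : Fin 2) (h : i ≠ j) :
    IsCompl (Set.range (emb1 i)) (Set.range (emb1 j : Fin 1 ↪o Fin 2)) := by
  rw [isCompl_range_iff]
  refine ⟨fun a b => by rwa [Subsingleton.elim a 0, Subsingleton.elim b 0], fun x => ?_⟩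
  have : i = x ∨ j = x := by omega
  exact this.imp (fun h => ⟨0, h⟩) (fun h => ⟨0, h⟩)

theorem isCompl_emb_zero (ρ : Fin (1 + 1) ↪o Fin 2) :
    IsCompl (Set.range (emb0 2)) (Set.range ρ) := by
  rw [isCompl_range_iff]
  refine ⟨fun i => i.elim0, fun x => Or.inr ?_⟩
  obtain ⟨h0, h1⟩ := embedding_two ρ
  fin_cases x
  · exact ⟨0, h0⟩
  · exact ⟨1, h1⟩

theorem zero_lt_one_fin_two : (0 : Fin 2) < 1 := by decide

theorem Lines.neg_image {V ι : Type*} [AddCommGroup V] [Module ℂ V] {Q : Set V} {N : ℕ∞}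
    {v : ι → V} {I : Set ι} (h : Lines Q ((fun i => -v i) '' I) N) : Lines Q (v '' I) N := by
  refine h.congr ?_ ?_
  · rintro _ ⟨i, hi, rfl⟩
    exact ⟨-1, by norm_num, _, ⟨i, hi, rfl⟩, by simp⟩
  · rintro _ ⟨i, hi, rfl⟩
    exact ⟨-1, by norm_num, _, ⟨i, hi, rfl⟩, by simp⟩

theorem m0_add_one (F : Affine.Simplex ℝ E 1) (α : Fin 2 → ℕ) (x : body F) (v : Fin 0 → Tangent F) :
    m0 F (α + 1) x v = (mono F α x : ℂ) * bary F 0 x * bary F 1 x := by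
  rw [m0_apply, mono_add, mono_one, Fin.prod_univ_two]
  push_cast
  ring

theorem Lines.graphI_zero_edge {F : Affine.Simplex ℝ E 1} {Q : Set (Form F 0)} {N : ℕ∞} {s : ℕ}
    (h : Lines Q (m0 F '' {α | ∑ i, α i = s}) N) :
    Lines (FEEC.imageOf (graphI s F 0 1) Q) (m1 F '' {α | ∑ i, α i = s}) N := by
  have key : ∀ (α : Fin 2 → ℕ) (σ : Fin 0 ↪o Fin 2) (ρ : Fin (1 + 1) ↪o Fin 2),
      (fmul (mono F α) (alternator F σ),
      seqSign (Fin.append σ ρ) • fmul (mono F α) (fmul (prodBary F σ) (whitney F ρ))) =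
      (m0 F α, m1 F α) := by
    intro α σ ρ
    obtain ⟨h0, h1⟩ := embedding_two ρ
    rw [seqSign_zero_two, h0, h1, if_pos zero_lt_one_fin_two, one_smul, fmul_alternator_zero,
      ← fmul_whitney_edge F α ρ]
    refine Prod.ext rfl (Form.ext fun x v => ?_)
    simp [fmul_apply, prodBary_zero]
  refine h.imageOf (linearIndependent_m0 F (r := s) fun α hα => hα) ?_ ?_
  · rintro _ ⟨α, σ, ρ, hα, hc, rfl⟩
    exact ⟨α, hα, 1, by rw [key, one_smul, one_smul]⟩
  · intro α hα
    exact Submodule.subset_span ⟨α, emb0 2, emb2 zero_lt_one_fin_two, hα, isCompl_emb_zero _,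
      (key _ _ _).symm⟩

theorem Lines.graphJ_zero_edge {F : Affine.Simplex ℝ E 1} {Q : Set (Form F 1)} {N : ℕ∞} {s : ℕ}
    (h : Lines Q (m1 F '' {α | ∑ i, α i + 1 = s}) N) :
    Lines (FEEC.inverseImageOf (graphJ s F 0 1) Q)
      ((fun α => m0 F (α + 1)) '' {α | ∑ i, α i + 1 = s}) N := by
  have key : ∀ (α : Fin 2 → ℕ) (σ : Fin 0 ↪o Fin 2) (ρ : Fin (1 + 1) ↪o Fin 2),
      (fmul (mono F α) (fmul (prodBary F ρ) (alternator F σ)),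
      seqSign (Fin.append σ ρ) • fmul (mono F α) (whitney F ρ)) =
      (m0 F (α + 1), m1 F α) := by
    intro α σ ρ
    obtain ⟨h0, h1⟩ := embedding_two ρ
    rw [seqSign_zero_two, h0, h1, if_pos zero_lt_one_fin_two, one_smul, fmul_whitney_edge F α ρ]
    refine Prod.ext (Form.ext fun x v => ?_) rfl
    simp only [fmul_apply, prodBary_two, h0, h1, alternator_zero_apply, m0_add_one]
    push_cast
    ring
  refine h.inverseImageOf (linearIndependent_m1 F (r := s - 1) fun α hα => ?_) ?_ ?_
  · simp only [Set.mem_ofPred_eq] at hα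
    omega
  · rintro _ ⟨α, σ, ρ, hα, hc, rfl⟩
    exact ⟨α, hα, 1, by rw [key, one_smul, one_smul]⟩
  · intro α hα
    exact Submodule.subset_span ⟨α, emb0 2, emb2 zero_lt_one_fin_two, hα, isCompl_emb_zero _,
      (key _ _ _).symm⟩

/-- Both choices of `σ` give, up to the same sign in both components, the one pair `(λ^α dλ₁, -λ^α
λ₀ λ₁)`, because `dλ₀ = -dλ₁`. -/
theorem Lines.graphI_one_edge {F : Affine.Simplex ℝ E 1} {Q : Set (Form F 1)} {N : ℕ∞} {s : ℕ}
    (h : Lines Q (m1 F '' {α | ∑ i, α i = s}) N) :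
    Lines (FEEC.imageOf (graphI s F 1 0) Q) ((fun α => m0 F (α + 1)) '' {α | ∑ i, α i = s}) N := by
  have key : ∀ (α : Fin 2 → ℕ) (σ : Fin 1 ↪o Fin 2) (ρ : Fin (0 + 1) ↪o Fin 2),
      IsCompl (Set.range σ) (Set.range ρ) → (fmul (mono F α) (alternator F σ),
      seqSign (Fin.append σ ρ) • fmul (mono F α) (fmul (prodBary F σ) (whitney F ρ))) =
      ((if σ 0 = 0 then (-1 : ℂ) else 1) • m1 F α,
        (if σ 0 = 0 then (-1 : ℂ) else 1) • -m0 F (α + 1)) := by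
    intro α σ ρ hc
    rw [seqSign_one_one, fmul_alternator_edge]
    refine Prod.ext rfl (Form.ext fun x v => ?_)
    rcases isCompl_embedding_edge hc with ⟨h0, h1⟩ | ⟨h0, h1⟩
    · simp [h0, h1, fmul_apply, prodBary_one, whitney_zero_apply, m0_add_one]
      ring
    · simp [h0, h1, fmul_apply, prodBary_one, whitney_zero_apply, m0_add_one]
      ring
  refine (h.imageOf (w := fun α => -m0 F (α + 1))
    (linearIndependent_m1 F (r := s) fun α hα => hα) ?_ ?_).neg_image
  · rintro _ ⟨α, σ, ρ, hα, hc, rfl⟩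
    exact ⟨α, hα, _, key _ _ _ hc⟩
  · intro α hα
    have hc := isCompl_emb_edge 1 0 (by decide)
    refine Submodule.subset_span ⟨α, emb1 1, emb1 0, hα, hc, ?_⟩
    rw [key _ _ _ hc, if_neg (by decide), one_smul, one_smul]

/-- The factor `λ_{σᶜ}` occurs in both components of a prescribed pair. Absorbed into the monomial,
it leaves the pair `(-λ^β dλ₁, λ^β)` up to a common sign, with `|β| = s`. -/
theorem Lines.graphJ_one_edge {F : Affine.Simplex ℝ E 1} {Q : Set (Form F 0)} {N : ℕ∞} {s : ℕ}
    (hs : s ≠ 0) (h : Lines Q (m0 F '' {α | ∑ i, α i = s}) N) :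
    Lines (FEEC.inverseImageOf (graphJ s F 1 0) Q) (m1 F '' {α | ∑ i, α i = s}) N := by
  have key : ∀ (α : Fin 2 → ℕ) (σ : Fin 1 ↪o Fin 2) (ρ : Fin (0 + 1) ↪o Fin 2),
      IsCompl (Set.range σ) (Set.range ρ) →
      (fmul (mono F α) (fmul (prodBary F ρ) (alternator F σ)),
      seqSign (Fin.append σ ρ) • fmul (mono F α) (whitney F ρ)) =
      ((if σ 0 = 0 then (1 : ℂ) else -1) • -m1 F (α + Pi.single (ρ 0) 1),
        (if σ 0 = 0 then (1 : ℂ) else -1) • m0 F (α + Pi.single (ρ 0) 1)) := by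
    intro α σ ρ hc
    rw [seqSign_one_one, fmul_whitney_zero]
    refine Prod.ext (Form.ext fun x v => ?_) (Form.ext fun x v => ?_)
    · rcases isCompl_embedding_edge hc with ⟨h0, h1⟩ | ⟨h0, h1⟩
      · simp [h0, h1, fmul_apply, prodBary_one, alternator_one_apply, m1_apply, mono_add,
          mono_single, dbary_edge]
        ring
      · simp [h0, h1, fmul_apply, prodBary_one, alternator_one_apply, m1_apply, mono_add,
          mono_single]
        ring
    · rcases isCompl_embedding_edge hc with ⟨h0, h1⟩ | ⟨h0, h1⟩
      · simp [h0, h1]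
      · simp [h0, h1]
  refine (h.inverseImageOf (v := fun α => -m1 F α)
    (linearIndependent_m0 F (r := s) fun α hα => hα) ?_ ?_).neg_image
  · rintro _ ⟨α, σ, ρ, hα, hc, rfl⟩
    refine ⟨_, ?_, _, key _ _ _ hc⟩
    rw [Set.mem_ofPred_eq, ← hα]
    simp [Finset.sum_add_distrib]
  · intro β hβ
    have hpos : ∃ i, β i ≠ 0 := by
      by_contra! h0
      simp [h0] at hβ
      exact hs hβ.symm
    -- A factor `λ_j` with `β j ≠ 0` is split off to play the role of `λ_{σᶜ}`; then `σ` is the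
    -- other vertex. Such a `j` exists because `s ≠ 0`.
    obtain ⟨j, hj⟩ := hpos
    obtain ⟨i, hij⟩ : ∃ i : Fin 2, i ≠ j := exists_ne j
    have hc := isCompl_emb_edge i j hij
    have e : β - Pi.single j 1 + Pi.single j 1 = β := by
      refine tsub_add_cancel_of_le fun a => ?_
      by_cases ha : a = j
      · subst ha
        simpa using Nat.one_le_iff_ne_zero.2 hj
      · simp [ha]
    have h1 : (((if i = 0 then (1 : ℂ) else -1) • -m1 F β,
        (if i = 0 then (1 : ℂ) else -1) • m0 F β) :
        Form F 1 × Form F 0) ∈ graphJ s F 1 0 := by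
      refine Submodule.subset_span ⟨β - Pi.single j 1, emb1 i, emb1 j, ?_, hc, ?_⟩
      · have hβ' : ∑ i, β i = s := hβ
        rw [← hβ', ← e]
        simp [Finset.sum_add_distrib]
      · rw [key _ _ _ hc, show (emb1 j : Fin 1 ↪o Fin 2) 0 = j from rfl,
          show (emb1 i : Fin 1 ↪o Fin 2) 0 = i from rfl, e]
    change _ ∈ graphJ s F 1 0
    by_cases hi : i = 0
    · simpa only [hi, if_true, one_smul] using h1
    · have h2 := Submodule.smul_mem _ (-1 : ℂ) h1
      simpa only [hi, if_false, Prod.smul_mk, smul_smul, mul_neg, mul_one, neg_neg,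
        one_smul] using h2

theorem iUnion_faces_edge {V : Type*}
    (X : ∀ (m : ℕ) (fs : Finset (Fin (1 + 1))) (_ : fs.card = m + 1), Set V) :
    (⋃ (m : ℕ) (fs : Finset (Fin (1 + 1))) (h : fs.card = m + 1), X m fs h) =
      X 0 {0} (Finset.card_singleton _) ∪ X 0 {1} (Finset.card_singleton _) ∪
        X 1 Finset.univ (Finset.card_fin (1 + 1)) := by
  apply Set.Subset.antisymm
  · refine Set.iUnion_subset fun m => Set.iUnion_subset fun fs => Set.iUnion_subset fun h => ?_
    have h1 := Finset.card_le_univ fs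
    rw [Fintype.card_fin] at h1
    have hfs : fs = {0} ∨ fs = {1} ∨ fs = Finset.univ := by
      have h2 : fs.card ≠ 0 := by omega
      clear h h1
      revert fs
      decide
    rcases hfs with rfl | rfl | rfl
    · obtain rfl : m = 0 := by simpa using h.symm
      exact fun x hx => Or.inl (Or.inl hx)
    · obtain rfl : m = 0 := by simpa using h.symm
      exact fun x hx => Or.inl (Or.inr hx)
    · obtain rfl : m = 1 := by simpa using h.symm
      exact fun x hx => Or.inr hx
  · rintro x ((hx | hx) | hx)
    · exact Set.mem_iUnion.2 ⟨0, Set.mem_iUnion₂.2 ⟨_, _, hx⟩⟩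
    · exact Set.mem_iUnion.2 ⟨0, Set.mem_iUnion₂.2 ⟨_, _, hx⟩⟩
    · exact Set.mem_iUnion.2 ⟨1, Set.mem_iUnion₂.2 ⟨_, _, hx⟩⟩

/-- A monomial in two variables is a pure power or divisible by `λ₀ λ₁`, which matches the two
vertices and the interior of the edge. The interior condition `|α| + 1 = r` has no solution for `r =
0`, as it should. -/
theorem exponents_edge (r : ℕ) : ({α | ∑ i, α i = r + 1} : Set (Fin 2 → ℕ)) =
    {Pi.single 0 (r + 1)} ∪ {Pi.single 1 (r + 1)} ∪
      (fun α => α + 1) '' {α | ∑ i, α i + 1 = r} := by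
  ext β
  simp only [Set.mem_ofPred_eq, Fin.sum_univ_two, Set.mem_union, Set.mem_singleton_iff,
    Set.mem_image]
  constructor
  · intro h
    by_cases h1 : β 1 = 0
    · left; left
      ext i
      fin_cases i
      · simpa [h1] using h
      · simpa using h1
    by_cases h0 : β 0 = 0
    · left; right
      ext i
      fin_cases i
      · simpa using h0
      · simpa [h0] using h
    right
    refine ⟨fun i => β i - 1, ?_, ?_⟩
    · change β 0 - 1 + (β 1 - 1) + 1 = r
      omega
    ext i
    fin_cases i
    · simp only [Pi.add_apply, Pi.one_apply]
      change β 0 - 1 + 1 = β 0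
      omega
    · simp only [Pi.add_apply, Pi.one_apply]
      change β 1 - 1 + 1 = β 1
      omega
  · rintro ((rfl | rfl) | ⟨α, h, rfl⟩)
    · simp
    · simp
    · simp only [Pi.add_apply, Pi.one_apply]
      omega

theorem m0_mem_spanningP (T : Affine.Simplex ℝ E n) {r : ℕ} {α : Fin (n + 1) → ℕ}
    (h : ∑ i, α i = r) : m0 T α ∈ spanningP r T 0 :=
  ⟨α, emb0 _, h, (fmul_alternator_zero T α _).symm⟩

theorem m0_mem_spanningPminus (T : Affine.Simplex ℝ E n) {r : ℕ} {β : Fin (n + 1) → ℕ}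
    (h : ∑ i, β i = r) (hr : r ≠ 0) : m0 T β ∈ spanningPminus r T 0 := by
  have hpos : ∃ i, β i ≠ 0 := by
    by_contra! h0
    simp [h0] at h
    exact hr h.symm
  obtain ⟨j, hj⟩ := hpos
  have e : β - Pi.single j 1 + Pi.single j 1 = β := by
    refine tsub_add_cancel_of_le fun a => ?_
    by_cases ha : a = j
    · subst ha
      simpa using Nat.one_le_iff_ne_zero.2 hj
    · simp [ha]
  refine ⟨β - Pi.single j 1, emb1 j, ?_, ?_⟩
  · rw [← h, ← e]
    simp [Finset.sum_add_distrib]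
  · rw [fmul_whitney_zero, show (emb1 j : Fin 1 ↪o Fin (n + 1)) 0 = j from rfl, e]

theorem m1_mem_spaceP (F : Affine.Simplex ℝ E 1) {r : ℕ} {α : Fin 2 → ℕ}
    (h : ∑ i, α i = r) : m1 F α ∈ spanningP r F 1 :=
  ⟨α, emb1 1, h, rfl⟩

theorem m1_zero_ne_zero (F : Affine.Simplex ℝ E 1) : m1 F 0 ≠ 0 := by
  have h : LinearIndependent ℂ fun α : ({0} : Set (Fin 2 → ℕ)) => m1 F α :=
    linearIndependent_m1 F (r := 0) (by simp)
  exact h.ne_zero (⟨0, Set.mem_singleton 0⟩ : ({0} : Set (Fin 2 → ℕ)))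

theorem m1_mem_spanningPminus (F : Affine.Simplex ℝ E 1) {r : ℕ} {α : Fin 2 → ℕ}
    (h : ∑ i, α i + 1 = r) : m1 F α ∈ spanningPminus r F 1 :=
  ⟨α, emb2 zero_lt_one_fin_two, h, (fmul_whitney_edge F α _).symm⟩

theorem Lines.subset_span_of_subset {V : Type*} [AddCommGroup V] [Module ℂ V] {Q S D : Set V}
    {N : ℕ∞} (h : Lines Q S N) (hS : S ⊆ D) : Q ⊆ Submodule.span ℂ D :=
  h.subset_span.trans (Submodule.span_mono hS)

-- Bases on an edge

section Recursion

variable (B : ∀ {n : ℕ} (T : Affine.Simplex ℝ E n) (k : ℕ), Set (Form T k))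

variable {B}

theorem lines_basisPminus_zero_edge
    (hB : ∀ {n : ℕ} (F : Affine.Simplex ℝ E n) (k : ℕ), n ≤ 1 → k ≤ n →
      IsBasisOf ℝ (B F k) (spaceP ℝ 0 F k)) (F : Affine.Simplex ℝ E 1) (r : ℕ)
    (h : ∀ s, s + 1 = r → Lines (basisP B s F 1) (m1 F '' {α | ∑ i, α i = s}) (s + 1 : ℕ)) :
    Lines (basisPminus B (r + 1) F 0) (m0 F '' {α | ∑ i, α i = r + 1}) (r + 1 + 1 : ℕ) := by
  have hring : Lines (basisPminusRing B (r + 1) F 0)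
      ((fun α => m0 F (α + 1)) '' {α | ∑ i, α i + 1 = r}) r := by
    rcases r with _ | s
    · rw [basisPminusRing_eq_empty B (k := 0) (l := 1) rfl (by norm_num)]
      simpa using Lines.empty 0
    · have e := basisPminusRing_eq B (k := 0) (l := 1) (n := 1) rfl s F
      rw [e]
      simpa using (h s rfl).graphI_one_edge
  rw [basisPminus, iUnion_faces_edge, exponents_edge, Set.image_union, Set.image_union,
    Set.image_singleton, Set.image_singleton, Set.image_image]
  refine Lines.mono_card (((Lines.graphExtMinus_vertex _ rfl r
    (lines_point B hB r _).2.1).union (Lines.graphExtMinus_vertex _ rfl r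
    (lines_point B hB r _).2.1)).union (N' := r) ?_) ?_
  · rw [imageOf_graphExtMinus_full F _ (fun T' => basisPminusRing B (r + 1) T' 0)]
    · exact hring
    · refine hring.subset_span_of_subset ?_
      rintro _ ⟨α, hα, rfl⟩
      refine m0_mem_spanningPminus F ?_ (by omega)
      simp only [Set.mem_ofPred_eq] at hα
      rw [← hα]
      simp [Finset.sum_add_distrib]
  · norm_cast
    omega

theorem lines_basisPminus_one_edge (F : Affine.Simplex ℝ E 1) (r : ℕ)
    (h : ∀ s, s + 1 = r → Lines (basisP B s F 0) (m0 F '' {α | ∑ i, α i = s}) (s + 1 : ℕ)) :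
    Lines (basisPminus B r F 1) (m1 F '' {α | ∑ i, α i + 1 = r}) r := by
  rcases r with _ | s
  · rw [basisPminus_zero]
    simpa using Lines.empty 0
  have hring : Lines (basisPminusRing B (s + 1) F 1) (m1 F '' {α | ∑ i, α i = s}) (s + 1 : ℕ) := by
    have e := basisPminusRing_eq B (k := 1) (l := 0) (n := 1) rfl s F
    rw [add_zero] at e
    rw [e]
    exact (h s rfl).graphI_zero_edge
  rw [basisPminus, iUnion_faces_edge, basisPminusRing_eq_empty_of_lt B (by norm_num),
    basisPminusRing_eq_empty_of_lt B (by norm_num), imageOf_empty, imageOf_empty, Set.empty_union,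
    Set.empty_union, imageOf_graphExtMinus_full F _ (fun T' => basisPminusRing B (s + 1) T' 1)]
  · simpa using hring
  · refine hring.subset_span_of_subset ?_
    rintro _ ⟨α, hα, rfl⟩
    exact m1_mem_spanningPminus F (congrArg (· + 1) hα)

theorem lines_basisPring_one_edge
    (hB : ∀ {n : ℕ} (F : Affine.Simplex ℝ E n) (k : ℕ), n ≤ 1 → k ≤ n →
      IsBasisOf ℝ (B F k) (spaceP ℝ 0 F k)) (F : Affine.Simplex ℝ E 1) (r : ℕ)
    (h : ∀ s, s + 1 = r → Lines (basisP B s F 1) (m1 F '' {α | ∑ i, α i = s}) (s + 1 : ℕ)) :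
    Lines (basisPring B (r + 1) F 1) (m1 F '' {α | ∑ i, α i = r + 1}) (r + 1 + 1 : ℕ) := by
  have e := basisPring_eq B (k := 1) (l := 0) (n := 1) rfl (r + 1) F
  rw [add_zero] at e
  rw [e]
  exact (lines_basisPminus_zero_edge hB F r h).graphJ_one_edge (by omega)

/-- Degree `r + 1` is reached from degree `r - 1` of the same form degree: an interior function is
`λ₀ λ₁` times a monomial, and the 1-forms pass through the functions of `basisPminus (r + 1)`. A
step of two calls for strong induction. -/
theorem lines_edge
    (hB : ∀ {n : ℕ} (F : Affine.Simplex ℝ E n) (k : ℕ), n ≤ 1 → k ≤ n →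
      IsBasisOf ℝ (B F k) (spaceP ℝ 0 F k)) (r : ℕ) (F : Affine.Simplex ℝ E 1) :
    Lines (basisP B r F 0) (m0 F '' {α | ∑ i, α i = r}) (r + 1 : ℕ) ∧
      Lines (basisP B r F 1) (m1 F '' {α | ∑ i, α i = r}) (r + 1 : ℕ) := by
  induction r using Nat.strong_induction_on with
  | _ r ih =>
  rcases r with _ | r
  · have e : ({α | ∑ i, α i = 0} : Set (Fin 2 → ℕ)) = {0} := by
      ext α
      simp [funext_iff]
    rw [basisP_zero, basisP_zero, e, Set.image_singleton, Set.image_singleton]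
    constructor
    · have h := hB F 0 (by norm_num) (by norm_num)
      have e1 : spanningP 0 F 0 = {m0 F 0} := by
        ext ω
        constructor
        · rintro ⟨α, σ, hα, rfl⟩
          obtain rfl : α = 0 := by simpa [funext_iff] using hα
          exact fmul_alternator_zero F _ _
        · rintro rfl
          exact m0_mem_spanningP F (by simp)
      rw [spaceP, e1] at h
      exact Lines.of_isBasisOf (unitForm_ne_zero F) h
    · have h := hB F 1 (by norm_num) (by norm_num)
      have e1 : spaceP ℝ 0 F 1 = Submodule.span ℝ {m1 F 0} := by
        apply le_antisymm
        · refine Submodule.span_le.2 ?_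
          rintro _ ⟨α, σ, hα, rfl⟩
          obtain rfl : α = 0 := by simpa [funext_iff] using hα
          rw [fmul_alternator_edge]
          refine Submodule.mem_span_singleton.2 ⟨if σ 0 = 0 then -1 else 1, ?_⟩
          split_ifs <;> simp
        · refine Submodule.span_le.2 ?_
          rintro _ rfl
          exact Submodule.subset_span (m1_mem_spaceP F (by simp))
      rw [e1] at h
      refine Lines.of_isBasisOf ?_ h
      exact m1_zero_ne_zero F
  · constructor
    · have hring : Lines (basisPring B (r + 1) F 0)
          ((fun α => m0 F (α + 1)) '' {α | ∑ i, α i + 1 = r}) r := by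
        have e := basisPring_eq B (k := 0) (l := 1) (n := 1) rfl r F
        rw [e]
        exact (lines_basisPminus_one_edge F r fun s hs => (ih s (by omega)).1).graphJ_zero_edge
      rw [basisP_succ, iUnion_faces_edge, exponents_edge, Set.image_union, Set.image_union,
        Set.image_singleton, Set.image_singleton, Set.image_image]
      refine Lines.mono_card (((Lines.graphExt_vertex _ rfl (r + 1)
        (lines_point B hB r _).2.2).union (Lines.graphExt_vertex _ rfl (r + 1)
        (lines_point B hB r _).2.2)).union (N' := r) ?_) ?_
      · rw [imageOf_graphExt_full F _ (fun T' => basisPring B (r + 1) T' 0)]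
        · exact hring
        · refine hring.subset_span_of_subset ?_
          rintro _ ⟨α, hα, rfl⟩
          refine m0_mem_spanningP F ?_
          simp only [Set.mem_ofPred_eq] at hα
          rw [← hα]
          simp [Finset.sum_add_distrib]
      · norm_cast
        omega
    · have hring := lines_basisPring_one_edge hB F r fun s hs => (ih s (by omega)).2
      rw [basisP_succ, iUnion_faces_edge, basisPring_eq_empty_of_lt B (by norm_num),
        basisPring_eq_empty_of_lt B (by norm_num), imageOf_empty, imageOf_empty, Set.empty_union,
        Set.empty_union, imageOf_graphExt_full F _ (fun T' => basisPring B (r + 1) T' 1)]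
      · exact hring
      · refine hring.subset_span_of_subset ?_
        rintro _ ⟨α, hα, rfl⟩
        exact m1_mem_spaceP F hα

end Recursion

/-! ### The canonical isomorphisms on a triangle -/

theorem add_form_apply {T : Affine.Simplex ℝ E n} {k : ℕ} (ω η : Form T k) (x : body T)
    (v : Fin k → Tangent T) : (ω + η) x v = ω x v + η x v := rfl

theorem sub_form_apply {T : Affine.Simplex ℝ E n} {k : ℕ} (ω η : Form T k) (x : body T)
    (v : Fin k → Tangent T) : (ω - η) x v = ω x v - η x v := rfl

theorem neg_form_apply {T : Affine.Simplex ℝ E n} {k : ℕ} (ω : Form T k) (x : body T)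
    (v : Fin k → Tangent T) : (-ω) x v = -ω x v := rfl

theorem smul_form_apply {T : Affine.Simplex ℝ E n} {k : ℕ} (c : ℂ) (ω : Form T k) (x : body T)
    (v : Fin k → Tangent T) : (c • ω) x v = c * ω x v := rfl

/-- The pointwise linear map of `1`-forms on a triangle with `dλ_i ↦ λ_i φ_{i+1,i+2}`. -/
def starMap (T : Affine.Simplex ℝ E 2) : Form T 1 →ₗ[ℂ] Form T 1 where
  toFun ω x := ∑ i : Fin 3, ((bary T i x : ℂ) * ω x (fun _ => vertexBasis T i -ᵥ x.1)) •
    whitney T ![i + 1, i + 2] x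
  map_add' ω η := by
    funext x
    simp only [add_form_apply, mul_add, add_smul, Finset.sum_add_distrib]
    rfl
  map_smul' c ω := by
    funext x
    simp only [RingHom.id_apply, Pi.smul_apply, Finset.smul_sum, smul_smul,
      AlternatingMap.smul_apply, smul_eq_mul]
    exact Finset.sum_congr rfl fun i _ => by ring_nf

theorem whitney_pair_apply (T : Affine.Simplex ℝ E n) (i j : Fin (n + 1)) (x : body T)
    (v : Fin 1 → Tangent T) : whitney T ![i, j] x v =
      bary T i x * (dbary T j (v 0) : ℂ) - bary T j x * dbary T i (v 0) :=
  whitney_one_apply T ![i, j] x v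

theorem starMap_apply (T : Affine.Simplex ℝ E 2) (ω : Form T 1) (x : body T)
    (v : Fin 1 → Tangent T) : starMap T ω x v =
      ∑ i : Fin 3, ((bary T i x : ℂ) * ω x (fun _ => vertexBasis T i -ᵥ x.1)) *
        whitney T ![i + 1, i + 2] x v := by
  simp [starMap, Fin.sum_univ_three]

theorem starMap_fmul {T : Affine.Simplex ℝ E 2} (f : body T → ℝ) (ω : Form T 1) :
    starMap T (fmul f ω) = fmul f (starMap T ω) := by
  refine Form.ext fun x v => ?_
  simp only [starMap_apply, fmul_apply, Finset.mul_sum]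
  exact Finset.sum_congr rfl fun i _ => by ring

theorem sum_bary_triangle (T : Affine.Simplex ℝ E 2) (x : Hull T) :
    (bary T 0 x : ℂ) + bary T 1 x + bary T 2 x = 1 := by
  have h := sum_bary T x
  rw [Fin.sum_univ_three] at h
  exact_mod_cast congrArg Complex.ofReal h

theorem sum_dbary_triangle (T : Affine.Simplex ℝ E 2) (w : Tangent T) :
    (dbary T 0 w : ℂ) + dbary T 1 w + dbary T 2 w = 0 := by
  have h := sum_dbary_apply T w
  rw [Fin.sum_univ_three] at h
  exact_mod_cast congrArg Complex.ofReal h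

/-- Since `dλ_j (v_i - x) = δ_ij - λ_j(x)`, the sum defining `starMap` is `λ_j φ_{j+1,j+2}` minus
`λ_j` times the cyclic sum of `λ_i φ_{i+1,i+2}`, and the latter is zero. -/
theorem starMap_dform (T : Affine.Simplex ℝ E 2) (i : Fin 3) :
    starMap T (dform T i) = fmul (fun x => bary T i x) (whitney T ![i + 1, i + 2]) := by
  refine Form.ext fun x v => ?_
  simp only [starMap_apply, fmul_apply, dform_apply, dbary_vsub, bary_vertexBasis,
    Fin.sum_univ_three, whitney_pair_apply]
  fin_cases i <;> simp <;> ring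

/-- By pointwise linearity the left side is `λ_{i+1} λ_{i+2} (φ_{i,i+1} - φ_{i+2,i})`. With `∑ λ_j =
1` and `∑ dλ_j = 0` the bracket collapses to `-dλ_i`, so `-starMap` inverts J. -/
theorem starMap_whitney (T : Affine.Simplex ℝ E 2) (i : Fin 3) :
    starMap T (whitney T ![i + 1, i + 2]) =
      -fmul (fun x => bary T (i + 1) x * bary T (i + 2) x) (dform T i) := by
  have h : whitney T ![i + 1, i + 2] = fmul (fun x => bary T (i + 1) x) (dform T (i + 2)) -
      fmul (fun x => bary T (i + 2) x) (dform T (i + 1)) := by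
    refine Form.ext fun x v => ?_
    simp only [sub_form_apply, fmul_apply, dform_apply, whitney_pair_apply]
  rw [h, map_sub, starMap_fmul, starMap_fmul, starMap_dform, starMap_dform]
  refine Form.ext fun x v => ?_
  simp only [sub_form_apply, neg_form_apply, fmul_apply, dform_apply, whitney_pair_apply]
  have h1 := sum_bary_triangle T x.1
  have h2 := sum_dbary_triangle T (v 0)
  fin_cases i
  · change (bary T 1 x : ℂ) *
      (bary T 2 x * (bary T 0 x * dbary T 1 (v 0) - bary T 1 x * dbary T 0 (v 0)))
      - bary T 2 x * (bary T 1 x * (bary T 2 x * dbary T 0 (v 0) - bary T 0 x * dbary T 2 (v 0))) =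
      -(((bary T 1 x * bary T 2 x : ℝ) : ℂ) * dbary T 0 (v 0))
    push_cast
    linear_combination (bary T 1 x * bary T 2 x : ℂ) * bary T 0 x * h2 -
      (bary T 1 x * bary T 2 x : ℂ) * dbary T 0 (v 0) * h1
  · change (bary T 2 x : ℂ) *
      (bary T 0 x * (bary T 1 x * dbary T 2 (v 0) - bary T 2 x * dbary T 1 (v 0)))
      - bary T 0 x * (bary T 2 x * (bary T 0 x * dbary T 1 (v 0) - bary T 1 x * dbary T 0 (v 0))) =
      -(((bary T 2 x * bary T 0 x : ℝ) : ℂ) * dbary T 1 (v 0))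
    push_cast
    linear_combination (bary T 2 x * bary T 0 x : ℂ) * bary T 1 x * h2 -
      (bary T 2 x * bary T 0 x : ℂ) * dbary T 1 (v 0) * h1
  · change (bary T 0 x : ℂ) *
      (bary T 1 x * (bary T 2 x * dbary T 0 (v 0) - bary T 0 x * dbary T 2 (v 0)))
      - bary T 1 x * (bary T 0 x * (bary T 1 x * dbary T 2 (v 0) - bary T 2 x * dbary T 1 (v 0))) =
      -(((bary T 0 x * bary T 1 x : ℝ) : ℂ) * dbary T 2 (v 0))
    push_cast
    linear_combination (bary T 0 x * bary T 1 x : ℂ) * bary T 2 x * h2 -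
      (bary T 0 x * bary T 1 x : ℂ) * dbary T 2 (v 0) * h1

theorem isCompl_embedding_triangle {σ : Fin 1 ↪o Fin 3} {ρ : Fin (1 + 1) ↪o Fin 3}
    (h : IsCompl (Set.range σ) (Set.range ρ)) : (σ 0 = 0 ∧ ρ 0 = 1 ∧ ρ 1 = 2) ∨
      (σ 0 = 1 ∧ ρ 0 = 0 ∧ ρ 1 = 2) ∨ (σ 0 = 2 ∧ ρ 0 = 0 ∧ ρ 1 = 1) := by
  have h1 := ((isCompl_range_iff σ ρ).1 h).1 0
  have h2 : ρ 0 < ρ 1 := ρ.strictMono (by decide)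
  have h3 := h1 0
  have h4 := h1 1
  revert h2 h3 h4
  generalize σ 0 = a
  generalize ρ 0 = b
  generalize ρ 1 = c
  revert a b c
  decide

/-- The sign `ε(σ, σᶜ)` converts the ascending order of the complement into the cyclic order modulo
3, so that I and J are given by one formula for all indices. -/
theorem seqSign_smul_whitney (T : Affine.Simplex ℝ E 2) {σ : Fin 1 ↪o Fin 3}
    {ρ : Fin (1 + 1) ↪o Fin 3} (h : IsCompl (Set.range σ) (Set.range ρ)) :
    seqSign (Fin.append σ ρ) • whitney T ρ = whitney T ![σ 0 + 1, σ 0 + 2] := by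
  rw [seqSign_one_two]
  refine Form.ext fun x v => ?_
  rw [whitney_pair_apply]
  rcases isCompl_embedding_triangle h with ⟨h0, h1, h2⟩ | ⟨h0, h1, h2⟩ | ⟨h0, h1, h2⟩
  · rw [h0, h1, h2, if_pos (by decide), if_pos (by decide), if_pos (by decide), one_mul, one_mul,
      one_smul, whitney_one_apply, h1, h2]
    rfl
  · rw [h0, h1, h2, if_neg (by decide), if_pos (by decide), if_pos (by decide), mul_one, mul_one,
      neg_one_smul, neg_form_apply, whitney_one_apply, h1, h2]
    exact neg_sub _ _
  · rw [h0, h1, h2, if_neg (by decide), if_neg (by decide), if_pos (by decide), neg_mul_neg,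
      one_mul, one_mul, one_smul, whitney_one_apply, h1, h2]
    rfl

theorem prodBary_triangle (T : Affine.Simplex ℝ E 2) {σ : Fin 1 ↪o Fin 3}
    {ρ : Fin (1 + 1) ↪o Fin 3} (h : IsCompl (Set.range σ) (Set.range ρ)) (x : body T) :
    prodBary T ρ x = bary T (σ 0 + 1) x * bary T (σ 0 + 2) x := by
  rw [prodBary_two]
  rcases isCompl_embedding_triangle h with ⟨h0, h1, h2⟩ | ⟨h0, h1, h2⟩ | ⟨h0, h1, h2⟩
  · rw [h0, h1, h2]
    rfl
  · rw [h0, h1, h2]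
    exact mul_comm _ _
  · rw [h0, h1, h2]
    rfl

theorem alternator_one (T : Affine.Simplex ℝ E n) (σ : Fin 1 → Fin (n + 1)) :
    alternator T σ = dform T (σ 0) :=
  Form.ext fun x v => by rw [alternator_one_apply, dform_apply]

theorem exists_isCompl_right (σ : Fin 1 ↪o Fin 3) :
    ∃ ρ : Fin (1 + 1) ↪o Fin 3, IsCompl (Set.range σ) (Set.range ρ) := by
  have : ∀ i : Fin 3, ∃ j k : Fin 3, j < k ∧ i ≠ j ∧ i ≠ k ∧ ∀ x, i = x ∨ j = x ∨ k = x := by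
    decide
  obtain ⟨j, k, hjk, h1, h2, h3⟩ := this (σ 0)
  refine ⟨emb2 hjk, ?_⟩
  rw [isCompl_range_iff]
  refine ⟨fun a b => ?_, fun x => ?_⟩
  · rw [Subsingleton.elim a 0]
    fin_cases b
    · exact h1
    · exact h2
  · rcases h3 x with h | h | h
    · exact Or.inl ⟨0, h⟩
    · exact Or.inr ⟨0, h⟩
    · exact Or.inr ⟨1, h⟩

theorem exists_isCompl_left (ρ : Fin (1 + 1) ↪o Fin 3) :
    ∃ σ : Fin 1 ↪o Fin 3, IsCompl (Set.range σ) (Set.range ρ) := by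
  have : ∀ j k : Fin 3, j < k → ∃ i, i ≠ j ∧ i ≠ k ∧ ∀ x, i = x ∨ j = x ∨ k = x := by
    decide
  obtain ⟨i, h1, h2, h3⟩ := this (ρ 0) (ρ 1) (ρ.strictMono (by decide))
  refine ⟨emb1 i, ?_⟩
  rw [isCompl_range_iff]
  refine ⟨fun a b => ?_, fun x => ?_⟩
  · rw [Subsingleton.elim a 0]
    fin_cases b
    · exact h1
    · exact h2
  · rcases h3 x with h | h | h
    · exact Or.inl ⟨0, h⟩
    · exact Or.inr ⟨0, h⟩
    · exact Or.inr ⟨1, h⟩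

theorem fmul_zsmul {T : Affine.Simplex ℝ E n} {k : ℕ} (c : ℤ) (f : body T → ℝ) (ω : Form T k) :
    c • fmul f ω = fmul f (c • ω) := by
  funext x
  exact smul_comm c (f x) (ω x)

theorem imageOf_graphI_triangle {T : Affine.Simplex ℝ E 2} {s : ℕ} {Q : Set (Form T 1)}
    (hQ : Q ⊆ spaceP ℂ s T 1) : imageOf (graphI s T 1 1) Q = starMap T '' Q := by
  refine imageOf_eq_image (starMap T) ?_ ?_ hQ
  · intro p hp
    refine Submodule.span_induction ?_ (map_zero _).symm ?_ ?_ hp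
    · rintro _ ⟨α, σ, ρ, hα, hc, rfl⟩
      simp only
      rw [fmul_zsmul, fmul_zsmul, seqSign_smul_whitney T hc, alternator_one, starMap_fmul,
        starMap_dform]
      congr 2
      funext x
      exact prodBary_one T σ x
    · rintro p q - - hp hq
      simp_all
    · rintro c p - hp
      simp_all
  · rintro _ ⟨α, σ, hα, rfl⟩
    obtain ⟨ρ, hc⟩ := exists_isCompl_right σ
    exact ⟨_, Submodule.subset_span ⟨α, σ, ρ, hα, hc, rfl⟩⟩

theorem inverseImageOf_graphJ_triangle {T : Affine.Simplex ℝ E 2} {s : ℕ} {Q : Set (Form T 1)}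
    (hQ : Q ⊆ spacePminus ℂ s T 1) : inverseImageOf (graphJ s T 1 1) Q = (-starMap T) '' Q := by
  have key : ∀ (α : Fin 3 → ℕ) (σ : Fin 1 ↪o Fin 3) (ρ : Fin (1 + 1) ↪o Fin 3),
      IsCompl (Set.range σ) (Set.range ρ) →
      fmul (mono T α) (fmul (prodBary T ρ) (alternator T σ)) =
      (-starMap T) (seqSign (Fin.append σ ρ) • fmul (mono T α) (whitney T ρ)) := by
    intro α σ ρ hc
    rw [fmul_zsmul, seqSign_smul_whitney T hc, alternator_one, LinearMap.neg_apply, starMap_fmul,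
      starMap_whitney]
    refine Form.ext fun x v => ?_
    simp only [fmul_apply, neg_form_apply, prodBary_triangle T hc]
    ring
  refine inverseImageOf_eq_image (-starMap T) ?_ ?_ hQ
  · intro p hp
    refine Submodule.span_induction ?_ (map_zero _).symm ?_ ?_ hp
    · rintro _ ⟨α, σ, ρ, hα, hc, rfl⟩
      exact key α σ ρ hc
    · rintro p q - - hp hq
      rw [Prod.fst_add, Prod.snd_add, hp, hq, map_add]
    · rintro c p - hp
      rw [Prod.smul_fst, Prod.smul_snd, hp, map_smul]
  · rintro _ ⟨α, ρ, hα, rfl⟩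
    obtain ⟨σ, hc⟩ := exists_isCompl_left ρ
    have h1 : (_, seqSign (Fin.append σ ρ) • fmul (mono T α) (whitney T ρ)) ∈ graphJ s T 1 1 :=
      Submodule.subset_span ⟨α, σ, ρ, hα, hc, rfl⟩
    -- The prescribed value carries a sign; multiplying the pair by the sign once more yields the
    -- bare form `λ^α φ_ρ`.
    have hsq : seqSign (Fin.append σ ρ) * seqSign (Fin.append σ ρ) = 1 := by
      rw [seqSign_one_two]
      split_ifs <;> norm_num
    have h2 := zsmul_mem h1 (seqSign (Fin.append σ ρ))
    rw [Prod.smul_mk, smul_smul, hsq, one_smul] at h2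
    exact ⟨_, h2⟩

/-! ### Forms on a triangle that are extended from its edges -/

/-- The form `λ_i^a λ_j^b (b dλ_i - a dλ_j)`. -/
def edgeP (T : Affine.Simplex ℝ E 2) (i j : Fin 3) (a b : ℕ) : Form T 1 :=
  fmul (mono T (Pi.single i a + Pi.single j b)) ((b : ℂ) • dform T i - (a : ℂ) • dform T j)

/-- The form `λ_i^a λ_j^b φ_ij`. -/
def edgeM (T : Affine.Simplex ℝ E 2) (i j : Fin 3) (a b : ℕ) : Form T 1 :=
  fmul (mono T (Pi.single i a + Pi.single j b)) (whitney T ![i, j])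

/-- The forms `λ_i^a λ_j^b (b dλ_i - a dλ_j)` of degree `r`. -/
def edgeSetP (T : Affine.Simplex ℝ E 2) (r : ℕ) : Set (Form T 1) :=
  {ω | ∃ i j : Fin 3, i ≠ j ∧ ∃ a b : ℕ, a + b = r ∧ ω = edgeP T i j a b}

/-- The forms `λ_i^a λ_j^b φ_ij` of degree `r`. -/
def edgeSetM (T : Affine.Simplex ℝ E 2) (r : ℕ) : Set (Form T 1) :=
  {ω | ∃ i j : Fin 3, i ≠ j ∧ ∃ a b : ℕ, a + b + 1 = r ∧ ω = edgeM T i j a b}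

theorem edgeP_swap (T : Affine.Simplex ℝ E 2) (i j : Fin 3) (a b : ℕ) :
    edgeP T j i b a = -edgeP T i j a b := by
  refine Form.ext fun x v => ?_
  simp only [edgeP, fmul_apply, neg_form_apply, sub_form_apply, smul_form_apply,
    add_comm (Pi.single j b : Fin 3 → ℕ)]
  ring

theorem edgeM_swap (T : Affine.Simplex ℝ E 2) (i j : Fin 3) (a b : ℕ) :
    edgeM T j i b a = -edgeM T i j a b := by
  refine Form.ext fun x v => ?_
  simp only [edgeM, fmul_apply, neg_form_apply, whitney_pair_apply,
    add_comm (Pi.single j b : Fin 3 → ℕ)]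
  ring

theorem extend_vec2 {N : ℕ} {i j : Fin N} (hij : i ≠ j) (α : Fin (1 + 1) → ℕ) :
    Function.extend (![i, j] : Fin (1 + 1) → Fin N) α 0 =
      Pi.single i (α 0) + Pi.single j (α 1) := by
  have hinj : Function.Injective (![i, j] : Fin (1 + 1) → Fin N) := by
    intro a b h
    fin_cases a <;> fin_cases b
    · rfl
    · exact absurd h hij
    · exact absurd h.symm hij
    · rfl
  ext k
  by_cases hi : k = i
  · subst hi
    simpa [hij] using hinj.extend_apply α 0 0
  by_cases hj : k = j
  · subst hj
    simpa [hi] using hinj.extend_apply α 0 1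
  rw [Function.extend_apply']
  · simp [hi, hj]
  · rintro ⟨a, rfl⟩
    fin_cases a
    · exact hi rfl
    · exact hj rfl

theorem sum_single_add_single {N : ℕ} (i j : Fin N) (a b : ℕ) :
    ∑ k, (Pi.single i a + Pi.single j b : Fin N → ℕ) k = a + b := by
  simp [Finset.sum_add_distrib]

/-- For exponents `a + b = r` on the edge, `Ψ_i = dλ_i - (a/r)(dλ_i + dλ_j) = (1/r)(b dλ_i - a
dλ_j)`, and `Ψ_j` is its negative. Division by `r` requires `r ≠ 0`. -/
theorem Lines.graphExt_edge {T : Affine.Simplex ℝ E 2} {fs : Finset (Fin (2 + 1))}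
    (h : fs.card = 1 + 1) {i j : Fin 3} (hij : i < j) (hfs : fs = {i, j})
    {Q : Set (Form (T.face h) 1)} {N : ℕ∞} {r : ℕ} (hr : r ≠ 0)
    (hQ : Lines Q (m1 (T.face h) '' {α | ∑ i, α i = r}) N) :
    Lines (FEEC.imageOf (graphExt r T h 1) Q)
      {ω | ∃ a b : ℕ, a + b = r ∧ ω = edgeP T i j a b} N := by
  have e := orderEmbOfFin_pair h hij hfs
  have e0 : fs.orderEmbOfFin h 0 = i := congrFun e 0
  have e1 : fs.orderEmbOfFin h 1 = j := congrFun e 1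
  have hij' := hij.ne
  have key : ∀ (α : Fin (1 + 1) → ℕ) (σ : Fin 1 ↪o Fin (1 + 1)), ∑ i, α i = r →
      (fmul (mono (T.face h) α) (alternator (T.face h) σ),
      fmul (mono T (Function.extend (fs.orderEmbOfFin h) α 0))
        (psi T fs (Function.extend (fs.orderEmbOfFin h) α 0) (fs.orderEmbOfFin h ∘ σ))) =
      ((if σ 0 = 0 then (-1 : ℂ) else 1) • m1 (T.face h) α,
        (if σ 0 = 0 then (-1 : ℂ) else 1) • ((-(r : ℂ)⁻¹) • edgeP T i j (α 0) (α 1))) := by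
    intro α σ hα
    rw [fmul_alternator_edge]
    refine Prod.ext rfl (Form.ext fun x v => ?_)
    have hr' : (r : ℂ) ≠ 0 := by exact_mod_cast hr
    have hα' : (α 0 : ℂ) + α 1 = r := by
      rw [Fin.sum_univ_two] at hα
      exact_mod_cast hα
    simp only [smul_form_apply, edgeP, fmul_apply, sub_form_apply, dform_apply]
    rw [psi_one_apply, Function.comp_apply, e, extend_vec2 hij', ← Nat.cast_sum,
      sum_single_add_single, Nat.cast_add, hα', hfs, Finset.sum_pair hij']
    have hσ : σ 0 = 0 ∨ σ 0 = 1 := by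
      generalize σ 0 = a
      revert a
      decide
    rcases hσ with hσ | hσ
    · rw [hσ, if_pos rfl]
      simp only [Matrix.cons_val_zero, Pi.add_apply, Pi.single_eq_same, Pi.single_eq_of_ne hij',
        add_zero]
      rw [← hα'] at hr' ⊢
      field_simp
      ring
    · rw [hσ, if_neg (by decide)]
      simp only [Matrix.cons_val_one, Matrix.cons_val_fin_one, Pi.add_apply, Pi.single_eq_same,
        Pi.single_eq_of_ne hij'.symm, zero_add]
      rw [← hα'] at hr' ⊢
      field_simp
      ring
  have h1 : Lines (FEEC.imageOf (graphExt r T h 1) Q)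
      ((fun α : Fin 2 → ℕ => (-(r : ℂ)⁻¹) • edgeP T i j (α 0) (α 1)) '' {α | ∑ i, α i = r}) N := by
    refine hQ.imageOf (linearIndependent_m1 _ (r := r) fun α hα => hα) ?_ ?_
    · rintro _ ⟨α, σ, hα, rfl⟩
      exact ⟨α, hα, _, key α σ hα⟩
    · intro α hα
      refine Submodule.subset_span ⟨α, emb1 1, hα, ?_⟩
      rw [key α _ hα, if_neg (by decide), one_smul, one_smul]
  have hr' : (r : ℝ) ≠ 0 := by exact_mod_cast hr
  refine h1.congr ?_ ?_
  · rintro _ ⟨α, hα, rfl⟩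
    refine ⟨-(r : ℝ)⁻¹, by simpa using hr, _, ⟨α 0, α 1, ?_, rfl⟩, by push_cast; rfl⟩
    simpa using hα
  · rintro _ ⟨a, b, hab, rfl⟩
    refine ⟨-(r : ℝ), by simpa using hr, _, ⟨![a, b], by simpa using hab, rfl⟩, ?_⟩
    have hr'' : (r : ℂ) ≠ 0 := by exact_mod_cast hr
    rw [smul_smul]
    push_cast
    rw [neg_mul_neg, mul_inv_cancel₀ hr'', one_smul]

theorem Lines.graphExtMinus_edge {T : Affine.Simplex ℝ E 2} {fs : Finset (Fin (2 + 1))}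
    (h : fs.card = 1 + 1) {i j : Fin 3} (hij : i < j) (hfs : fs = {i, j})
    {Q : Set (Form (T.face h) 1)} {N : ℕ∞} {r : ℕ}
    (hQ : Lines Q (m1 (T.face h) '' {α | ∑ i, α i = r}) N) :
    Lines (FEEC.imageOf (graphExtMinus (r + 1) T h 1) Q)
      {ω | ∃ a b : ℕ, a + b + 1 = r + 1 ∧ ω = edgeM T i j a b} N := by
  have e := orderEmbOfFin_pair h hij hfs
  have key : ∀ (α : Fin (1 + 1) → ℕ) (ρ : Fin (1 + 1) ↪o Fin (1 + 1)),
      (fmul (mono (T.face h) α) (whitney (T.face h) ρ),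
      fmul (mono T (Function.extend (fs.orderEmbOfFin h) α 0))
        (whitney T (fs.orderEmbOfFin h ∘ ρ))) =
      (m1 (T.face h) α, edgeM T i j (α 0) (α 1)) := by
    intro α ρ
    rw [fmul_whitney_edge]
    refine Prod.ext rfl ?_
    have hρ : (fs.orderEmbOfFin h ∘ ρ : Fin (1 + 1) → Fin 3) = ![i, j] := by
      funext k
      obtain ⟨h0, h1⟩ := embedding_two ρ
      fin_cases k
      · exact (congrArg _ h0).trans (congrFun e 0)
      · exact (congrArg _ h1).trans (congrFun e 1)
    rw [hρ, e, extend_vec2 hij.ne]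
    rfl
  have h1 : Lines (FEEC.imageOf (graphExtMinus (r + 1) T h 1) Q)
      ((fun α : Fin 2 → ℕ => edgeM T i j (α 0) (α 1)) '' {α | ∑ i, α i = r}) N := by
    refine hQ.imageOf (linearIndependent_m1 _ (r := r) fun α hα => hα) ?_ ?_
    · rintro _ ⟨α, ρ, hα, rfl⟩
      exact ⟨α, Nat.succ_injective hα, 1, by rw [key, one_smul, one_smul]⟩
    · intro α hα
      exact Submodule.subset_span ⟨α, emb2 zero_lt_one_fin_two, congrArg (· + 1) hα,
        (key α _).symm⟩
  convert h1 using 1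
  ext ω
  constructor
  · rintro ⟨a, b, hab, rfl⟩
    exact ⟨![a, b], by simpa using hab, rfl⟩
  · rintro ⟨α, hα, rfl⟩
    exact ⟨α 0, α 1, by simpa using hα, rfl⟩

theorem iUnion_faces_triangle {V : Type*}
    (X : ∀ (m : ℕ) (fs : Finset (Fin (2 + 1))) (_ : fs.card = m + 1), Set V)
    (hX : ∀ fs h, X 0 fs h = ∅) :
    (⋃ (m : ℕ) (fs : Finset (Fin (2 + 1))) (h : fs.card = m + 1), X m fs h) =
      (X 1 {0, 1} (by decide) ∪ X 1 {0, 2} (by decide) ∪ X 1 {1, 2} (by decide)) ∪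
        X 2 Finset.univ (Finset.card_fin (2 + 1)) := by
  apply Set.Subset.antisymm
  · refine Set.iUnion_subset fun m => Set.iUnion_subset fun fs => Set.iUnion_subset fun h => ?_
    have h1 := Finset.card_le_univ fs
    rw [Fintype.card_fin] at h1
    have hm : m = 0 ∨ m = 1 ∨ m = 2 := by omega
    rcases hm with rfl | rfl | rfl
    · rw [hX]
      exact Set.empty_subset _
    · have hfs : fs = {0, 1} ∨ fs = {0, 2} ∨ fs = {1, 2} := by
        clear h1
        revert fs
        decide
      rcases hfs with rfl | rfl | rfl
      · exact fun x hx => Or.inl (Or.inl (Or.inl hx))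
      · exact fun x hx => Or.inl (Or.inl (Or.inr hx))
      · exact fun x hx => Or.inl (Or.inr hx)
    · obtain rfl : fs = Finset.univ := (Finset.card_eq_iff_eq_univ fs).1 h
      exact fun x hx => Or.inr hx
  · rintro x (((hx | hx) | hx) | hx)
    · exact Set.mem_iUnion.2 ⟨1, Set.mem_iUnion₂.2 ⟨_, _, hx⟩⟩
    · exact Set.mem_iUnion.2 ⟨1, Set.mem_iUnion₂.2 ⟨_, _, hx⟩⟩
    · exact Set.mem_iUnion.2 ⟨1, Set.mem_iUnion₂.2 ⟨_, _, hx⟩⟩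
    · exact Set.mem_iUnion.2 ⟨2, Set.mem_iUnion₂.2 ⟨_, _, hx⟩⟩

/-- Reversing an edge only changes the sign, so the target may be indexed by ordered pairs of
distinct vertices; in this form it is visibly stable under permutations of the vertices. -/
theorem Lines.union_edges {T : Affine.Simplex ℝ E 2} {p : ℕ → ℕ → Prop}
    {f : Fin 3 → Fin 3 → ℕ → ℕ → Form T 1} (hp : ∀ a b, p a b → p b a)
    (hf : ∀ i j a b, f j i b a = -f i j a b) {Q₀ Q₁ Q₂ : Set (Form T 1)} {N : ℕ∞}
    (h₀ : Lines Q₀ {ω | ∃ a b : ℕ, p a b ∧ ω = f 0 1 a b} N)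
    (h₁ : Lines Q₁ {ω | ∃ a b : ℕ, p a b ∧ ω = f 0 2 a b} N)
    (h₂ : Lines Q₂ {ω | ∃ a b : ℕ, p a b ∧ ω = f 1 2 a b} N) :
    Lines (Q₀ ∪ Q₁ ∪ Q₂) {ω | ∃ i j : Fin 3, i ≠ j ∧ ∃ a b : ℕ, p a b ∧ ω = f i j a b}
      (N + N + N) := by
  refine ((h₀.union h₁).union h₂).congr ?_ ?_
  · rintro _ ((⟨a, b, h, rfl⟩ | ⟨a, b, h, rfl⟩) | ⟨a, b, h, rfl⟩)
    · exact ⟨1, one_ne_zero, _, ⟨0, 1, by decide, a, b, h, rfl⟩, by simp⟩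
    · exact ⟨1, one_ne_zero, _, ⟨0, 2, by decide, a, b, h, rfl⟩, by simp⟩
    · exact ⟨1, one_ne_zero, _, ⟨1, 2, by decide, a, b, h, rfl⟩, by simp⟩
  · have main : ∀ i j : Fin 3, i < j → ∀ a b, p a b →
        f i j a b ∈ ({ω | ∃ a b : ℕ, p a b ∧ ω = f 0 1 a b} ∪
          {ω | ∃ a b : ℕ, p a b ∧ ω = f 0 2 a b}) ∪ {ω | ∃ a b : ℕ, p a b ∧ ω = f 1 2 a b} := by
      intro i j hij a b hab
      have : (i = 0 ∧ j = 1) ∨ (i = 0 ∧ j = 2) ∨ (i = 1 ∧ j = 2) := by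
        revert i j
        decide
      rcases this with ⟨rfl, rfl⟩ | ⟨rfl, rfl⟩ | ⟨rfl, rfl⟩
      · exact Or.inl (Or.inl ⟨a, b, hab, rfl⟩)
      · exact Or.inl (Or.inr ⟨a, b, hab, rfl⟩)
      · exact Or.inr ⟨a, b, hab, rfl⟩
    rintro _ ⟨i, j, hij, a, b, hab, rfl⟩
    rcases lt_or_gt_of_ne hij with h | h
    · exact ⟨1, one_ne_zero, _, main i j h a b hab, by simp⟩
    · exact ⟨-1, by norm_num, _, main j i h b a (hp a b hab), by rw [hf]; simp⟩

-- The two recursion formulas on a triangle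

section Recursion

variable {B : ∀ {n : ℕ} (T : Affine.Simplex ℝ E n) (k : ℕ), Set (Form T k)}

/-- Vertices carry no 1-forms, each edge carries the `r + 2` monomials of degree `r + 1`, and the
interior is `-starMap` of the lower set. The inclusions `hsub` and `hsub'` ensure that the relations
are defined on these sets. -/
theorem basisP_triangle_eq
    (hB : ∀ {n : ℕ} (F : Affine.Simplex ℝ E n) (k : ℕ), n ≤ 1 → k ≤ n →
      IsBasisOf ℝ (B F k) (spaceP ℝ 0 F k)) (T : Affine.Simplex ℝ E 2) (r : ℕ)
    (hsub : basisPminus B r T 1 ⊆ spacePminus ℂ r T 1)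
    (hsub' : (-starMap T) '' basisPminus B r T 1 ⊆ spaceP ℂ (r + 1) T 1) :
    ∃ Q, Lines Q (edgeSetP T (r + 1)) (3 * (r + 2) : ℕ) ∧
      basisP B (r + 1) T 1 = Q ∪ (-starMap T) '' basisPminus B r T 1 := by
  have hring : basisPring B (r + 1) T 1 = (-starMap T) '' basisPminus B r T 1 := by
    rw [basisPring_eq B (k := 1) (l := 1) (n := 2) rfl r T, inverseImageOf_graphJ_triangle hsub]
  have hedge : ∀ (fs : Finset (Fin (2 + 1))) (h : fs.card = 1 + 1) (i j : Fin 3), i < j →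
      fs = {i, j} → Lines (imageOf (graphExt (r + 1) T h 1) (basisPring B (r + 1) (T.face h) 1))
        {ω | ∃ a b : ℕ, a + b = r + 1 ∧ ω = edgeP T i j a b} (r + 2 : ℕ) :=
    fun fs h i j hij hfs => Lines.graphExt_edge h hij hfs (by omega)
      (lines_basisPring_one_edge hB _ r fun s _ => (lines_edge hB s _).2)
  have hQ := (Lines.union_edges (p := fun a b => a + b = r + 1) (f := edgeP T)
    (fun a b h => by omega) (edgeP_swap T) (hedge _ (by decide) 0 1 (by decide) rfl)
    (hedge _ (by decide) 0 2 (by decide) rfl)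
    (hedge _ (by decide) 1 2 (by decide) rfl)).mono_card (M := (3 * (r + 2) : ℕ))
    (by norm_cast; omega)
  refine ⟨_, hQ, ?_⟩
  rw [basisP_succ, iUnion_faces_triangle,
    imageOf_graphExt_full T _ (fun T' => basisPring B (r + 1) T' 1), hring]
  · rw [hring]
    exact hsub'
  · intro fs h
    rw [basisPring_eq_empty_of_lt B (by norm_num), imageOf_empty]

theorem basisPminus_triangle_eq
    (hB : ∀ {n : ℕ} (F : Affine.Simplex ℝ E n) (k : ℕ), n ≤ 1 → k ≤ n →
      IsBasisOf ℝ (B F k) (spaceP ℝ 0 F k)) (T : Affine.Simplex ℝ E 2) (r : ℕ)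
    (hsub : basisPminusRing B (r + 1) T 1 ⊆ spacePminus ℂ (r + 1) T 1) :
    ∃ Q, Lines Q (edgeSetM T (r + 1)) (3 * (r + 1) : ℕ) ∧
      basisPminus B (r + 1) T 1 = Q ∪ basisPminusRing B (r + 1) T 1 := by
  have hedge : ∀ (fs : Finset (Fin (2 + 1))) (h : fs.card = 1 + 1) (i j : Fin 3), i < j →
      fs = {i, j} → Lines (imageOf (graphExtMinus (r + 1) T h 1)
        (basisPminusRing B (r + 1) (T.face h) 1))
        {ω | ∃ a b : ℕ, a + b + 1 = r + 1 ∧ ω = edgeM T i j a b} (r + 1 : ℕ) := by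
    intro fs h i j hij hfs
    refine Lines.graphExtMinus_edge h hij hfs ?_
    have e := basisPminusRing_eq B (k := 1) (l := 0) (n := 1) rfl r (T.face h)
    rw [add_zero] at e
    rw [e]
    exact (lines_edge hB r _).1.graphI_zero_edge
  have hQ := (Lines.union_edges (p := fun a b => a + b + 1 = r + 1) (f := edgeM T)
    (fun a b h => by omega) (edgeM_swap T) (hedge _ (by decide) 0 1 (by decide) rfl)
    (hedge _ (by decide) 0 2 (by decide) rfl)
    (hedge _ (by decide) 1 2 (by decide) rfl)).mono_card (M := (3 * (r + 1) : ℕ))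
    (by norm_cast; omega)
  refine ⟨_, hQ, ?_⟩
  rw [basisPminus, iUnion_faces_triangle,
    imageOf_graphExtMinus_full T _ (fun T' => basisPminusRing B (r + 1) T' 1)]
  · exact hsub
  · intro fs h
    rw [basisPminusRing_eq_empty_of_lt B (by norm_num), imageOf_empty]

end Recursion

/-! ### Spanning sets of the polynomial `1`-forms on a triangle -/

theorem fmul_mem_spaceP (T : Affine.Simplex ℝ E n) {r : ℕ} {α : Fin (n + 1) → ℕ}
    (hα : ∑ i, α i = r) (i : Fin (n + 1)) : fmul (mono T α) (dform T i) ∈ spaceP ℂ r T 1 :=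
  Submodule.subset_span ⟨α, emb1 i, hα, rfl⟩

theorem fmul_mem_spacePminus (T : Affine.Simplex ℝ E n) {r : ℕ} {α : Fin (n + 1) → ℕ}
    (hα : ∑ i, α i + 1 = r) {i j : Fin (n + 1)} (hij : i ≠ j) :
    fmul (mono T α) (whitney T ![i, j]) ∈ spacePminus ℂ r T 1 := by
  rcases lt_or_gt_of_ne hij with h | h
  · exact Submodule.subset_span ⟨α, emb2 h, hα, rfl⟩
  · have h1 : fmul (mono T α) (whitney T ![j, i]) ∈ spacePminus ℂ r T 1 :=
      Submodule.subset_span ⟨α, emb2 h, hα, rfl⟩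
    have h2 : fmul (mono T α) (whitney T ![i, j]) = -fmul (mono T α) (whitney T ![j, i]) := by
      refine Form.ext fun x v => ?_
      simp only [fmul_apply, neg_form_apply, whitney_pair_apply]
      ring
    rw [h2]
    exact neg_mem h1

theorem fmul_mono_bary (T : Affine.Simplex ℝ E n) {k : ℕ} (α : Fin (n + 1) → ℕ)
    (i : Fin (n + 1)) (ω : Form T k) :
    fmul (mono T α) (fmul (fun x => bary T i x) ω) = fmul (mono T (α + Pi.single i 1)) ω := by
  refine Form.ext fun x v => ?_
  simp only [fmul_apply, mono_add, mono_single, pow_one]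
  push_cast
  ring

theorem fmul_mono_bary_bary (T : Affine.Simplex ℝ E n) {k : ℕ} (α : Fin (n + 1) → ℕ)
    (i j : Fin (n + 1)) (ω : Form T k) :
    fmul (mono T α) (fmul (fun x => bary T i x * bary T j x) ω) =
      fmul (mono T (α + Pi.single i 1 + Pi.single j 1)) ω := by
  refine Form.ext fun x v => ?_
  simp only [fmul_apply, mono_add, mono_single, pow_one]
  push_cast
  ring

theorem sum_add_single {N : ℕ} (α : Fin N → ℕ) (i : Fin N) :
    ∑ k, (α + Pi.single i 1 : Fin N → ℕ) k = ∑ k, α k + 1 := by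
  simp [Finset.sum_add_distrib]

theorem fmul_neg {T : Affine.Simplex ℝ E n} {k : ℕ} (f : body T → ℝ) (ω : Form T k) :
    fmul f (-ω) = -fmul f ω :=
  Form.ext fun x v => by simp only [fmul_apply, neg_form_apply, mul_neg]

theorem starMap_fmul_mono_dform (T : Affine.Simplex ℝ E 2) (α : Fin 3 → ℕ) (i : Fin 3) :
    starMap T (fmul (mono T α) (dform T i)) =
      fmul (mono T (α + Pi.single i 1)) (whitney T ![i + 1, i + 2]) := by
  rw [starMap_fmul, starMap_dform, fmul_mono_bary]

theorem starMap_fmul_mono_whitney (T : Affine.Simplex ℝ E 2) (α : Fin 3 → ℕ) (i : Fin 3) :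
    starMap T (fmul (mono T α) (whitney T ![i + 1, i + 2])) =
      -fmul (mono T (α + Pi.single (i + 1) 1 + Pi.single (i + 2) 1)) (dform T i) := by
  rw [starMap_fmul, starMap_whitney, fmul_neg, fmul_mono_bary_bary]

/-- A spanning form `λ^α φ_ρ` is, up to sign, of the form `λ^α φ_{i+1,i+2}`. -/
theorem exists_eq_of_mem_spanningPminus {T : Affine.Simplex ℝ E 2} {r : ℕ} {ω : Form T 1}
    (h : ω ∈ spanningPminus r T 1) : ∃ (α : Fin 3 → ℕ) (i : Fin 3), ∑ j, α j + 1 = r ∧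
      (ω = fmul (mono T α) (whitney T ![i + 1, i + 2]) ∨
        ω = -fmul (mono T α) (whitney T ![i + 1, i + 2])) := by
  obtain ⟨α, ρ, hα, rfl⟩ := h
  obtain ⟨σ, hc⟩ := exists_isCompl_left ρ
  refine ⟨α, σ 0, hα, ?_⟩
  rw [← seqSign_smul_whitney T hc, seqSign_one_two]
  rcases isCompl_embedding_triangle hc with ⟨h0, h1, h2⟩ | ⟨h0, h1, h2⟩ | ⟨h0, h1, h2⟩
  · left
    simp [h0, h1, h2]
  · right
    simp [h0, h1, h2, fmul_neg]
  · left
    simp [h0, h1, h2]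

theorem map_starMap_spaceP_le (T : Affine.Simplex ℝ E 2) (r : ℕ) :
    (spaceP ℂ r T 1).map (starMap T) ≤ spacePminus ℂ (r + 2) T 1 := by
  rw [spaceP, Submodule.map_span, Submodule.span_le]
  rintro _ ⟨_, ⟨α, σ, hα, rfl⟩, rfl⟩
  rw [alternator_one, starMap_fmul_mono_dform]
  refine fmul_mem_spacePminus T ?_ ?_
  · rw [sum_add_single, hα]
  · generalize σ 0 = i
    revert i
    decide

theorem map_starMap_spacePminus_le (T : Affine.Simplex ℝ E 2) (r : ℕ) :
    (spacePminus ℂ r T 1).map (starMap T) ≤ spaceP ℂ (r + 1) T 1 := by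
  rw [spacePminus, Submodule.map_span, Submodule.span_le]
  rintro _ ⟨ω, hω, rfl⟩
  obtain ⟨α, i, hα, rfl | rfl⟩ := exists_eq_of_mem_spanningPminus hω
  · rw [starMap_fmul_mono_whitney]
    refine neg_mem (fmul_mem_spaceP T ?_ i)
    rw [sum_add_single, sum_add_single, hα]
  · rw [map_neg, starMap_fmul_mono_whitney, neg_neg]
    refine fmul_mem_spaceP T ?_ i
    rw [sum_add_single, sum_add_single, hα]

theorem edgeSetP_subset (T : Affine.Simplex ℝ E 2) (r : ℕ) :
    edgeSetP T r ⊆ spaceP ℂ r T 1 := by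
  rintro _ ⟨i, j, hij, a, b, hab, rfl⟩
  have e : edgeP T i j a b = (b : ℂ) • fmul (mono T (Pi.single i a + Pi.single j b)) (dform T i) -
      (a : ℂ) • fmul (mono T (Pi.single i a + Pi.single j b)) (dform T j) := by
    refine Form.ext fun x v => ?_
    simp only [edgeP, fmul_apply, sub_form_apply, smul_form_apply]
    ring
  rw [e]
  have hs := (sum_single_add_single i j a b).trans hab
  exact sub_mem (Submodule.smul_mem _ _ (fmul_mem_spaceP T hs i))
    (Submodule.smul_mem _ _ (fmul_mem_spaceP T hs j))

theorem edgeSetM_subset (T : Affine.Simplex ℝ E 2) (r : ℕ) :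
    edgeSetM T r ⊆ spacePminus ℂ r T 1 := by
  rintro _ ⟨i, j, hij, a, b, hab, rfl⟩
  exact fmul_mem_spacePminus T (by rw [sum_single_add_single]; exact hab) hij

theorem sub_single_add_single {N : ℕ} {α : Fin N → ℕ} {i : Fin N} (h : α i ≠ 0) :
    α - Pi.single i 1 + Pi.single i 1 = α := by
  refine tsub_add_cancel_of_le fun a => ?_
  by_cases ha : a = i
  · subst ha
    simpa using Nat.one_le_iff_ne_zero.2 h
  · simp [ha]

theorem eq_single_add_single {α : Fin 3 → ℕ} {i j k : Fin 3} (hij : i ≠ j) (hik : i ≠ k)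
    (hjk : j ≠ k) (h : α i = 0) : Pi.single j (α j) + Pi.single k (α k) = α := by
  ext l
  have hl : l = i ∨ l = j ∨ l = k := by omega
  rcases hl with rfl | rfl | rfl
  · simp [hij, hik, h]
  · simp [hjk]
  · simp [hjk.symm]

theorem sum_eq_of_ne (α : Fin 3 → ℕ) {i j k : Fin 3} (hij : i ≠ j) (hik : i ≠ k) (hjk : j ≠ k) :
    ∑ l, α l = α i + α j + α k := by
  rw [Fin.sum_univ_three]
  have : ∀ i j k : Fin 3, i ≠ j → i ≠ k → j ≠ k → (i = 0 ∧ j = 1 ∧ k = 2) ∨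
      (i = 0 ∧ j = 2 ∧ k = 1) ∨ (i = 1 ∧ j = 0 ∧ k = 2) ∨ (i = 1 ∧ j = 2 ∧ k = 0) ∨
      (i = 2 ∧ j = 0 ∧ k = 1) ∨ (i = 2 ∧ j = 1 ∧ k = 0) := by decide
  rcases this i j k hij hik hjk with ⟨rfl, rfl, rfl⟩ | ⟨rfl, rfl, rfl⟩ | ⟨rfl, rfl, rfl⟩ |
    ⟨rfl, rfl, rfl⟩ | ⟨rfl, rfl, rfl⟩ | ⟨rfl, rfl, rfl⟩ <;> omega

theorem sum_dbary_of_ne (T : Affine.Simplex ℝ E 2) (w : Tangent T) {i j k : Fin 3} (hij : i ≠ j)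
    (hik : i ≠ k) (hjk : j ≠ k) : (dbary T i w : ℂ) + dbary T j w + dbary T k w = 0 := by
  have h := sum_dbary_triangle T w
  have : ∀ i j k : Fin 3, i ≠ j → i ≠ k → j ≠ k → (i = 0 ∧ j = 1 ∧ k = 2) ∨
      (i = 0 ∧ j = 2 ∧ k = 1) ∨ (i = 1 ∧ j = 0 ∧ k = 2) ∨ (i = 1 ∧ j = 2 ∧ k = 0) ∨
      (i = 2 ∧ j = 0 ∧ k = 1) ∨ (i = 2 ∧ j = 1 ∧ k = 0) := by decide
  rcases this i j k hij hik hjk with ⟨rfl, rfl, rfl⟩ | ⟨rfl, rfl, rfl⟩ | ⟨rfl, rfl, rfl⟩ |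
    ⟨rfl, rfl, rfl⟩ | ⟨rfl, rfl, rfl⟩ | ⟨rfl, rfl, rfl⟩ <;> linear_combination h

/-- For `λ^α φ_{i+1,i+2}`: if `α i = 0` this is an edge form; otherwise a factor `λ_i` can be split
off, and `λ_i φ_{i+1,i+2}` is `starMap` of `dλ_i`. -/
theorem spacePminus_succ_le (T : Affine.Simplex ℝ E 2) (r : ℕ) (M : Submodule ℂ (Form T 1))
    (h₁ : edgeSetM T (r + 1) ⊆ M) (h₂ : ∀ s, s + 1 = r → (spaceP ℂ s T 1).map (starMap T) ≤ M) :
    spacePminus ℂ (r + 1) T 1 ≤ M := by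
  refine Submodule.span_le.2 fun ω hω => ?_
  obtain ⟨α, i, hα, h⟩ := exists_eq_of_mem_spanningPminus hω
  suffices hM : fmul (mono T α) (whitney T ![i + 1, i + 2]) ∈ M by
    rcases h with rfl | rfl
    · exact hM
    · exact neg_mem hM
  have hne : i ≠ i + 1 ∧ i ≠ i + 2 ∧ i + 1 ≠ i + 2 := by
    clear h
    revert i
    decide
  by_cases hi : α i = 0
  · refine h₁ ⟨i + 1, i + 2, hne.2.2, α (i + 1), α (i + 2), ?_, ?_⟩
    · rw [← hα, sum_eq_of_ne α hne.1 hne.2.1 hne.2.2, hi, zero_add]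
    · rw [edgeM, eq_single_add_single hne.1 hne.2.1 hne.2.2 hi]
  · have e := sub_single_add_single hi
    have hs : ∑ k, (α - Pi.single i 1 : Fin 3 → ℕ) k + 1 = r := by
      rw [← sum_add_single _ i, e]
      omega
    rw [← e, ← starMap_fmul_mono_dform]
    exact h₂ _ hs (Submodule.mem_map_of_mem (fmul_mem_spaceP T rfl i))

/-- If the two exponents other than that of `λ_k` are non-zero, `λ^α dλ_k` is minus `starMap` of a
higher order Whitney form. Otherwise `α l = 0` for some `l ≠ k`. On the edge with vertices `k`, `m`
the form `α_m dλ_k - α_k dλ_m` equals `(α_k + α_m) dλ_k + α_k dλ_l`, and `α_k + α_m = r + 1` is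
invertible, so it remains to treat `α_k λ^α dλ_l`. -/
theorem spaceP_succ_le (T : Affine.Simplex ℝ E 2) (r : ℕ) (M : Submodule ℂ (Form T 1))
    (h₁ : edgeSetP T (r + 1) ⊆ M) (h₂ : (spacePminus ℂ r T 1).map (starMap T) ≤ M) :
    spaceP ℂ (r + 1) T 1 ≤ M := by
  refine Submodule.span_le.2 ?_
  rintro _ ⟨α, σ, hα, rfl⟩
  rw [alternator_one]
  generalize σ 0 = k
  have inner : ∀ l : Fin 3, α (l + 1) ≠ 0 → α (l + 2) ≠ 0 → fmul (mono T α) (dform T l) ∈ M := by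
    intro l hl₁ hl₂
    have hl : l + 1 ≠ l + 2 ∧ l ≠ l + 1 ∧ l ≠ l + 2 := by
      clear hl₁ hl₂
      revert l
      decide
    have e₂ := sub_single_add_single hl₂
    have h3 : (α - Pi.single (l + 2) 1 : Fin 3 → ℕ) (l + 1) ≠ 0 := by simpa [hl.1] using hl₁
    have e₁ := sub_single_add_single h3
    have hs : ∑ k, (α - Pi.single (l + 2) 1 - Pi.single (l + 1) 1 : Fin 3 → ℕ) k + 1 = r := by
      rw [← sum_add_single _ (l + 1), e₁]
      have := sum_add_single (α - Pi.single (l + 2) 1) (l + 2)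
      rw [e₂] at this
      exact Nat.succ_injective (this.symm.trans hα)
    have h4 := h₂ (Submodule.mem_map_of_mem (fmul_mem_spacePminus T hs hl.1))
    rw [starMap_fmul_mono_whitney, e₁, e₂] at h4
    simpa using neg_mem h4
  have inner' : ∀ l p q : Fin 3, l ≠ p → l ≠ q → p ≠ q → α p ≠ 0 → α q ≠ 0 →
      fmul (mono T α) (dform T l) ∈ M := by
    intro l p q h1 h2 h3 hp hq
    have : (p = l + 1 ∧ q = l + 2) ∨ (p = l + 2 ∧ q = l + 1) := by
      clear hp hq
      revert l p q
      decide
    rcases this with ⟨rfl, rfl⟩ | ⟨rfl, rfl⟩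
    · exact inner l hp hq
    · exact inner l hq hp
  have outer : ∀ l p q : Fin 3, l ≠ p → l ≠ q → p ≠ q → α l = 0 → edgeP T p q (α p) (α q) =
      fmul (mono T α) ((α q : ℂ) • dform T p - (α p : ℂ) • dform T q) ∧
      edgeP T p q (α p) (α q) ∈ M := by
    intro l p q h1 h2 h3 hl
    refine ⟨by rw [edgeP, eq_single_add_single h1 h2 h3 hl], h₁ ⟨p, q, h3, _, _, ?_, rfl⟩⟩
    rw [← hα, sum_eq_of_ne α h1 h2 h3, hl, zero_add]
  obtain ⟨i, j, hki, hkj, hij⟩ : ∃ i j : Fin 3, k ≠ i ∧ k ≠ j ∧ i ≠ j := by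
    revert k
    decide
  by_cases h0 : α i ≠ 0 ∧ α j ≠ 0
  · exact inner' k i j hki hkj hij h0.1 h0.2
  obtain ⟨l, m, hkl, hkm, hlm, hl⟩ : ∃ l m : Fin 3, k ≠ l ∧ k ≠ m ∧ l ≠ m ∧ α l = 0 := by
    by_cases hi : α i = 0
    · exact ⟨i, j, hki, hkj, hij, hi⟩
    · exact ⟨j, i, hkj, hki, hij.symm, by tauto⟩
  have hsum : α k + α m = r + 1 := by
    rw [← hα, sum_eq_of_ne α hkl.symm hlm hkm, hl, zero_add]
  obtain ⟨e, he⟩ := outer l k m hkl.symm hlm hkm hl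
  -- For `α k = 0` nothing is left. If `α k` and `α m` are non-zero, the form is of the interior
  -- type. For `α m = 0` the monomial is a power of `λ_k`, and the edge form on `k`, `l` is itself a
  -- multiple of `λ^α dλ_l`.
  have hkl' : (α k : ℂ) • fmul (mono T α) (dform T l) ∈ M := by
    by_cases hk : α k = 0
    · rw [hk, Nat.cast_zero, zero_smul]
      exact zero_mem M
    refine Submodule.smul_mem _ _ ?_
    by_cases hm : α m = 0
    · obtain ⟨e', he'⟩ := outer m k l hkm.symm hlm.symm hkl hm
      have hk' : (α k : ℂ) ≠ 0 := by exact_mod_cast hk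
      have e2 : fmul (mono T α) (dform T l) = (-(α k : ℂ)⁻¹) • edgeP T k l (α k) (α l) := by
        rw [e', hl]
        refine Form.ext fun x v => ?_
        simp only [fmul_apply, sub_form_apply, smul_form_apply]
        field_simp
        simp
        ring
      rw [e2]
      exact Submodule.smul_mem _ _ he'
    · exact inner' l k m hkl.symm hlm hkm hk hm
  have hr : (α k : ℂ) + α m ≠ 0 := by
    have : α k + α m ≠ 0 := by omega
    exact_mod_cast this
  have e2 : fmul (mono T α) (dform T k) = ((α k : ℂ) + α m)⁻¹ •
      (edgeP T k m (α k) (α m) - (α k : ℂ) • fmul (mono T α) (dform T l)) := by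
    rw [e]
    refine Form.ext fun x v => ?_
    simp only [fmul_apply, sub_form_apply, smul_form_apply, dform_apply]
    have hs := sum_dbary_of_ne T (v 0) hkl hkm hlm
    rw [eq_inv_mul_iff_mul_eq₀ hr]
    linear_combination (α k : ℂ) * (mono T α x : ℂ) * hs
  rw [e2]
  exact Submodule.smul_mem _ _ (sub_mem he hkl')

theorem xi_primitive : IsPrimitiveRoot xi 3 := by
  have h := Complex.isPrimitiveRoot_exp 3 (by norm_num)
  have e : xi = Complex.exp (2 * Real.pi * Complex.I / (3 : ℕ)) := by
    rw [xi]
    congr 1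
    push_cast
    ring
  rwa [e]

theorem xi_pow_three : xi ^ 3 = 1 := xi_primitive.pow_eq_one

theorem one_add_xi : 1 + xi + xi ^ 2 = 0 := by
  have h := xi_primitive.geom_sum_eq_zero (by norm_num)
  simpa [Finset.sum_range_succ] using h

theorem span_triangleBasis (T : Affine.Simplex ℝ E 2) :
    Submodule.span ℂ (triangleBasis T) = spaceP ℂ 0 T 1 := by
  have hd : ∀ i, dform T i ∈ spaceP ℂ 0 T 1 := by
    intro i
    have := fmul_mem_spaceP T (α := 0) (r := 0) (by simp) i
    convert this using 1
    refine Form.ext fun x v => ?_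
    simp [fmul_apply, mono]
  apply le_antisymm
  · refine Submodule.span_le.2 ?_
    rintro _ (rfl | rfl)
    · exact add_mem (add_mem (hd 0) (Submodule.smul_mem _ _ (hd 1))) (Submodule.smul_mem _ _ (hd 2))
    · exact add_mem (add_mem (hd 0) (Submodule.smul_mem _ _ (hd 1))) (Submodule.smul_mem _ _ (hd 2))
  · refine Submodule.span_le.2 ?_
    rintro _ ⟨α, σ, hα, rfl⟩
    obtain rfl : α = 0 := by simpa [funext_iff] using hα
    rw [alternator_one]
    generalize σ 0 = k
    have h1 : dform T 0 + xi • dform T 1 + xi ^ 2 • dform T 2 ∈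
        Submodule.span ℂ (triangleBasis T) := Submodule.subset_span (Or.inl rfl)
    have h2 : dform T 0 + xi ^ 2 • dform T 1 + xi • dform T 2 ∈
        Submodule.span ℂ (triangleBasis T) := Submodule.subset_span (Or.inr rfl)
    -- Inverse discrete Fourier transform on three points: the coefficients are `ξ^{-k}/3` and
    -- `ξ^{-2k}/3`, and the missing third mode `∑ dλ_j` vanishes.
    have key : fmul (mono T 0) (dform T k) =
        ((xi ^ 3) ^ (k : ℕ) * xi ^ (2 * (k : ℕ)) / 3) •
          (dform T 0 + xi • dform T 1 + xi ^ 2 • dform T 2) +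
        (xi ^ (k : ℕ) / 3) • (dform T 0 + xi ^ 2 • dform T 1 + xi • dform T 2) := by
      refine Form.ext fun x v => ?_
      simp only [fmul_apply, add_form_apply, smul_form_apply, dform_apply]
      have hs := sum_dbary_triangle T (v 0)
      have h3 := xi_pow_three
      have h4 := one_add_xi
      have hm : (mono T 0 x : ℂ) = 1 := by simp [mono]
      rw [hm, one_mul, h3, one_pow, one_mul]
      fin_cases k
      · simp only [Fin.zero_eta, mul_zero, pow_zero]
        linear_combination (1 / 3 : ℂ) * hs -
          (1 / 3 : ℂ) * h4 * ((dbary T 1 (v 0) : ℂ) + dbary T 2 (v 0))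
      · simp only [Fin.mk_one, mul_one, pow_one]
        linear_combination (1 / 3 : ℂ) * hs - (1 / 3 : ℂ) * h4 * (dbary T 0 (v 0) : ℂ) -
          (2 / 3 : ℂ) * h3 * (dbary T 1 (v 0) : ℂ) -
          (1 / 3 : ℂ) * (xi * h3 + h4) * (dbary T 2 (v 0) : ℂ)
      · simp only [Fin.reduceFinMk]
        linear_combination (1 / 3 : ℂ) * hs -
          (1 / 3 : ℂ) * (xi * h3 + h4) * (dbary T 0 (v 0) : ℂ) -
          (1 / 3 : ℂ) * ((xi ^ 2 + xi) * h3 + h4) * (dbary T 1 (v 0) : ℂ) -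
          (1 / 3 : ℂ) * (xi ^ 3 + 2) * h3 * (dbary T 2 (v 0) : ℂ)
    rw [SetLike.mem_coe, key]
    exact add_mem (Submodule.smul_mem _ _ h1) (Submodule.smul_mem _ _ h2)

/-! ### The recursively constructed sets on a triangle are bases -/

section Recursion

variable {B : ∀ {n : ℕ} (T : Affine.Simplex ℝ E n) (k : ℕ), Set (Form T k)}

theorem basisPminusRing_one_triangle (T : Affine.Simplex ℝ E 2) :
    basisPminusRing B 1 T 1 = ∅ :=
  basisPminusRing_eq_empty B (k := 1) (l := 1) rfl (by norm_num) T

theorem basisPminusRing_triangle {T : Affine.Simplex ℝ E 2} {r : ℕ}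
    (hsub : basisP B r T 1 ⊆ spaceP ℂ r T 1) :
    basisPminusRing B (r + 2) T 1 = starMap T '' basisP B r T 1 := by
  rw [← imageOf_graphI_triangle hsub]
  exact basisPminusRing_eq B (k := 1) (l := 1) (n := 2) rfl r T

theorem map_neg_starMap (T : Affine.Simplex ℝ E 2) (M : Submodule ℂ (Form T 1)) :
    M.map (-starMap T) = M.map (starMap T) :=
  Submodule.map_neg (f := starMap T) (p := M)

theorem image_subset_of_span_eq {V W : Type*} [AddCommGroup V] [Module ℂ V] [AddCommGroup W]
    [Module ℂ W] {Q : Set V} {M : Submodule ℂ V} {N : Submodule ℂ W} (L : V →ₗ[ℂ] W)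
    (hQ : Submodule.span ℂ Q = M) (h : M.map L ≤ N) : L '' Q ⊆ N := by
  rintro _ ⟨q, hq, rfl⟩
  exact h (Submodule.mem_map_of_mem (hQ ▸ Submodule.subset_span hq))

/-- The bounds are consistent with the recursion: `3(r + 2) + r(r + 2) = (r + 2)(r + 3)` and `3(r +
2) + (r + 1)(r + 2) = (r + 2)(r + 4)`. `basisPminus 1` has no interior part, which makes it a
separate case. -/
theorem span_basis_triangle
    (hB : ∀ {n : ℕ} (F : Affine.Simplex ℝ E n) (k : ℕ), n ≤ 1 → k ≤ n →
      IsBasisOf ℝ (B F k) (spaceP ℝ 0 F k))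
    (hB' : ∀ F : Affine.Simplex ℝ E 2, B F 1 = triangleBasis F)
    (T : Affine.Simplex ℝ E 2) (r : ℕ) :
    (Submodule.span ℂ (basisP B r T 1) = spaceP ℂ r T 1 ∧
      (basisP B r T 1).encard ≤ ((r + 1) * (r + 2) : ℕ)) ∧
    (Submodule.span ℂ (basisPminus B r T 1) = spacePminus ℂ r T 1 ∧
      (basisPminus B r T 1).encard ≤ (r * (r + 2) : ℕ)) := by
  induction r using Nat.strong_induction_on with
  | _ r ih =>
  constructor
  · rcases r with _ | r
    · rw [basisP_zero, hB']
      exact ⟨span_triangleBasis T, (Set.encard_insert_le _ _).trans (by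
        rw [Set.encard_singleton]
        norm_num)⟩
    obtain ⟨hs, hc⟩ := (ih r (Nat.lt_succ_self r)).2
    have hle : (spacePminus ℂ r T 1).map (-starMap T) ≤ spaceP ℂ (r + 1) T 1 := by
      rw [map_neg_starMap]
      exact map_starMap_spacePminus_le T r
    obtain ⟨Q, hQ, e⟩ := basisP_triangle_eq hB T r (hs ▸ Submodule.subset_span)
      (image_subset_of_span_eq _ hs hle)
    rw [e]
    constructor
    · rw [Submodule.span_union, hQ.span_eq, Submodule.span_image, hs]
      refine le_antisymm (sup_le (Submodule.span_le.2 (edgeSetP_subset T _)) hle) ?_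
      refine spaceP_succ_le T r _ (fun ω hω => ?_) ?_
      · exact Submodule.mem_sup_left (Submodule.subset_span hω)
      · rw [map_neg_starMap]
        exact le_sup_right
    · refine (Set.encard_union_le _ _).trans
        ((add_le_add hQ.1 ((Set.encard_image_le _ _).trans hc)).trans ?_)
      norm_cast
      nlinarith
  · rcases r with _ | _ | r
    · rw [basisPminus_zero]
      refine ⟨?_, by simp⟩
      rw [spacePminus]
      congr 1
      symm
      rw [Set.eq_empty_iff_forall_notMem]
      rintro _ ⟨α, ρ, hα, _⟩
      omega
    · obtain ⟨Q, hQ, e⟩ := basisPminus_triangle_eq hB T 0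
        (by rw [zero_add, basisPminusRing_one_triangle]; exact Set.empty_subset _)
      rw [zero_add] at e hQ ⊢
      rw [basisPminusRing_one_triangle, Set.union_empty] at e
      rw [e]
      refine ⟨?_, hQ.1.trans (by norm_num)⟩
      rw [hQ.span_eq]
      refine le_antisymm (Submodule.span_le.2 (edgeSetM_subset T _)) ?_
      exact spacePminus_succ_le T 0 _ Submodule.subset_span fun s hs => by omega
    · obtain ⟨hs, hc⟩ := (ih r (by omega)).1
      have hsub : basisP B r T 1 ⊆ spaceP ℂ r T 1 := hs ▸ Submodule.subset_span
      have hle := map_starMap_spaceP_le T r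
      have hring := basisPminusRing_triangle hsub
      obtain ⟨Q, hQ, e⟩ := basisPminus_triangle_eq hB T (r + 1)
        (by rw [hring]; exact image_subset_of_span_eq _ hs hle)
      rw [e, hring]
      constructor
      · rw [Submodule.span_union, hQ.span_eq, Submodule.span_image, hs]
        refine le_antisymm (sup_le (Submodule.span_le.2 (edgeSetM_subset T _)) hle) ?_
        refine spacePminus_succ_le T (r + 1) _ (fun ω hω => ?_) ?_
        · exact Submodule.mem_sup_left (Submodule.subset_span hω)
        · intro s hs
          obtain rfl : s = r := by omega
          exact le_sup_right
      · refine (Set.encard_union_le _ _).trans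
          ((add_le_add hQ.1 ((Set.encard_image_le _ _).trans hc)).trans ?_)
        norm_cast
        nlinarith

theorem exists_basisP_succ_eq
    (hB : ∀ {n : ℕ} (F : Affine.Simplex ℝ E n) (k : ℕ), n ≤ 1 → k ≤ n →
      IsBasisOf ℝ (B F k) (spaceP ℝ 0 F k))
    (hB' : ∀ F : Affine.Simplex ℝ E 2, B F 1 = triangleBasis F)
    (T : Affine.Simplex ℝ E 2) (r : ℕ) :
    ∃ Q, Lines Q (edgeSetP T (r + 1)) (3 * (r + 2) : ℕ) ∧
      basisP B (r + 1) T 1 = Q ∪ (-starMap T) '' basisPminus B r T 1 := by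
  have hs := (span_basis_triangle hB hB' T r).2.1
  refine basisP_triangle_eq hB T r (hs ▸ Submodule.subset_span)
    (image_subset_of_span_eq _ hs ?_)
  rw [map_neg_starMap]
  exact map_starMap_spacePminus_le T r

theorem exists_basisPminus_one_eq
    (hB : ∀ {n : ℕ} (F : Affine.Simplex ℝ E n) (k : ℕ), n ≤ 1 → k ≤ n →
      IsBasisOf ℝ (B F k) (spaceP ℝ 0 F k)) (T : Affine.Simplex ℝ E 2) :
    Lines (basisPminus B 1 T 1) (edgeSetM T 1) 3 := by
  obtain ⟨Q, hQ, e⟩ := basisPminus_triangle_eq hB T 0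
    (by rw [zero_add, basisPminusRing_one_triangle]; exact Set.empty_subset _)
  rw [zero_add] at e hQ
  rw [basisPminusRing_one_triangle, Set.union_empty] at e
  rw [e]
  exact hQ.mono_card (by norm_num)

theorem exists_basisPminus_add_two_eq
    (hB : ∀ {n : ℕ} (F : Affine.Simplex ℝ E n) (k : ℕ), n ≤ 1 → k ≤ n →
      IsBasisOf ℝ (B F k) (spaceP ℝ 0 F k))
    (hB' : ∀ F : Affine.Simplex ℝ E 2, B F 1 = triangleBasis F)
    (T : Affine.Simplex ℝ E 2) (r : ℕ) :
    ∃ Q, Lines Q (edgeSetM T (r + 2)) (3 * (r + 2) : ℕ) ∧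
      basisPminus B (r + 2) T 1 = Q ∪ starMap T '' basisP B r T 1 := by
  have hs := (span_basis_triangle hB hB' T r).1.1
  have hring := basisPminusRing_triangle (B := B) (T := T) (r := r) (hs ▸ Submodule.subset_span)
  rw [← hring]
  refine basisPminus_triangle_eq hB T (r + 1) ?_
  rw [hring]
  exact image_subset_of_span_eq _ hs (map_starMap_spaceP_le T r)

theorem linearIndependent_dform_pair (T : Affine.Simplex ℝ E 2) :
    LinearIndependent ℂ fun i : Fin 2 =>
      (complexify (wedge fun j : Fin 1 => dbary T (![i.succ] j)) :
          (Tangent T) [⋀^Fin 1]→ₗ[ℝ] ℂ) := by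
  rw [Fintype.linearIndependent_iff]
  intro g hg i
  have h := DFunLike.congr_fun hg fun _ => vertexBasis T i.succ -ᵥ vertexBasis T 0
  rw [Fin.sum_univ_two, AlternatingMap.add_apply, AlternatingMap.smul_apply,
    AlternatingMap.smul_apply, complexify_wedge_one, complexify_wedge_one] at h
  fin_cases i <;> simpa [dbary_vsub, bary_vertexBasis] using h

/-- The space `P_r Λ¹(T)` of a triangle has dimension at least `(r + 1) (r + 2)`. -/
theorem le_finrank_spaceP (T : Affine.Simplex ℝ E 2) (r : ℕ) {Q : Set (Form T 1)}
    (hfin : Q.Finite) (hQ : Submodule.span ℂ Q = spaceP ℂ r T 1) :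
    (r + 1) * (r + 2) ≤ Module.finrank ℂ (Submodule.span ℂ Q) := by
  -- The exponents of degree `r` are the triples `(r - a, b, a - b)` with `b ≤ a ≤ r`; each is
  -- paired with one of the two independent covectors `dλ₁`, `dλ₂`.
  let ι := (Σ a : Fin (r + 1), Fin ((a : ℕ) + 1)) × Fin 2
  let f : ι → {α : Fin 3 → ℕ // ∑ i, α i = r} × Fin 2 := fun p =>
    (⟨![r - (p.1.1 : ℕ), (p.1.2 : ℕ), (p.1.1 : ℕ) - (p.1.2 : ℕ)], by
      have h1 := p.1.1.2
      have h2 := p.1.2.2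
      simp only [Fin.sum_univ_three, Matrix.cons_val_zero, Matrix.cons_val_one, Matrix.cons_val]
      omega⟩, p.2)
  have hf : Function.Injective f := by
    rintro ⟨⟨a, b⟩, c⟩ ⟨⟨a', b'⟩, c'⟩ h
    have h0 : r - (a : ℕ) = r - (a' : ℕ) := congrFun (congrArg (fun p => p.1.1) h) 0
    have h1 : (b : ℕ) = (b' : ℕ) := congrFun (congrArg (fun p => p.1.1) h) 1
    have h2 : c = c' := congrArg Prod.snd h
    obtain rfl : a = a' := by
      ext
      omega
    obtain rfl : b = b' := Fin.ext h1
    rw [h2]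
  have hli := (linearIndependent_mono_smul T r 1 (linearIndependent_dform_pair T)).comp f hf
  have hcard : Fintype.card ι = (r + 1) * (r + 2) := by
    have h1 : ∑ a : Fin (r + 1), ((a : ℕ) + 1) = ∑ i ∈ Finset.range (r + 2), i := by
      rw [Fin.sum_univ_eq_sum_range (fun a => a + 1), Finset.sum_range_succ' _ (r + 1), add_zero]
    simp only [ι, Fintype.card_prod, Fintype.card_sigma, Fintype.card_fin]
    rw [h1, Finset.sum_range_id_mul_two]
    simp [mul_comm]
  rw [← hcard, ← finrank_span_eq_card hli]
  have := FiniteDimensional.span_of_finite ℂ hfin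
  refine Submodule.finrank_mono ?_
  rw [hQ, Submodule.span_le]
  rintro _ ⟨p, rfl⟩
  exact fmul_mem_spaceP T (f p).1.2 (f p).2.succ

theorem isBasisOf_basisP
    (hB : ∀ {n : ℕ} (F : Affine.Simplex ℝ E n) (k : ℕ), n ≤ 1 → k ≤ n →
      IsBasisOf ℝ (B F k) (spaceP ℝ 0 F k))
    (hB' : ∀ F : Affine.Simplex ℝ E 2, B F 1 = triangleBasis F)
    (T : Affine.Simplex ℝ E 2) (r : ℕ) : IsBasisOf ℂ (basisP B r T 1) (spaceP ℂ r T 1) := by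
  obtain ⟨hs, hc⟩ := (span_basis_triangle hB hB' T r).1
  refine ⟨?_, hs⟩
  have hfin : (basisP B r T 1).Finite := Set.finite_of_encard_le_coe hc
  have := hfin.fintype
  rw [LinearIndepOn, linearIndependent_iff_card_le_finrank_span, Set.finrank]
  have h1 := le_finrank_spaceP T r hfin hs
  have h2 : Set.range (fun x : basisP B r T 1 => id (x : Form T 1)) = basisP B r T 1 :=
    Subtype.range_coe
  rw [h2]
  refine le_trans ?_ h1
  rw [Set.encard_eq_coe_toFinset_card, Set.toFinset_card] at hc
  exact_mod_cast hc

/-- Independence is inherited from degree `r + 1` of the other family. There the edge part has at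
most `3(r + 2)` of at least `(r + 2)(r + 3)` members, so `-starMap` must be injective on
`basisPminus r`. Its image is part of an independent set, and independence pulls back along a linear
map. -/
theorem isBasisOf_basisPminus
    (hB : ∀ {n : ℕ} (F : Affine.Simplex ℝ E n) (k : ℕ), n ≤ 1 → k ≤ n →
      IsBasisOf ℝ (B F k) (spaceP ℝ 0 F k))
    (hB' : ∀ F : Affine.Simplex ℝ E 2, B F 1 = triangleBasis F)
    (T : Affine.Simplex ℝ E 2) (r : ℕ) :
    IsBasisOf ℂ (basisPminus B r T 1) (spacePminus ℂ r T 1) := by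
  obtain ⟨hs, hc⟩ := (span_basis_triangle hB hB' T r).2
  refine ⟨?_, hs⟩
  have hfin : (basisPminus B r T 1).Finite := Set.finite_of_encard_le_coe hc
  obtain ⟨hli, hsp⟩ := isBasisOf_basisP hB hB' T (r + 1)
  have hfin' : (basisP B (r + 1) T 1).Finite :=
    Set.finite_of_encard_le_coe (span_basis_triangle hB hB' T (r + 1)).1.2
  have h1 := le_finrank_spaceP T (r + 1) hfin' hsp
  obtain ⟨Q, hQ, e⟩ := exists_basisP_succ_eq hB hB' T r
  have hQfin : Q.Finite := Set.finite_of_encard_le_coe hQ.1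
  have h2 : Module.finrank ℂ (Submodule.span ℂ (basisP B (r + 1) T 1)) ≤
      (basisP B (r + 1) T 1).ncard := by
    have := hfin'.fintype
    rw [Set.ncard_eq_toFinset_card']
    exact finrank_span_le_card _
  have h3 : Q.ncard ≤ 3 * (r + 2) := by
    rw [← Nat.cast_le (α := ℕ∞), hQfin.cast_ncard_eq]
    exact hQ.1
  have h4 : (basisPminus B r T 1).ncard ≤ r * (r + 2) := by
    rw [← Nat.cast_le (α := ℕ∞), hfin.cast_ncard_eq]
    exact hc
  have h5 := Set.ncard_union_le Q ((-starMap T) '' basisPminus B r T 1)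
  rw [← e] at h5
  have h6 : ((-starMap T) '' basisPminus B r T 1).ncard ≤ (basisPminus B r T 1).ncard :=
    Set.ncard_image_le hfin
  have hinj : Set.InjOn (-starMap T) (basisPminus B r T 1) :=
    Set.injOn_of_ncard_image_eq (by nlinarith) hfin
  have h7 := hli.mono (e ▸ Set.subset_union_right :
    (-starMap T) '' basisPminus B r T 1 ⊆ basisP B (r + 1) T 1)
  rw [← linearIndepOn_iff_image hinj] at h7
  exact LinearIndepOn.of_comp (-starMap T) h7

end Recursion

/-! ### Symmetries -/

/-- Vertices are extreme points. If `S w = v_i` with `w` in the simplex, then for `m ≠ i` the sum of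
the non-negative numbers `λ_k(w) λ_m(S v_k)` is zero, so every vertex of positive weight in `w` is
mapped to `v_i`. -/
theorem exists_map_vertex (T : Affine.Simplex ℝ E n) (S : Symmetry T) (i : Fin (n + 1)) :
    ∃ j, S.1 (vertexBasis T j) = vertexBasis T i := by
  obtain ⟨w, hw, hSw⟩ := S.2.superset (vertexBasis_mem_body T i)
  have hw1 := sum_bary T w
  obtain ⟨j, hj⟩ : ∃ j, bary T j w ≠ 0 := by
    by_contra! h
    simp [h] at hw1
  have hmem : ∀ k, S.1 (vertexBasis T k) ∈ body T := fun k =>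
    S.2.subset (Set.mem_image_of_mem _ (vertexBasis_mem_body T k))
  have hcomb : ∀ m, bary T m (S.1 w) = ∑ k, bary T k w * bary T m (S.1 (vertexBasis T k)) := by
    intro m
    have h1 := (vertexBasis T).affineCombination_coord_eq_self w
    have h2 := Finset.univ.map_affineCombination (vertexBasis T) (fun k => bary T k w) hw1
      ((bary T m).comp S.1.toAffineMap)
    have h3 : Finset.univ.affineCombination ℝ (vertexBasis T) (fun k => bary T k w) = w := h1
    rw [h3, Finset.affineCombination_eq_linear_combination _ _ _ hw1] at h2
    exact h2
  refine ⟨j, ?_⟩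
  have hzero : ∀ m, m ≠ i → bary T m (S.1 (vertexBasis T j)) = 0 := by
    intro m hm
    have h1 := hcomb m
    rw [hSw, bary_vertexBasis, if_neg hm] at h1
    have h2 := (Finset.sum_eq_zero_iff_of_nonneg fun k _ =>
      mul_nonneg (bary_nonneg T k hw) (bary_nonneg T m (hmem k))).1 h1.symm j (Finset.mem_univ j)
    exact (mul_eq_zero.1 h2).resolve_left hj
  refine (vertexBasis T).ext_elem fun m => ?_
  change bary T m _ = bary T m _
  rw [bary_vertexBasis]
  split_ifs with hm
  · subst hm
    rw [← sum_bary T (S.1 (vertexBasis T j)), Finset.sum_eq_single m]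
    · exact fun b _ hb => hzero b hb
    · exact fun h => absurd (Finset.mem_univ m) h
  · exact hzero m hm

/-- A symmetry permutes the vertices. -/
theorem exists_perm (T : Affine.Simplex ℝ E n) (S : Symmetry T) :
    ∃ π : Equiv.Perm (Fin (n + 1)), ∀ i, S.1 (vertexBasis T (π i)) = vertexBasis T i := by
  choose f hf using exists_map_vertex T S
  have hinj : Function.Injective f := by
    intro i j hij
    have := hf i
    rw [hij, hf j] at this
    exact (vertexBasis T).ind.injective this.symm
  exact ⟨Equiv.ofBijective f (Finite.injective_iff_bijective.1 hinj), hf⟩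

/-- The convention that `S` sends `v_{π i}` to `v_i` makes pullback act on indices by `π` and not by
its inverse. -/
theorem bary_map_of_vertices {T : Affine.Simplex ℝ E n} {S : Hull T ≃ᵃ[ℝ] Hull T}
    {π : Equiv.Perm (Fin (n + 1))} (hπ : ∀ i, S (vertexBasis T (π i)) = vertexBasis T i)
    (i : Fin (n + 1)) (x : Hull T) : bary T i (S x) = bary T (π i) x := by
  have h1 := (vertexBasis T).affineCombination_coord_eq_self x
  have hx1 := sum_bary T x
  have h2 := Finset.univ.map_affineCombination (vertexBasis T) (fun k => bary T k x) hx1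
    ((bary T i).comp S.toAffineMap)
  have h3 : Finset.univ.affineCombination ℝ (vertexBasis T) (fun k => bary T k x) = x := h1
  rw [h3, Finset.affineCombination_eq_linear_combination _ _ _ hx1] at h2
  refine h2.trans ?_
  rw [Finset.sum_eq_single (π i)]
  · change _ * bary T i (S (vertexBasis T (π i))) = _
    rw [hπ, bary_vertexBasis, if_pos rfl, mul_one]
  · intro k _ hk
    change _ * bary T i (S (vertexBasis T k)) = 0
    obtain ⟨j, rfl⟩ := π.surjective k
    rw [hπ, bary_vertexBasis, if_neg, mul_zero]
    rintro rfl
    exact hk rfl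
  · exact fun h => absurd (Finset.mem_univ _) h

section

variable {T : Affine.Simplex ℝ E n} {S : Symmetry T} {π : Equiv.Perm (Fin (n + 1))}
  (hπ : ∀ i, S.1 (vertexBasis T (π i)) = vertexBasis T i)

include hπ

theorem bary_symmetry (i : Fin (n + 1)) (x : Hull T) : bary T i (S.1 x) = bary T (π i) x :=
  bary_map_of_vertices hπ i x

theorem dbary_symmetry (i : Fin (n + 1)) (w : Tangent T) :
    dbary T i (S.1.linear w) = dbary T (π i) w := by
  have h : w = (w +ᵥ vertexBasis T 0) -ᵥ vertexBasis T 0 := (vadd_vsub _ _).symm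
  have h2 : S.1.linear w = S.1 (w +ᵥ vertexBasis T 0) -ᵥ S.1 (vertexBasis T 0) := by
    rw [S.1.map_vadd, vadd_vsub]
  rw [h2, dbary_vsub, bary_symmetry hπ, bary_symmetry hπ, ← dbary_vsub, ← h]

end

theorem mem_body_iff (T : Affine.Simplex ℝ E n) (x : Hull T) :
    x ∈ body T ↔ ∀ i, 0 ≤ bary T i x := by
  refine ⟨fun h i => bary_nonneg T i h, fun h => ?_⟩
  obtain ⟨y, hy⟩ := exists_mem_body T _ h (sum_bary T x)
  rw [(vertexBasis T).ext_elem fun i => (hy i).symm]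
  exact y.2

/-- Every permutation of the vertices is induced by a symmetry. -/
theorem exists_symmetry (T : Affine.Simplex ℝ E n) (π : Equiv.Perm (Fin (n + 1))) :
    ∃ S : Symmetry T, ∀ i, S.1 (vertexBasis T (π i)) = vertexBasis T i := by
  -- `S` is the affine map taking `v_{π 0}` to `v_0` whose linear part takes the basis `v_{π i} -
  -- v_{π 0}` to `v_i - v_0`.
  let e : {j // j ≠ π 0} ≃ {j // j ≠ (0 : Fin (n + 1))} :=
    π.symm.subtypeEquiv fun a => by simp [Equiv.symm_apply_eq]
  let L := ((vertexBasis T).basisOf (π 0)).equiv ((vertexBasis T).basisOf 0) e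
  let S : Hull T ≃ᵃ[ℝ] Hull T := ((AffineEquiv.vaddConst ℝ (vertexBasis T (π 0))).symm.trans
    L.toAffineEquiv).trans (AffineEquiv.vaddConst ℝ (vertexBasis T 0))
  have hS : ∀ i, S (vertexBasis T (π i)) = vertexBasis T i := by
    intro i
    change L (vertexBasis T (π i) -ᵥ vertexBasis T (π 0)) +ᵥ vertexBasis T 0 = _
    by_cases hi : i = 0
    · subst hi
      simp
    · have hi' : π i ≠ π 0 := π.injective.ne hi
      have h1 := ((vertexBasis T).basisOf (π 0)).equiv_apply (⟨π i, hi'⟩)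
        ((vertexBasis T).basisOf 0) e
      rw [AffineBasis.basisOf_apply, AffineBasis.basisOf_apply] at h1
      have h2 : ((e ⟨π i, hi'⟩ : {j // j ≠ (0 : Fin (n + 1))}) : Fin (n + 1)) = i :=
        π.symm_apply_apply i
      rw [h2] at h1
      rw [show L _ = _ from h1, vsub_vadd]
  have hb : ∀ x, S x ∈ body T ↔ x ∈ body T := by
    intro x
    simp only [mem_body_iff, bary_map_of_vertices hS]
    exact ⟨fun h i => by simpa using h (π.symm i), fun h i => h _⟩
  refine ⟨⟨S, ?_⟩, hS⟩
  ext y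
  constructor
  · rintro ⟨x, hx, rfl⟩
    exact (hb x).2 hx
  · intro hy
    exact ⟨S.symm y, (hb _).1 (by rwa [S.apply_symm_apply]), S.apply_symm_apply y⟩

theorem pullback_apply {T : Affine.Simplex ℝ E n} {k : ℕ} (S : Symmetry T) (ω : Form T k)
    (x : body T) (v : Fin k → Tangent T) : pullback S ω x v =
      ω ⟨S.1 x, S.2.subset (Set.mem_image_of_mem _ x.2)⟩ (fun i => S.1.linear (v i)) := rfl

/-- The pullback along a symmetry, as a linear map. -/
def pullbackₗ {T : Affine.Simplex ℝ E n} (S : Symmetry T) (k : ℕ) : Form T k →ₗ[ℂ] Form T k where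
  toFun := pullback S
  map_add' _ _ := rfl
  map_smul' _ _ := rfl

theorem pullback_injective {T : Affine.Simplex ℝ E n} (S : Symmetry T) (k : ℕ) :
    Function.Injective (pullback S : Form T k → Form T k) := by
  intro ω η h
  refine Form.ext fun x v => ?_
  obtain ⟨y, hy, hyx⟩ := S.2.superset x.2
  have h1 := DFunLike.congr_fun (congrFun h ⟨y, hy⟩) fun i => S.1.linear.symm (v i)
  rw [pullback_apply, pullback_apply] at h1
  have h2 : (⟨S.1 y, S.2.subset (Set.mem_image_of_mem _ hy)⟩ : body T) = x := Subtype.ext hyx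
  simp only [LinearEquiv.apply_symm_apply] at h1
  rw [h2] at h1
  exact h1

-- Equivariance of the building blocks on a triangle

section Triangle

variable {T : Affine.Simplex ℝ E 2} {S : Symmetry T} {π : Equiv.Perm (Fin 3)}

theorem pullback_dform (hπ : ∀ i, S.1 (vertexBasis T (π i)) = vertexBasis T i) (i : Fin 3) :
    pullback S (dform T i) = dform T (π i) := by
  refine Form.ext fun x v => ?_
  rw [pullback_apply, dform_apply, dform_apply, dbary_symmetry hπ]

theorem pullback_whitney (hπ : ∀ i, S.1 (vertexBasis T (π i)) = vertexBasis T i) (i j : Fin 3) :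
    pullback S (whitney T ![i, j]) = whitney T ![π i, π j] := by
  refine Form.ext fun x v => ?_
  simp only [pullback_apply, whitney_pair_apply, dbary_symmetry hπ, bary_symmetry hπ]

theorem pullback_edgeP (hπ : ∀ i, S.1 (vertexBasis T (π i)) = vertexBasis T i) (i j : Fin 3)
    (a b : ℕ) : pullback S (edgeP T i j a b) = edgeP T (π i) (π j) a b := by
  refine Form.ext fun x v => ?_
  simp only [pullback_apply, edgeP, fmul_apply, sub_form_apply, smul_form_apply, dform_apply,
    mono_add, mono_single, dbary_symmetry hπ, bary_symmetry hπ]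

theorem pullback_edgeM (hπ : ∀ i, S.1 (vertexBasis T (π i)) = vertexBasis T i) (i j : Fin 3)
    (a b : ℕ) : pullback S (edgeM T i j a b) = edgeM T (π i) (π j) a b := by
  refine Form.ext fun x v => ?_
  simp only [pullback_apply, edgeM, fmul_apply, whitney_pair_apply,
    mono_add, mono_single, dbary_symmetry hπ, bary_symmetry hπ]

/-- A permutation of three indices is a rotation or a reflection. -/
theorem perm_three (π : Equiv.Perm (Fin 3)) :
    (∀ i, π (i + 1) = π i + 1 ∧ π (i + 2) = π i + 2) ∨
      (∀ i, π (i + 1) = π i + 2 ∧ π (i + 2) = π i + 1) := by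
  revert π
  decide

theorem pullback_starMap_eq_sum (hπ : ∀ i, S.1 (vertexBasis T (π i)) = vertexBasis T i)
    (ω : Form T 1) (x : body T) (v : Fin 1 → Tangent T) :
    pullback S (starMap T ω) x v = ∑ i : Fin 3, ((bary T (π i) x : ℂ) *
      pullback S ω x (fun _ => vertexBasis T (π i) -ᵥ x.1)) *
        whitney T ![π (i + 1), π (i + 2)] x v := by
  rw [pullback_apply, starMap_apply]
  refine Finset.sum_congr rfl fun i _ => ?_
  rw [← pullback_apply S (whitney T ![i + 1, i + 2]), pullback_whitney hπ, bary_symmetry hπ,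
    pullback_apply]
  have h : S.1.linear (vertexBasis T (π i) -ᵥ x.1) = vertexBasis T i -ᵥ S.1 x.1 := by
    rw [← hπ i]
    exact S.1.toAffineMap.linearMap_vsub _ _
  simp only [h]

/-- A rotation preserves the cyclic successor indices, so reindexing the sum by `π` gives `starMap`
again. -/
theorem pullback_starMap_rotation (hπ : ∀ i, S.1 (vertexBasis T (π i)) = vertexBasis T i)
    (hrot : ∀ i, π (i + 1) = π i + 1 ∧ π (i + 2) = π i + 2) (ω : Form T 1) :
    pullback S (starMap T ω) = starMap T (pullback S ω) := by
  refine Form.ext fun x v => ?_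
  rw [pullback_starMap_eq_sum hπ, starMap_apply]
  refine Fintype.sum_equiv π _ _ fun i => ?_
  rw [(hrot i).1, (hrot i).2]

/-- A reflection exchanges the two successors of each index, and `φ_{ij}` is antisymmetric. -/
theorem pullback_starMap_reflection (hπ : ∀ i, S.1 (vertexBasis T (π i)) = vertexBasis T i)
    (href : ∀ i, π (i + 1) = π i + 2 ∧ π (i + 2) = π i + 1) (ω : Form T 1) :
    pullback S (starMap T ω) = -starMap T (pullback S ω) := by
  refine Form.ext fun x v => ?_
  rw [pullback_starMap_eq_sum hπ, neg_form_apply, starMap_apply, ← Finset.sum_neg_distrib]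
  refine Fintype.sum_equiv π _ _ fun i => ?_
  rw [(href i).1, (href i).2, whitney_pair_apply, whitney_pair_apply]
  ring

/-! ### Invariance up to factors -/

/-- Every symmetry maps each member of `Q` to a multiple of a member of `Q`, with a non-zero factor
in `K`. -/
def MapsLines (K : IntermediateField ℝ ℂ) (Q : Set (Form T 1)) : Prop :=
  ∀ S : Symmetry T, ∀ ω ∈ Q, ∃ χ ∈ K, χ ≠ 0 ∧ ∃ η ∈ Q, pullback S ω = χ • η

variable {K : IntermediateField ℝ ℂ}

theorem ofReal_mem (K : IntermediateField ℝ ℂ) (c : ℝ) : (c : ℂ) ∈ K :=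
  K.algebraMap_mem c

theorem MapsLines.union {Q Q' : Set (Form T 1)} (h : MapsLines K Q) (h' : MapsLines K Q') :
    MapsLines K (Q ∪ Q') := by
  rintro S ω (hω | hω)
  · obtain ⟨χ, hK, h0, η, hη, e⟩ := h S ω hω
    exact ⟨χ, hK, h0, η, Or.inl hη, e⟩
  · obtain ⟨χ, hK, h0, η, hη, e⟩ := h' S ω hω
    exact ⟨χ, hK, h0, η, Or.inr hη, e⟩

/-- The factors relating `Q` and `R` are real, hence lie in every intermediate field `K`. -/
theorem MapsLines.of_lines {Q R : Set (Form T 1)} {N : ℕ∞} (h : Lines Q R N)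
    (hR : ∀ S : Symmetry T, ∀ ω ∈ R, pullback S ω ∈ R) : MapsLines K Q := by
  intro S ω hω
  obtain ⟨c, hc, s, hs, rfl⟩ := h.2 ω hω
  obtain ⟨d, hd, hm⟩ := h.3 _ (hR S s hs)
  have hd' : (d : ℂ) ≠ 0 := by exact_mod_cast hd
  refine ⟨(c : ℂ) * (d : ℂ)⁻¹, mul_mem (ofReal_mem K c) (inv_mem (ofReal_mem K d)),
    mul_ne_zero (by exact_mod_cast hc) (inv_ne_zero hd'), _, hm, ?_⟩
  rw [smul_smul, mul_assoc, inv_mul_cancel₀ hd', mul_one]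
  exact (pullbackₗ S 1).map_smul c s

theorem MapsLines.image_starMap {Q : Set (Form T 1)} (h : MapsLines K Q) :
    MapsLines K (starMap T '' Q) := by
  rintro S _ ⟨ω, hω, rfl⟩
  obtain ⟨χ, hK, h0, η, hη, e⟩ := h S ω hω
  obtain ⟨π, hπ⟩ := exists_perm T S
  rcases perm_three π with hrot | href
  · exact ⟨χ, hK, h0, _, ⟨η, hη, rfl⟩, by rw [pullback_starMap_rotation hπ hrot, e, map_smul]⟩
  · exact ⟨-χ, neg_mem hK, neg_ne_zero.2 h0, _, ⟨η, hη, rfl⟩, by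
      rw [pullback_starMap_reflection hπ href, e, map_smul, neg_smul]⟩

theorem MapsLines.image_neg {Q : Set (Form T 1)} (h : MapsLines K (starMap T '' Q)) :
    MapsLines K ((-starMap T) '' Q) := by
  rintro S _ ⟨ω, hω, rfl⟩
  obtain ⟨χ, hK, h0, _, ⟨η, hη, rfl⟩, e⟩ := h S _ ⟨ω, hω, rfl⟩
  refine ⟨χ, hK, h0, _, ⟨η, hη, rfl⟩, ?_⟩
  rw [LinearMap.neg_apply, LinearMap.neg_apply, smul_neg, ← e]
  exact (pullbackₗ S 1).map_neg _

theorem mapsLines_of_lines_edgeSetP {Q : Set (Form T 1)} {N : ℕ∞} {r : ℕ}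
    (h : Lines Q (edgeSetP T r) N) : MapsLines K Q := by
  refine MapsLines.of_lines h ?_
  rintro S _ ⟨i, j, hij, a, b, hab, rfl⟩
  obtain ⟨π, hπ⟩ := exists_perm T S
  exact ⟨π i, π j, π.injective.ne hij, a, b, hab, pullback_edgeP hπ i j a b⟩

theorem mapsLines_of_lines_edgeSetM {Q : Set (Form T 1)} {N : ℕ∞} {r : ℕ}
    (h : Lines Q (edgeSetM T r) N) : MapsLines K Q := by
  refine MapsLines.of_lines h ?_
  rintro S _ ⟨i, j, hij, a, b, hab, rfl⟩
  obtain ⟨π, hπ⟩ := exists_perm T S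
  exact ⟨π i, π j, π.injective.ne hij, a, b, hab, pullback_edgeM hπ i j a b⟩

end Triangle

-- From lines permuted by symmetries to invariance, and an obstruction

section Invariance

variable {T : Affine.Simplex ℝ E 2}

theorem pullback_combination {S : Symmetry T} {π : Equiv.Perm (Fin 3)}
    (hπ : ∀ i, S.1 (vertexBasis T (π i)) = vertexBasis T i) (a b : ℂ) :
    pullback S (dform T 0 + a • dform T 1 + b • dform T 2) =
      dform T (π 0) + a • dform T (π 1) + b • dform T (π 2) := by
  rw [← pullback_dform hπ, ← pullback_dform hπ, ← pullback_dform hπ]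
  rfl

theorem mapsLines_triangleBasis (T : Affine.Simplex ℝ E 2) : MapsLines ⊤ (triangleBasis T) := by
  have h3 := xi_pow_three
  have hx : xi ≠ 0 := xi_primitive.ne_zero (by norm_num)
  have hx2 : xi ^ 2 ≠ 0 := pow_ne_zero 2 hx
  intro S
  obtain ⟨π, hπ⟩ := exists_perm T S
  have main : ∀ a b : ℂ, (a = xi ∧ b = xi ^ 2) ∨ (a = xi ^ 2 ∧ b = xi) → ∃ χ : ℂ, χ ≠ 0 ∧
      (dform T (π 0) + a • dform T (π 1) + b • dform T (π 2) =
        χ • (dform T 0 + xi • dform T 1 + xi ^ 2 • dform T 2) ∨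
      dform T (π 0) + a • dform T (π 1) + b • dform T (π 2) =
        χ • (dform T 0 + xi ^ 2 • dform T 1 + xi • dform T 2)) := by
    intro a b hab
    have hc : π 0 = 0 ∨ π 0 = 1 ∨ π 0 = 2 := by
      generalize π 0 = c
      revert c
      decide
    have hrr : (π 1 = π 0 + 1 ∧ π 2 = π 0 + 2) ∨ (π 1 = π 0 + 2 ∧ π 2 = π 0 + 1) :=
      (perm_three π).imp (fun h => h 0) (fun h => h 0)
    have e12 : (1 : Fin 3) + 2 = 0 := rfl
    have e22 : (2 : Fin 3) + 2 = 1 := rfl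
    have e21 : (2 : Fin 3) + 1 = 0 := rfl
    have e11 : (1 : Fin 3) + 1 = 2 := rfl
    -- Rotations multiply the form built from `u` by a power of `u`; reflections also exchange `u`
    -- and `u²`. The cases `u = ξ` and `u = ξ²` cover both basis forms, since `(ξ²)² = ξ`.
    have key : ∀ u : ℂ, u ^ 3 = 1 → u ≠ 0 → ∃ χ : ℂ, χ ≠ 0 ∧
        (dform T (π 0) + u • dform T (π 1) + u ^ 2 • dform T (π 2) =
          χ • (dform T 0 + u • dform T 1 + u ^ 2 • dform T 2) ∨
        dform T (π 0) + u • dform T (π 1) + u ^ 2 • dform T (π 2) =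
          χ • (dform T 0 + u ^ 2 • dform T 1 + u • dform T 2)) := by
      intro u hu hu0
      rcases hrr with ⟨h1, h2⟩ | ⟨h1, h2⟩ <;> rcases hc with h | h | h <;>
        rw [h] at h1 h2 <;> rw [h, h1, h2] <;> simp only [e12, e22, e21, e11, zero_add]
      · exact ⟨1, one_ne_zero, Or.inl (one_smul _ _).symm⟩
      · exact ⟨u ^ 2, pow_ne_zero 2 hu0, Or.inl (by match_scalars <;> grind)⟩
      · exact ⟨u, hu0, Or.inl (by match_scalars <;> grind)⟩
      · exact ⟨1, one_ne_zero, Or.inr (by match_scalars <;> grind)⟩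
      · exact ⟨u, hu0, Or.inr (by match_scalars <;> grind)⟩
      · exact ⟨u ^ 2, pow_ne_zero 2 hu0, Or.inr (by match_scalars <;> grind)⟩
    have h4 : (xi ^ 2) ^ 2 = xi := by grind
    rcases hab with ⟨rfl, rfl⟩ | ⟨rfl, rfl⟩
    · exact key xi h3 hx
    · have := key (xi ^ 2) (by grind) hx2
      rw [h4] at this
      obtain ⟨χ, h0, h⟩ := this
      exact ⟨χ, h0, h.symm⟩
  rintro _ (rfl | rfl)
  · obtain ⟨χ, h0, e | e⟩ := main xi (xi ^ 2) (Or.inl ⟨rfl, rfl⟩)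
    · exact ⟨χ, trivial, h0, _, Or.inl rfl, (pullback_combination hπ _ _).trans e⟩
    · exact ⟨χ, trivial, h0, _, Or.inr rfl, (pullback_combination hπ _ _).trans e⟩
  · obtain ⟨χ, h0, e | e⟩ := main (xi ^ 2) xi (Or.inr ⟨rfl, rfl⟩)
    · exact ⟨χ, trivial, h0, _, Or.inl rfl, (pullback_combination hπ _ _).trans e⟩
    · exact ⟨χ, trivial, h0, _, Or.inr rfl, (pullback_combination hπ _ _).trans e⟩

/-- Two members sent to multiples of the same form would be proportional, because pullback is
injective; independence forbids this. The resulting self-map of a finite set is injective, hence a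
permutation. -/
theorem MapsLines.exists_perm {K : IntermediateField ℝ ℂ} {Q : Set (Form T 1)}
    (h : MapsLines K Q) (hfin : Q.Finite) (hli : LinearIndepOn ℂ id Q) (S : Symmetry T) :
    ∃ (τ : Equiv.Perm Q) (χ : Q → ℂ), ∀ ω : Q, χ ω ∈ K ∧ χ ω ≠ 0 ∧
      pullback S (ω : Form T 1) = χ ω • (τ ω : Form T 1) := by
  choose χ hK h0 f hf e using fun ω : Q => h S ω ω.2
  have hinj : Function.Injective fun ω : Q => (⟨f ω, hf ω⟩ : Q) := by
    intro ω η hωη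
    have hωη' : f ω = f η := congrArg Subtype.val hωη
    by_contra hne
    have h1 : χ η • (ω : Form T 1) = χ ω • (η : Form T 1) := by
      refine pullback_injective S 1 ?_
      change χ η • pullback S (ω : Form T 1) = χ ω • pullback S (η : Form T 1)
      rw [e, e, hωη', smul_smul, smul_smul, mul_comm]
    have h2 := (LinearIndepOn.pair_iff id fun h => hne (Subtype.ext h)).1
      (hli.mono (Set.insert_subset ω.2 (Set.singleton_subset_iff.2 η.2))) (χ η) (-χ ω)
      (by simp only [id, h1, neg_smul, add_neg_cancel])
    exact h0 η h2.1
  have := hfin.to_subtype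
  exact ⟨Equiv.ofBijective _ (Finite.injective_iff_bijective.1 hinj), χ,
    fun ω => ⟨hK ω, h0 ω, e ω⟩⟩

theorem MapsLines.isInvariant_complex {Q : Set (Form T 1)} (h : MapsLines ⊤ Q) (hfin : Q.Finite)
    (hli : LinearIndepOn ℂ id Q) : IsInvariant ℂ Q := by
  refine ⟨hfin, fun S => ?_⟩
  obtain ⟨τ, χ, hχ⟩ := h.exists_perm hfin hli S
  exact ⟨τ, χ, fun ω => (hχ ω).2⟩

theorem MapsLines.isInvariant_real {Q : Set (Form T 1)} (h : MapsLines ⊥ Q) (hfin : Q.Finite)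
    (hli : LinearIndepOn ℂ id Q) : IsInvariant ℝ Q := by
  refine ⟨hfin, fun S => ?_⟩
  obtain ⟨τ, χ, hχ⟩ := h.exists_perm hfin hli S
  choose c hc using fun ω => IntermediateField.mem_bot.1 (hχ ω).1
  refine ⟨τ, c, fun ω => ⟨fun h0 => (hχ ω).2.1 ?_, ?_⟩⟩
  · rw [← hc, h0, map_zero]
  · rw [(hχ ω).2.2, ← hc]
    exact algebraMap_smul ℂ (c ω) _

/-- By independence the permutation must fix `ω`, so its real factor would be `ξ²`. The only real
cube root of 1 is 1, whereas `ξ` is a primitive cube root. -/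
theorem not_isInvariant_real {Q : Set (Form T 1)} (hli : LinearIndepOn ℂ id Q) {S : Symmetry T}
    {ω : Form T 1} (hω : ω ∈ Q) (h : pullback S ω = xi ^ 2 • ω) : ¬ IsInvariant ℝ Q := by
  rintro ⟨-, hinv⟩
  obtain ⟨τ, χ, hχ⟩ := hinv S
  obtain ⟨h0, e⟩ := hχ ⟨ω, hω⟩
  rw [h, ← algebraMap_smul ℂ (χ ⟨ω, hω⟩)] at e
  have hx2 : xi ^ 2 ≠ 0 := pow_ne_zero 2 (xi_primitive.ne_zero (by norm_num))
  by_cases hτ : ω = (τ ⟨ω, hω⟩ : Form T 1)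
  · rw [← hτ] at e
    have hne : ω ≠ 0 := hli.ne_zero hω
    have e1 : xi ^ 2 = ((χ ⟨ω, hω⟩ : ℝ) : ℂ) := smul_left_injective ℂ hne e
    have e2 : (χ ⟨ω, hω⟩) ^ 3 = 1 := by
      have : ((χ ⟨ω, hω⟩ : ℝ) : ℂ) ^ 3 = 1 := by
        rw [← e1, ← pow_mul, mul_comm, pow_mul, xi_pow_three, one_pow]
      exact_mod_cast this
    have e3 : χ ⟨ω, hω⟩ = 1 := by
      nlinarith [sq_nonneg (χ ⟨ω, hω⟩ + 1 / 2), sq_nonneg (χ ⟨ω, hω⟩ - 1)]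
    rw [e3, Complex.ofReal_one] at e1
    exact xi_primitive.pow_ne_one_of_pos_of_lt (by norm_num) (by norm_num) e1
  · have h2 := (LinearIndepOn.pair_iff id hτ).1
      (hli.mono (Set.insert_subset hω (Set.singleton_subset_iff.2 (τ ⟨ω, hω⟩).2))) (xi ^ 2)
      (-(algebraMap ℝ ℂ (χ ⟨ω, hω⟩))) (by simp only [id, e, neg_smul, add_neg_cancel])
    exact hx2 h2.1

end Invariance

-- The residue of the degree modulo 3

section Recursion

variable {B : ∀ {n : ℕ} (T : Affine.Simplex ℝ E n) (k : ℕ), Set (Form T k)}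

theorem mapsLines_basisP_succ
    (hB : ∀ {n : ℕ} (F : Affine.Simplex ℝ E n) (k : ℕ), n ≤ 1 → k ≤ n →
      IsBasisOf ℝ (B F k) (spaceP ℝ 0 F k))
    (hB' : ∀ F : Affine.Simplex ℝ E 2, B F 1 = triangleBasis F)
    {T : Affine.Simplex ℝ E 2} {K : IntermediateField ℝ ℂ} {r : ℕ}
    (h : MapsLines K (basisPminus B r T 1)) : MapsLines K (basisP B (r + 1) T 1) := by
  obtain ⟨Q, hQ, e⟩ := exists_basisP_succ_eq hB hB' T r
  rw [e]
  exact (mapsLines_of_lines_edgeSetP hQ).union h.image_starMap.image_neg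

theorem mapsLines_basisPminus_add_two
    (hB : ∀ {n : ℕ} (F : Affine.Simplex ℝ E n) (k : ℕ), n ≤ 1 → k ≤ n →
      IsBasisOf ℝ (B F k) (spaceP ℝ 0 F k))
    (hB' : ∀ F : Affine.Simplex ℝ E 2, B F 1 = triangleBasis F)
    {T : Affine.Simplex ℝ E 2} {K : IntermediateField ℝ ℂ} {r : ℕ}
    (h : MapsLines K (basisP B r T 1)) : MapsLines K (basisPminus B (r + 2) T 1) := by
  obtain ⟨Q, hQ, e⟩ := exists_basisPminus_add_two_eq hB hB' T r
  rw [e]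
  exact (mapsLines_of_lines_edgeSetM hQ).union h.image_starMap

/-- The induction goes from `r` to `r + 3` via `basisPminus (r + 2)`. Degree 1 starts from the empty
set and degree 2 from the Whitney forms, so `triangleBasis` is met only at multiples of 3. The first
alternative of `h` serves the complex field, the second one the reals. -/
theorem mapsLines_basisP
    (hB : ∀ {n : ℕ} (F : Affine.Simplex ℝ E n) (k : ℕ), n ≤ 1 → k ≤ n →
      IsBasisOf ℝ (B F k) (spaceP ℝ 0 F k))
    (hB' : ∀ F : Affine.Simplex ℝ E 2, B F 1 = triangleBasis F)
    {T : Affine.Simplex ℝ E 2} {K : IntermediateField ℝ ℂ} (r : ℕ)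
    (h : MapsLines K (triangleBasis T) ∨ ¬ ∃ j, r = 3 * j) : MapsLines K (basisP B r T 1) := by
  induction r using Nat.strong_induction_on with
  | _ r ih =>
  rcases r with _ | _ | _ | r
  · rw [basisP_zero, hB']
    exact h.resolve_right fun h => h ⟨0, rfl⟩
  · refine mapsLines_basisP_succ hB hB' ?_
    rw [basisPminus_zero]
    exact fun S ω hω => absurd hω (Set.notMem_empty ω)
  · exact mapsLines_basisP_succ hB hB'
      (mapsLines_of_lines_edgeSetM (exists_basisPminus_one_eq hB T))
  · refine mapsLines_basisP_succ hB hB' (mapsLines_basisPminus_add_two hB hB' (ih r (by omega) ?_))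
    refine h.imp_right fun h => ?_
    rintro ⟨j, rfl⟩
    exact h ⟨j + 1, by ring⟩

theorem mapsLines_basisPminus
    (hB : ∀ {n : ℕ} (F : Affine.Simplex ℝ E n) (k : ℕ), n ≤ 1 → k ≤ n →
      IsBasisOf ℝ (B F k) (spaceP ℝ 0 F k))
    (hB' : ∀ F : Affine.Simplex ℝ E 2, B F 1 = triangleBasis F)
    {T : Affine.Simplex ℝ E 2} {K : IntermediateField ℝ ℂ} (r : ℕ)
    (h : MapsLines K (triangleBasis T) ∨ ¬ ∃ j, r = 3 * j + 2) :
    MapsLines K (basisPminus B r T 1) := by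
  rcases r with _ | _ | r
  · rw [basisPminus_zero]
    exact fun S ω hω => absurd hω (Set.notMem_empty ω)
  · exact mapsLines_of_lines_edgeSetM (exists_basisPminus_one_eq hB T)
  · refine mapsLines_basisPminus_add_two hB hB' (mapsLines_basisP hB hB' r ?_)
    refine h.imp_right fun h => ?_
    rintro ⟨j, rfl⟩
    exact h ⟨j, rfl⟩

/-- `starMap` commutes with the rotation, so it transports an eigenform with unchanged eigenvalue
through both recursion formulas. -/
theorem exists_eigenform
    (hB : ∀ {n : ℕ} (F : Affine.Simplex ℝ E n) (k : ℕ), n ≤ 1 → k ≤ n →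
      IsBasisOf ℝ (B F k) (spaceP ℝ 0 F k))
    (hB' : ∀ F : Affine.Simplex ℝ E 2, B F 1 = triangleBasis F)
    (T : Affine.Simplex ℝ E 2) : ∃ S : Symmetry T, ∀ j,
      (∃ ω ∈ basisP B (3 * j) T 1, pullback S ω = xi ^ 2 • ω) ∧
      ∃ ω ∈ basisPminus B (3 * j + 2) T 1, pullback S ω = xi ^ 2 • ω := by
  obtain ⟨S, hS⟩ := exists_symmetry T (Equiv.addRight 1)
  have hrot : ∀ i : Fin 3, (Equiv.addRight (1 : Fin 3)) (i + 1) = Equiv.addRight 1 i + 1 ∧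
      (Equiv.addRight (1 : Fin 3)) (i + 2) = Equiv.addRight 1 i + 2 := by
    decide
  have step : ∀ r, (∃ ω ∈ basisP B r T 1, pullback S ω = xi ^ 2 • ω) →
      ∃ ω ∈ basisPminus B (r + 2) T 1, pullback S ω = xi ^ 2 • ω := by
    rintro r ⟨ω, hω, h⟩
    obtain ⟨Q, hQ, e⟩ := exists_basisPminus_add_two_eq hB hB' T r
    refine ⟨starMap T ω, e ▸ Or.inr ⟨ω, hω, rfl⟩, ?_⟩
    rw [pullback_starMap_rotation hS hrot, h, map_smul]
  refine ⟨S, fun j => ?_⟩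
  suffices h : ∃ ω ∈ basisP B (3 * j) T 1, pullback S ω = xi ^ 2 • ω from ⟨h, step _ h⟩
  induction j with
  | zero =>
    rw [mul_zero, basisP_zero, hB']
    -- The rotation shifts indices by 1, and `dλ₁ + ξ dλ₂ + ξ² dλ₀` is `ξ²` times the original form
    -- because `ξ³ = 1`.
    refine ⟨_, Or.inl rfl, ?_⟩
    have hp : pullback S (dform T 0 + xi • dform T 1 + xi ^ 2 • dform T 2) =
        dform T 1 + xi • dform T 2 + xi ^ 2 • dform T 0 := pullback_combination hS _ _
    rw [hp]
    refine Form.ext fun x v => ?_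
    simp only [add_form_apply, smul_form_apply]
    have h3 := xi_pow_three
    linear_combination (-dform T 1 x v - xi * dform T 2 x v) * h3
  | succ j ih =>
    obtain ⟨ω, hω, h⟩ := step _ ih
    obtain ⟨Q, hQ, e⟩ := exists_basisP_succ_eq hB hB' T (3 * j + 2)
    have hj : 3 * (j + 1) = 3 * j + 2 + 1 := by ring
    rw [hj, e]
    refine ⟨_, Or.inr ⟨ω, hω, rfl⟩, ?_⟩
    rw [LinearMap.neg_apply, smul_neg, ← map_smul, ← h, ← pullback_starMap_rotation hS hrot]
    rfl

end Recursion

end FEEC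

theorem mainTheorem2 {E : Type*} [NormedAddCommGroup E] [InnerProductSpace ℝ E]
    (B : ∀ {n : ℕ} (F : Affine.Simplex ℝ E n) (k : ℕ), Set (FEEC.Form F k))
    (hB : ∀ {n : ℕ} (F : Affine.Simplex ℝ E n) (k : ℕ), n ≤ 1 → k ≤ n →
      FEEC.IsBasisOf ℝ (B F k) (FEEC.spaceP ℝ 0 F k))
    (hB' : ∀ F : Affine.Simplex ℝ E 2, B F 1 = FEEC.triangleBasis F)
    (T : Affine.Simplex ℝ E 2) (r : ℕ) :
    (FEEC.IsBasisOf ℂ (FEEC.basisP B r T 1) (FEEC.spaceP ℂ r T 1) ∧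
      FEEC.IsBasisOf ℂ (FEEC.basisPminus B r T 1) (FEEC.spacePminus ℂ r T 1)) ∧
    (FEEC.IsInvariant ℂ (FEEC.basisP B r T 1) ∧
      FEEC.IsInvariant ℂ (FEEC.basisPminus B r T 1)) ∧
    (FEEC.IsInvariant ℝ (FEEC.basisP B r T 1) ↔ ¬ ∃ j : ℕ, r = 3 * j) ∧
    (FEEC.IsInvariant ℝ (FEEC.basisPminus B r T 1) ↔ ¬ ∃ j : ℕ, r = 3 * j + 2) := by
  have hP := FEEC.isBasisOf_basisP hB hB' T r
  have hM := FEEC.isBasisOf_basisPminus hB hB' T r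
  obtain ⟨⟨-, hcP⟩, -, hcM⟩ := FEEC.span_basis_triangle hB hB' T r
  have hfP := Set.finite_of_encard_le_coe hcP
  have hfM := Set.finite_of_encard_le_coe hcM
  obtain ⟨S, hS⟩ := FEEC.exists_eigenform hB hB' T
  refine ⟨⟨hP, hM⟩, ⟨?_, ?_⟩, ⟨?_, fun h => ?_⟩, ⟨?_, fun h => ?_⟩⟩
  · exact (FEEC.mapsLines_basisP hB hB' r
      (Or.inl (FEEC.mapsLines_triangleBasis T))).isInvariant_complex hfP hP.1
  · exact (FEEC.mapsLines_basisPminus hB hB' r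
      (Or.inl (FEEC.mapsLines_triangleBasis T))).isInvariant_complex hfM hM.1
  · rintro h ⟨j, rfl⟩
    obtain ⟨ω, hω, e⟩ := (hS j).1
    exact FEEC.not_isInvariant_real hP.1 hω e h
  · exact (FEEC.mapsLines_basisP hB hB' r (Or.inr h)).isInvariant_real hfP hP.1
  · rintro h ⟨j, rfl⟩
    obtain ⟨ω, hω, e⟩ := (hS j).2
    exact FEEC.not_isInvariant_real hM.1 hω e h
  · exact (FEEC.mapsLines_basisPminus hB hB' r (Or.inr h)).isInvariant_real hfM hM.1
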